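/- Let $V\in L^1(\mathbb R^3)$ be a real-valued even interaction potential with $\int (1+|p|)^2|\widehat V(p)|\,dp<\infty$, and for $N\ge 1$ put $\hbar=N^{-1/3}$. Then there are constants $C,c_2>0$ depending only on $V$ such that for every $C_0>0$ there is $c_1>0$, depending only on $V$ and $C_0$, for which the following holds. Let $N\ge1$ and let $\omega_N$ be an orthogonal projection on $L^2(\mathbb R^3)$ with $\operatorname{tr}\omega_N=N$ and $$\operatorname{tr}|[e^{ip\cdot x},\omega_N]|\le C_0N\hbar(1+|p|)\quad\text{for all }p\in\mathbb R^3,\qquad \operatorname{tr}|[\hbar\partial_j,\omega_N]|\le C_0N\hbar\quad (j=1,2,3).$$ Let $\omega_{N,t}$ be the solution of the Hartree–Fock equation $$i\hbar\,\partial_t\omega_{N,t}=[-\hbar^2\Delta+V*\rho_t-X_t,\ \omega_{N,t}],\qquad \rho_t(x)=N^{-1}\omega_{N,t}(x;x),\quad X_t(x;y)=N^{-1}V(x-y)\,\omega_{N,t}(x;y),$$ and $\widetilde\omega_{N,t}$ the solution of the Hartree equation $$i\hbar\,\partial_t\widetilde\omega_{N,t}=[-\hbar^2\Delta+V*\widetilde\rho_t,\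 \widetilde\omega_{N,t}],\qquad \widetilde\rho_t(x)=N^{-1}\widetilde\omega_{N,t}(x;x),$$ both with initial datum $\omega_N$ at $t=0$. (Solutions are paths $\mathbb R\ni t\mapsto\omega_{N,t}$ of self-adjoint trace class operators, continuous in trace norm, and the equations hold for all $t\in\mathbb R$ in the sense of sesquilinear forms on Schwartz functions.) Then $$\operatorname{tr}|\omega_{N,t}-\widetilde\omega_{N,t}|\le C\exp(c_1\exp(c_2|t|))\qquad\text{for all }t\in\mathbb R .$$ Consequently, bounds on the distance of a time-dependent one-particle density to the Hartree–Fock evolution carry over to the Hartree evolution. That is, for all $K,a,b>0$ there are $K',a',b'>0$, depending only on $V,C_0,K,a,b$, such that for all $N\geq 1$, $\omega_N,\omega_{N,t},\widetilde\omega_{N,t}$ as above and every family $(\gamma_t)_{t\in\mathbb R}$ of trace class operators on $L^2(\mathbb R^3)$, each of the four bounds 1. $\|\gamma_t-\omega_{N,t}\|_{\rm HS}\le K\exp(a\exp(b|t|))$ for all $t$, 2. $\operatorname{tr}|\gamma_t-\omega_{N,t}|\le KN^{1/2}\exp(a\exp(b|t|))$ for all $t$, 3. $\operatorname{tr}|\gamma_t-\omega_{N,t}|\le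 KN^{1/6}\exp(a\exp(b|t|))$ for all $t$, 4. $\bigl|\operatorname{tr}\,e^{ix\cdot q+\hbar p\cdot\nabla}(\gamma_t-\omega_{N,t})\bigr|\le K(1+|q|+|p|)^{1/2}\exp(a\exp(b|t|))$ for all $q,p\in\mathbb R^3$ and all $t$ implies the same bound with $\omega_{N,t},K,a,b$ replaced by $\widetilde\omega_{N,t},K',a',b'$. -/

import Mathlib

open MeasureTheory Filter Topology
open scoped ENNReal FourierTransform SchwartzMap Laplacian LineDeriv

noncomputable section

/-! ### Trace, trace norm and Hilbert-Schmidt norm on a complex Hilbert space -/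

section Trace

variable {H : Type} [NormedAddCommGroup H] [InnerProductSpace ℂ H] [CompleteSpace H]

variable (H) in
/-- The index set of a fixed Hilbert basis of `H`. -/
def traceIndex : Set H := (exists_hilbertBasis ℂ H).choose

variable (H) in
/-- A fixed Hilbert basis of `H`, used to compute traces
(traces do not depend on the choice of the basis). -/
def traceBasis : HilbertBasis (traceIndex H) ℂ H :=
  (exists_hilbertBasis ℂ H).choose_spec.choose

/-- The trace `∑ᵢ ⟨eᵢ, P eᵢ⟩ ∈ [0, ∞]` of a non-negative bounded operator `P`. -/
def posTrace (P : H →L[ℂ] H) : ℝ≥0∞ :=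
  ∑' i, ENNReal.ofReal (inner ℂ (traceBasis H i) (P (traceBasis H i))).re

/-- The trace `∑ᵢ ⟨eᵢ, A eᵢ⟩ ∈ ℂ` of a trace class operator `A`. -/
def opTrace (A : H →L[ℂ] H) : ℂ :=
  ∑' i, inner ℂ (traceBasis H i) (A (traceBasis H i))

/-- The trace norm `tr |A|` with `|A| = √(A* A)`; it is finite iff `A` is trace class. -/
def traceNorm (A : H →L[ℂ] H) : ℝ≥0∞ := posTrace (CFC.abs A)

/-- The Hilbert-Schmidt norm `(tr A* A)^{1/2}`. -/
def hsNorm (A : H →L[ℂ] H) : ℝ≥0∞ := posTrace (star A * A) ^ (1 / 2 : ℝ)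

end Trace

/-! ### Operators on `L²(ℝ³)` -/

/-- The space `ℝ³`. -/
abbrev R3 : Type := EuclideanSpace ℝ (Fin 3)

/-- The one-particle space `L²(ℝ³; ℂ)`. -/
abbrev L2R3 : Type := Lp ℂ 2 (volume : Measure R3)

/-- Bounded operators on `L²(ℝ³)`. -/
abbrev Op : Type := L2R3 →L[ℂ] L2R3

/-- A Schwartz function as an element of `L²(ℝ³)`. -/
abbrev schwartzL2 (f : 𝓢(R3, ℂ)) : L2R3 := f.toLp 2 volume

open Classical in
/-- The operator of multiplication with an essentially bounded function `φ`. -/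
def mulOp (φ : R3 → ℂ) : Op :=
  if h : MemLp φ ∞ (volume : Measure R3) then
    (ContinuousLinearMap.mul ℂ ℂ).holderL (volume : Measure R3) ∞ 2 2 (h.toLp φ)
  else 0

theorem mulOp_apply (φ : R3 → ℂ) (h : MemLp φ ∞ (volume : Measure R3)) (f : L2R3) :
    mulOp φ f =ᵐ[volume] fun x => φ x * f x := by
  have h1 : mulOp φ f = (ContinuousLinearMap.mul ℂ ℂ).holder 2 (h.toLp φ) f := by
    simp [mulOp, h]
  rw [h1]
  filter_upwards [(ContinuousLinearMap.mul ℂ ℂ).coeFn_holder (r := 2) (h.toLp φ) f,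
    h.coeFn_toLp] with x hx hx'
  rw [hx, hx']
  rfl

/-- The translation `(τ_a f)(x) = f (x + a)`, that is `τ_a = e^{a · ∇}`. -/
def translationOp (a : R3) : Op :=
  (Lp.compMeasurePreservingₗᵢ ℂ (fun x : R3 => x + a)
    (measurePreserving_add_right volume a)).toContinuousLinearMap

/-- The function `e^{i p · x}`. -/
def planeWave (p x : R3) : ℂ := Complex.exp (Complex.I * (inner ℝ p x : ℝ))

/-- The unitary operator `e^{i x · q + ħ p · ∇}`, that is
`f ↦ e^{i q · x + i ħ p · q / 2} f (x + ħ p)`. -/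
def weylOp (ħ : ℝ) (q p : R3) : Op :=
  Complex.exp (Complex.I * (ħ * inner ℝ p q / 2 : ℝ)) •
    (mulOp (planeWave q) * translationOp (ħ • p))

/-- The bounded operator `A` has the square integrable integral kernel `k`. -/
def HasKernel (A : Op) (k : R3 × R3 → ℂ) : Prop :=
  MemLp k 2 volume ∧ ∀ f : L2R3, A f =ᵐ[volume] fun x => ∫ y, k (x, y) * f y

/-! ### Semiclassical projections -/

/-- The `N`-dependent Planck constant `ħ = N^{-1/3}`. -/
def planck (N : ℕ) : ℝ := (N : ℝ) ^ (-(1 / 3) : ℝ)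

/-- `B` is the commutator `[ħ ∂_j, ω]`, in the sense of sesquilinear forms on
Schwartz functions (that is, in the sense of distribution kernels). -/
def IsGradCommutator (ħ : ℝ) (j : Fin 3) (ω B : Op) : Prop :=
  ∀ f g : 𝓢(R3, ℂ),
    inner ℂ (schwartzL2 f) (B (schwartzL2 g)) =
      - inner ℂ ((ħ : ℂ) • schwartzL2 (∂_{EuclideanSpace.single j (1 : ℝ)} f))
          (ω (schwartzL2 g))
      - inner ℂ (schwartzL2 f)
          (ω ((ħ : ℂ) • schwartzL2 (∂_{EuclideanSpace.single j (1 : ℝ)} g)))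

/-- `ω` is an orthogonal projection with `tr ω = N` and with the semiclassical structure
`tr |[e^{i p · x}, ω]| ≤ C N ħ (1 + |p|)` for all `p` and `tr |[ħ ∇, ω]| ≤ C N ħ`
(the latter for each of the three components of the gradient). -/
structure IsSemiclassicalProjection (N : ℕ) (C : ℝ) (ω : Op) : Prop where
  isProjection : IsStarProjection ω
  trace_eq : posTrace ω = N
  position : ∀ p : R3,
    traceNorm (mulOp (planeWave p) * ω - ω * mulOp (planeWave p)) ≤
      ENNReal.ofReal (C * N * planck N * (1 + ‖p‖))
  gradient : ∀ j : Fin 3, ∃ B : Op, IsGradCommutator (planck N) j ω B ∧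
    traceNorm B ≤ ENNReal.ofReal (C * N * planck N)

/-! ### Hartree-Fock and Hartree equations -/

/-- `ρ` is the normalized density `ρ (x) = N⁻¹ ω (x; x)` of the trace class operator `ω`: it is
the integrable function with `tr (φ ω) = N ∫ φ ρ` for all bounded measurable `φ`. -/
def IsDensity (N : ℕ) (ω : Op) (ρ : R3 → ℝ) : Prop :=
  Integrable ρ ∧
    ∀ φ : R3 → ℂ, Measurable φ → (∃ M : ℝ, ∀ x, ‖φ x‖ ≤ M) →
      opTrace (mulOp φ * ω) = N * ∫ x, φ x * (ρ x : ℂ)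

/-- `X` is the exchange operator of `ω`, with kernel `N⁻¹ V (x - y) ω (x; y)`. -/
def IsExchange (N : ℕ) (V : R3 → ℝ) (ω X : Op) : Prop :=
  ∃ k : R3 × R3 → ℂ, HasKernel ω k ∧
    HasKernel X fun z => (N : ℂ)⁻¹ * (V (z.1 - z.2) : ℂ) * k z

/-- The operator of multiplication with `V * ρ`. -/
def directOp (V ρ : R3 → ℝ) : Op :=
  mulOp fun x => ((∫ y, V (x - y) * ρ y : ℝ) : ℂ)

/-- A path of self-adjoint trace class operators, continuous in the trace norm. -/
structure IsDensityPath (ω : ℝ → Op) : Prop where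
  selfAdjoint : ∀ t, IsSelfAdjoint (ω t)
  traceClass : ∀ t, traceNorm (ω t) < ∞
  continuous : ∀ t, Tendsto (fun s => traceNorm (ω s - ω t)) (𝓝 t) (𝓝 0)

/-- The equation `i ħ ∂ₜ ω_t = [-ħ² Δ + B_t, ω_t]`, for all `t`, in the sense of sesquilinear
forms on Schwartz functions. -/
def SolvesVonNeumann (ħ : ℝ) (B ω : ℝ → Op) : Prop :=
  ∀ (f g : 𝓢(R3, ℂ)) (t : ℝ),
    HasDerivAt
      (fun s => Complex.I * ħ * inner ℂ (schwartzL2 f) (ω s (schwartzL2 g)))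
      (inner ℂ ((-(ħ : ℂ) ^ 2) • schwartzL2 (Δ f)) (ω t (schwartzL2 g))
        - inner ℂ (schwartzL2 f) (ω t ((-(ħ : ℂ) ^ 2) • schwartzL2 (Δ g)))
        + inner ℂ (schwartzL2 f) ((B t * ω t - ω t * B t) (schwartzL2 g)))
      t

/-- `ω` solves the Hartree-Fock equation
`i ħ ∂ₜ ω_t = [-ħ² Δ + V * ρ_t - X_t, ω_t]` with initial datum `ω₀`. -/
def IsHartreeFockSolution (N : ℕ) (V : R3 → ℝ) (ω₀ : Op) (ω : ℝ → Op) : Prop :=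
  IsDensityPath ω ∧ ω 0 = ω₀ ∧
    ∃ (ρ : ℝ → R3 → ℝ) (X : ℝ → Op),
      (∀ t, IsDensity N (ω t) (ρ t)) ∧ (∀ t, IsExchange N V (ω t) (X t)) ∧
        SolvesVonNeumann (planck N) (fun t => directOp V (ρ t) - X t) ω

/-- `ω` solves the Hartree equation `i ħ ∂ₜ ω_t = [-ħ² Δ + V * ρ_t, ω_t]` with initial
datum `ω₀`. -/
def IsHartreeSolution (N : ℕ) (V : R3 → ℝ) (ω₀ : Op) (ω : ℝ → Op) : Prop :=
  IsDensityPath ω ∧ ω 0 = ω₀ ∧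
    ∃ ρ : ℝ → R3 → ℝ,
      (∀ t, IsDensity N (ω t) (ρ t)) ∧
        SolvesVonNeumann (planck N) (fun t => directOp V (ρ t)) ω

/-! ### The bounds on the distance to the many-body evolution -/

/-- The double exponential `K exp (a exp (b |t|))`. -/
def doubleExp (K a b t : ℝ) : ℝ := K * Real.exp (a * Real.exp (b * |t|))

/-- `‖γ_t - ω_t‖_HS ≤ K exp (a exp (b |t|))` for all `t`. -/
def HSBound (K a b : ℝ) (γ ω : ℝ → Op) : Prop :=
  ∀ t, hsNorm (γ t - ω t) ≤ ENNReal.ofReal (doubleExp K a b t)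

/-- `tr |γ_t - ω_t| ≤ K N^r exp (a exp (b |t|))` for all `t`. -/
def TraceBound (N : ℕ) (r K a b : ℝ) (γ ω : ℝ → Op) : Prop :=
  ∀ t, traceNorm (γ t - ω t) ≤ ENNReal.ofReal ((N : ℝ) ^ r * doubleExp K a b t)

/-- `|tr e^{i x · q + ħ p · ∇} (γ_t - ω_t)| ≤ K (1 + |q| + |p|)^{1/2} exp (a exp (b |t|))`
for all `q`, `p`, `t`. -/
def ObservableBound (N : ℕ) (K a b : ℝ) (γ ω : ℝ → Op) : Prop :=
  ∀ (q p : R3) (t : ℝ),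
    ‖opTrace (weylOp (planck N) q p * (γ t - ω t))‖ ≤
      (1 + ‖q‖ + ‖p‖) ^ (1 / 2 : ℝ) * doubleExp K a b t

end

/-! Write `ω` for the Hartree–Fock and `ω'` for the Hartree solution. Conjugation with `e^{iħtΔ}`
removes the unbounded Laplacian. The difference `D` of the conjugated solutions then satisfies `D' =
i[A, D] + R` with `A` bounded and self-adjoint, and `tr|R| ≤ ħ⁻¹ tr|[V*(ρ-ρ') - X, ω']|`. The
commutator part leaves the trace norm unchanged, so `tr|D|` grows at most at the rate `tr|R|`
(`IsIdealNorm.le_of_hasTraceDerivAt`). The commutator in `R` is taken with the Hartree solution, for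
which the semiclassical structure is easier to propagate.

Both interactions are superpositions of plane waves `e_k`, so `R` is controlled by `tr|[e_k, ω']| ≤
C N ħ e^{c|t|}(1+|k|)`. In the direct term the Fourier transform of `ρ-ρ'` is at most `N⁻¹ tr|D|`,
and the factors `N` and `ħ` cancel. The exchange term averages `N⁻¹ e_k ω e_k*`. Since `ω'` commutes
with itself, `e_k ω e_k*` may be replaced by `e_k ω e_k* - ω'`, of trace norm at most `tr|D| +
tr|[e_k, ω']|` (`traceNorm_commutator_exchange_le`); with `Nħ ≥ 1` this costs `O(tr|D| + e^{c|t|})`.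
The inequality for `tr|D|` is therefore linear with rate `e^{c|t|}`, which yields a double
exponential without a power of `N`.

The commutator bound along the Hartree flow (`propagation`) is proved for all phase space shifts
`W(q, ħp)` at once. The free flow permutes these shifts, `p` moving to `p - 2tq`, and conjugating
`e_k` by such a shift only produces a phase at distance at most `ħ|k||p|` from 1, which compensates
`ħ⁻¹`. The resulting inequality bounds a constant `A` by `A₀ + A/2`; iterating from the trivial
bound by the trace gives `2A₀`.

The analytic basis is duality: the trace norm is a supremum of pairings with contractions
(`traceNorm_le_of_forall`), and vectors from a dense set suffice (`traceNorm_le_of_dense`). Hence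
form identities on Schwartz functions become derivatives in trace norm. The transfer of the four
bounds is the triangle inequality. -/

open MeasureTheory Filter Topology
open scoped ENNReal FourierTransform SchwartzMap Laplacian LineDeriv

noncomputable section

/-! ### Hilbert–Schmidt norm, absolute value and approximate polar decomposition. -/

section TraceClass

variable {H : Type} [NormedAddCommGroup H] [InnerProductSpace ℂ H] [CompleteSpace H]

/-- The square of the Hilbert-Schmidt norm, as a sum over the fixed basis. -/
def hsSq (A : H →L[ℂ] H) : ℝ≥0∞ := ∑' i, ‖A (traceBasis H i)‖ₑ ^ 2

omit [CompleteSpace H] in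
theorem enorm_inner_le (x y : H) : ‖inner ℂ x y‖ₑ ≤ ‖x‖ₑ * ‖y‖ₑ := by
  rw [← ofReal_norm, ← ofReal_norm, ← ofReal_norm, ← ENNReal.ofReal_mul (norm_nonneg _)]
  exact ENNReal.ofReal_le_ofReal (norm_inner_le_norm x y)

omit [CompleteSpace H] in
theorem tsum_enorm_inner_sq {ι : Type*} (b : HilbertBasis ι ℂ H) (x : H) :
    ∑' i, ‖inner ℂ (b i) x‖ₑ ^ 2 = ‖x‖ₑ ^ 2 := by
  have h := b.hasSum_inner_mul_inner x x
  have h2 : HasSum (fun i => ‖inner ℂ (b i) x‖ ^ 2) (‖x‖ ^ 2) := by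
    have := (Complex.hasSum_re h)
    convert! this using 1
    · ext i
      rw [← inner_conj_symm x (b i), ← Complex.normSq_eq_conj_mul_self, Complex.ofReal_re,
        Complex.normSq_eq_norm_sq]
    · rw [inner_self_eq_norm_sq_to_K]; norm_cast
  have h3 : ∀ y : ℂ, ‖y‖ₑ ^ 2 = ENNReal.ofReal (‖y‖ ^ 2) := fun y => by
    rw [ENNReal.ofReal_pow (norm_nonneg _), ofReal_norm]
  have h4 : ‖x‖ₑ ^ 2 = ENNReal.ofReal (‖x‖ ^ 2) := by
    rw [ENNReal.ofReal_pow (norm_nonneg _), ofReal_norm]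
  simp_rw [h3, h4]
  rw [← h2.tsum_eq, ENNReal.ofReal_tsum_of_nonneg (fun _ => by positivity) h2.summable]

/-- Parseval turns both sides into the double sum of squared matrix elements, and the order of
summation is exchanged. -/
theorem hsSq_star (A : H →L[ℂ] H) : hsSq (star A) = hsSq A := by
  unfold hsSq
  simp_rw [← tsum_enorm_inner_sq (traceBasis H) (_ : H)]
  rw [ENNReal.tsum_comm]
  congr! 4 with i j
  rw [ContinuousLinearMap.star_eq_adjoint, ContinuousLinearMap.adjoint_inner_right,
    ← inner_conj_symm, RCLike.enorm_conj]

theorem hsSq_mul_le_left (A B : H →L[ℂ] H) : hsSq (A * B) ≤ ‖A‖ₑ ^ 2 * hsSq B := by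
  unfold hsSq
  rw [← ENNReal.tsum_mul_left]
  refine ENNReal.tsum_le_tsum fun i => ?_
  rw [← mul_pow]
  gcongr
  exact A.le_opENorm _

theorem hsSq_mul_le_right (A B : H →L[ℂ] H) : hsSq (A * B) ≤ ‖B‖ₑ ^ 2 * hsSq A := by
  rw [← hsSq_star, star_mul, ← hsSq_star A]
  refine (hsSq_mul_le_left _ _).trans_eq ?_
  rw [enorm_eq_nnnorm, nnnorm_star, enorm_eq_nnnorm]

theorem enorm_sq_le_hsSq (A : H →L[ℂ] H) : ‖A‖ₑ ^ 2 ≤ hsSq A := by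
  rcases eq_or_ne (hsSq A) ∞ with h | h
  · simp [h]
  have key : ∀ x, ‖A x‖ ≤ √(hsSq A).toReal * ‖x‖ := fun x => by
    have h1 : ‖A x‖ₑ ^ 2 ≤ hsSq A * ‖x‖ₑ ^ 2 := by
      rw [← tsum_enorm_inner_sq (traceBasis H), ← hsSq_star, hsSq, ← ENNReal.tsum_mul_right]
      refine ENNReal.tsum_le_tsum fun i => ?_
      rw [← mul_pow]
      gcongr
      rw [← ContinuousLinearMap.adjoint_inner_left]
      exact enorm_inner_le _ _
    have h2 := ENNReal.toReal_mono (by finiteness) h1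
    simp only [ENNReal.toReal_pow, ENNReal.toReal_mul, toReal_enorm] at h2
    refine abs_le_of_sq_le_sq' ?_ (by positivity) |>.2
    rw [mul_pow, Real.sq_sqrt ENNReal.toReal_nonneg]
    exact h2
  have := ContinuousLinearMap.opNorm_le_bound A (by positivity) key
  rw [← ofReal_norm, ← ENNReal.ofReal_pow (norm_nonneg _)]
  refine ENNReal.ofReal_le_of_le_toReal ?_
  calc ‖A‖ ^ 2 ≤ √(hsSq A).toReal ^ 2 := by gcongr
    _ = _ := Real.sq_sqrt ENNReal.toReal_nonneg

theorem posTrace_star_mul_self (A : H →L[ℂ] H) : posTrace (star A * A) = hsSq A := by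
  unfold posTrace hsSq
  congr! 2 with i
  rw [mul_apply_eq_comp, ContinuousLinearMap.star_eq_adjoint,
    ContinuousLinearMap.adjoint_inner_right, inner_self_eq_norm_sq_to_K, ← ofReal_norm,
    ← ENNReal.ofReal_pow (norm_nonneg _)]
  norm_cast

theorem hsNorm_eq (A : H →L[ℂ] H) : hsNorm A = hsSq A ^ (1 / 2 : ℝ) := by
  rw [hsNorm, posTrace_star_mul_self]

/-- The square root of `|A|`. -/
def sqrtAbs (A : H →L[ℂ] H) : H →L[ℂ] H := CFC.sqrt (CFC.abs A)

theorem sqrtAbs_mul_self (A : H →L[ℂ] H) : sqrtAbs A * sqrtAbs A = CFC.abs A :=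
  CFC.sqrt_mul_sqrt_self _ (CFC.abs_nonneg A)

theorem star_sqrtAbs (A : H →L[ℂ] H) : star (sqrtAbs A) = sqrtAbs A :=
  (IsSelfAdjoint.of_nonneg (CFC.sqrt_nonneg (CFC.abs A))).star_eq

theorem traceNorm_eq_hsSq (A : H →L[ℂ] H) : traceNorm A = hsSq (sqrtAbs A) := by
  rw [traceNorm, ← posTrace_star_mul_self, star_sqrtAbs, sqrtAbs_mul_self]

theorem norm_apply_eq_of_star_mul_self {A B : H →L[ℂ] H} (h : star A * A = star B * B) (x : H) :
    ‖A x‖ = ‖B x‖ := by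
  have key : ∀ C : H →L[ℂ] H, inner ℂ (C x) (C x) = inner ℂ x ((star C * C) x) := fun C => by
    rw [mul_apply_eq_comp, ContinuousLinearMap.star_eq_adjoint,
      ContinuousLinearMap.adjoint_inner_right]
  have h1 := key A
  rw [h, ← key B, inner_self_eq_norm_sq_to_K, inner_self_eq_norm_sq_to_K] at h1
  have : ‖A x‖ ^ 2 = ‖B x‖ ^ 2 := by exact_mod_cast h1
  exact (sq_eq_sq₀ (norm_nonneg _) (norm_nonneg _)).1 this

theorem star_abs_eq (A : H →L[ℂ] H) : star (CFC.abs A) = CFC.abs A :=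
  (IsSelfAdjoint.of_nonneg (CFC.abs_nonneg A)).star_eq

theorem norm_abs_apply (A : H →L[ℂ] H) (x : H) : ‖CFC.abs A x‖ = ‖A x‖ :=
  norm_apply_eq_of_star_mul_self (by rw [star_abs_eq, CFC.abs_mul_abs]) x

theorem hsSq_abs (A : H →L[ℂ] H) : hsSq (CFC.abs A) = hsSq A := by
  unfold hsSq
  congr! 3 with i
  rw [← ofReal_norm, ← ofReal_norm, norm_abs_apply]

theorem enorm_le_traceNorm (A : H →L[ℂ] H) : ‖A‖ₑ ≤ traceNorm A := by
  have h : ‖A‖ ≤ ‖sqrtAbs A‖ ^ 2 := by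
    rw [← CFC.norm_abs, ← sqrtAbs_mul_self, sq]
    exact norm_mul_le _ _
  rw [traceNorm_eq_hsSq]
  refine le_trans ?_ (enorm_sq_le_hsSq _)
  rw [← ofReal_norm, ← ofReal_norm, ← ENNReal.ofReal_pow (norm_nonneg _)]
  exact ENNReal.ofReal_le_ofReal h

theorem hsSq_le_traceNorm_sq (A : H →L[ℂ] H) : hsSq A ≤ traceNorm A ^ 2 := by
  rw [← hsSq_abs, ← sqrtAbs_mul_self, sq]
  refine (hsSq_mul_le_left _ _).trans ?_
  rw [traceNorm_eq_hsSq]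
  gcongr
  exact enorm_sq_le_hsSq _

theorem hsNorm_le_traceNorm (A : H →L[ℂ] H) : hsNorm A ≤ traceNorm A := by
  rw [hsNorm_eq]
  refine (ENNReal.rpow_le_rpow (hsSq_le_traceNorm_sq A) (by norm_num)).trans_eq ?_
  rw [← ENNReal.rpow_natCast, ← ENNReal.rpow_mul]
  norm_num

theorem hsNorm_add_le (A B : H →L[ℂ] H) : hsNorm (A + B) ≤ hsNorm A + hsNorm B := by
  simp_rw [hsNorm_eq]
  rw [one_div, ENNReal.rpow_inv_le_iff (by norm_num)]
  rw [hsSq, ENNReal.tsum_eq_iSup_sum]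
  refine iSup_le fun s => ?_
  rw [← ENNReal.rpow_inv_le_iff (by norm_num), ← one_div]
  have h := ENNReal.Lp_add_le s (fun i => ‖A (traceBasis H i)‖ₑ) (fun i => ‖B (traceBasis H i)‖ₑ)
    (p := 2) (by norm_num)
  have h2 : ∀ x : ℝ≥0∞, x ^ (2 : ℝ) = x ^ 2 := fun x => by
    rw [← ENNReal.rpow_natCast]; norm_num
  simp_rw [h2] at h
  calc _ ≤ (∑ i ∈ s, (‖A (traceBasis H i)‖ₑ + ‖B (traceBasis H i)‖ₑ) ^ 2) ^ (1 / 2 : ℝ) := by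
        gcongr
        exact enorm_add_le _ _
    _ ≤ _ := h
    _ ≤ _ := by
        gcongr <;> exact ENNReal.sum_le_tsum _

/-- A contraction that approximates the partial isometry of the polar decomposition. -/
theorem exists_approx_polar (A : H →L[ℂ] H) {ε : ℝ} (hε : 0 < ε) :
    ∃ U : H →L[ℂ] H, ‖U‖ ≤ 1 ∧ ‖A - U * CFC.abs A‖ ≤ ε ∧ ‖CFC.abs A - star U * A‖ ≤ ε := by
  set P := CFC.abs A with hP
  have hP0 : 0 ≤ P := CFC.abs_nonneg A
  have hPs : IsSelfAdjoint P := IsSelfAdjoint.of_nonneg hP0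
  have hspec : ∀ x ∈ spectrum ℝ P, 0 ≤ x := fun x hx => spectrum_nonneg_of_nonneg hP0 hx
  -- With `G = (|A|+ε)⁻¹` and `U = A G`, the identity `1 - |A|G = ε G` makes the two errors equal to
  -- `ε A G` and `ε |A| G`, both of norm at most `ε`. No partial isometry is needed.
  set g : ℝ → ℝ := fun x => (x + ε)⁻¹ with hg
  have hgc : ContinuousOn g (spectrum ℝ P) := by
    refine ContinuousOn.inv₀ (by fun_prop) fun x hx => ?_
    have := hspec x hx; positivity
  set G : H →L[ℂ] H := cfc g P with hG
  have hGs : star G = G := (cfc_predicate g P : IsSelfAdjoint _).star_eq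
  have hPG : P * G = cfc (fun x => x * g x) P := by
    rw [cfc_mul (fun x => x) g P (by fun_prop) hgc, cfc_id' ℝ P]
  have hGP : G * P = P * G := by
    rw [hPG, ← cfc_id' ℝ P, hG, ← cfc_mul g (fun x => x) P hgc (by fun_prop)]
    simp_rw [mul_comm]
    rw [cfc_id' ℝ P]
  have hPGn : ‖P * G‖ ≤ 1 := by
    rw [hPG]
    refine norm_cfc_le zero_le_one fun x hx => ?_
    have := hspec x hx
    rw [Real.norm_of_nonneg (by positivity), hg, ← div_eq_mul_inv, div_le_one (by positivity)]
    linarith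
  have hone : 1 - P * G = (ε : ℂ) • G := by
    have h1 : (1 : H →L[ℂ] H) = cfc (fun _ => (1 : ℝ)) P := (cfc_const_one ℝ P).symm
    have h2 : (ε : ℂ) • G = ε • G := by ext x; simp
    rw [h2, h1, hPG, ← cfc_sub (fun _ => (1 : ℝ)) (fun x => x * g x) P (by fun_prop)
      (continuousOn_id.mul hgc), hG, ← cfc_smul ε g P hgc]
    refine cfc_congr fun x hx => ?_
    have := hspec x hx
    simp only [hg, smul_eq_mul]
    field_simp
    ring
  have hU : ‖A * G‖ ≤ 1 := by
    refine (ContinuousLinearMap.opNorm_le_bound _ zero_le_one fun x => ?_)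
    rw [mul_apply_eq_comp, ← norm_abs_apply, ← hP, ← mul_apply_eq_comp]
    exact (P * G).le_of_opNorm_le hPGn x
  refine ⟨A * G, hU, ?_, ?_⟩
  · have : A - A * G * P = (ε : ℂ) • (A * G) := by
      rw [mul_assoc, hGP, ← mul_smul_comm, ← hone]; noncomm_ring
    rw [this, norm_smul, Complex.norm_real, Real.norm_of_nonneg hε.le]
    nlinarith
  · have : P - star (A * G) * A = (ε : ℂ) • (P * G) := by
      rw [star_mul, hGs, mul_assoc, ← CFC.abs_mul_abs, ← mul_assoc, ← hP, hGP, mul_assoc,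
        ← hGP, ← mul_assoc, ← hGP]
      rw [hGP]
      have : P - P * G * P = P * (1 - P * G) := by rw [mul_assoc, hGP]; noncomm_ring
      rw [this, hone, mul_smul_comm]
    rw [this, norm_smul, Complex.norm_real, Real.norm_of_nonneg hε.le]
    nlinarith

end TraceClass

/-! ### Trace norm by duality: triangle inequality, ideal property, trace. -/

section TraceNorm

variable {H : Type} [NormedAddCommGroup H] [InnerProductSpace ℂ H] [CompleteSpace H]

theorem ENNReal.sum_mul_le_sqrt {ι : Type*} (s : Finset ι) (f g : ι → ℝ≥0∞) :
    ∑ i ∈ s, f i * g i ≤ (∑ i ∈ s, f i ^ 2) ^ (1 / 2 : ℝ) * (∑ i ∈ s, g i ^ 2) ^ (1 / 2 : ℝ) := by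
  have h2 : ∀ x : ℝ≥0∞, x ^ (2 : ℝ) = x ^ 2 := fun x => by
    rw [← ENNReal.rpow_natCast]; norm_num
  have := ENNReal.inner_le_Lp_mul_Lq s f g (p := 2) (q := 2) ⟨by norm_num, by norm_num, by norm_num⟩
  simpa only [h2] using this

theorem ENNReal.sq_rpow_half (x : ℝ≥0∞) : (x ^ 2) ^ (1 / 2 : ℝ) = x := by
  rw [← ENNReal.rpow_natCast, ← ENNReal.rpow_mul]; norm_num

theorem ENNReal.rpow_half_mul_self (x : ℝ≥0∞) : x ^ (1 / 2 : ℝ) * x ^ (1 / 2 : ℝ) = x := by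
  rw [← ENNReal.rpow_add_of_nonneg _ _ (by norm_num) (by norm_num)]; norm_num

theorem enorm_mul_le_of_le_one {A B : H →L[ℂ] H} (hA : ‖A‖ ≤ 1) : ‖A * B‖ₑ ≤ ‖B‖ₑ := by
  rw [← ofReal_norm, ← ofReal_norm]
  refine ENNReal.ofReal_le_ofReal ((norm_mul_le _ _).trans ?_)
  nlinarith [norm_nonneg B]

/-- The pairing of an operator with two families of vectors, refined. -/
theorem sum_enorm_inner_le_sqrt (A U W : H →L[ℂ] H) (F : Finset (traceIndex H)) :
    ∑ i ∈ F, ‖inner ℂ (U (traceBasis H i)) (A (W (traceBasis H i)))‖ₑ ≤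
      ‖U‖ₑ * (traceNorm A ^ (1 / 2 : ℝ) * hsSq (sqrtAbs A * W) ^ (1 / 2 : ℝ)) := by
  have hn : ∀ i, ‖traceBasis H i‖ = 1 := (traceBasis H).orthonormal.1
  have key : ∀ ε : ℝ, 0 < ε →
      ∑ i ∈ F, ‖inner ℂ (U (traceBasis H i)) (A (W (traceBasis H i)))‖ₑ ≤
        ‖U‖ₑ * (traceNorm A ^ (1 / 2 : ℝ) * hsSq (sqrtAbs A * W) ^ (1 / 2 : ℝ)) +
          ENNReal.ofReal (F.card * (‖U‖ * (ε * ‖W‖))) := by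
    intro ε hε
    obtain ⟨T, hT, hAT, -⟩ := exists_approx_polar A hε
    set S := sqrtAbs A
    have h1 : ∀ i, ‖inner ℂ (U (traceBasis H i)) (A (W (traceBasis H i)))‖ₑ ≤
        ‖(S * (star T * U)) (traceBasis H i)‖ₑ * ‖(S * W) (traceBasis H i)‖ₑ +
          ENNReal.ofReal (‖U‖ * (ε * ‖W‖)) := by
      intro i
      set e := traceBasis H i
      -- Up to an error of order `ε`, `A` is `T S S` with `S = |A|^{1/2}`. One factor `S` moves to
      -- the left vector, which prepares Cauchy–Schwarz in Hilbert–Schmidt norm.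
      have hs : inner ℂ (U e) (A (W e)) =
          inner ℂ ((S * (star T * U)) e) ((S * W) e) +
            inner ℂ (U e) ((A - T * CFC.abs A) (W e)) := by
        have : inner ℂ ((S * (star T * U)) e) ((S * W) e) =
            inner ℂ (U e) ((T * CFC.abs A) (W e)) := by
          rw [← sqrtAbs_mul_self]
          simp only [mul_apply_eq_comp, ContinuousLinearMap.star_eq_adjoint, S]
          conv_lhs => rw [← star_sqrtAbs, ContinuousLinearMap.star_eq_adjoint,
            ContinuousLinearMap.adjoint_inner_left, ContinuousLinearMap.adjoint_inner_left,
            ← ContinuousLinearMap.star_eq_adjoint, star_sqrtAbs]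
        rw [this, ← inner_add_right]
        simp
      rw [hs]
      refine (enorm_add_le _ _).trans (add_le_add (enorm_inner_le _ _) ?_)
      rw [← ofReal_norm]
      refine ENNReal.ofReal_le_ofReal ((norm_inner_le_norm _ _).trans ?_)
      have h2 : ‖U e‖ ≤ ‖U‖ := by simpa [e, hn] using U.le_opNorm e
      have h3 : ‖W e‖ ≤ ‖W‖ := by simpa [e, hn] using W.le_opNorm e
      have h4 := (A - T * CFC.abs A).le_of_opNorm_le hAT (W e)
      gcongr
      exact h4.trans (by gcongr)
    refine (Finset.sum_le_sum fun i _ => h1 i).trans ?_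
    rw [Finset.sum_add_distrib]
    refine add_le_add ?_ (le_of_eq ?_)
    · refine (ENNReal.sum_mul_le_sqrt _ _ _).trans ?_
      rw [← mul_assoc ‖U‖ₑ]
      gcongr
      · refine (ENNReal.rpow_le_rpow ((ENNReal.sum_le_tsum F).trans
          (hsSq_mul_le_right S (star T * U))) (by norm_num)).trans ?_
        rw [ENNReal.mul_rpow_of_nonneg _ _ (by norm_num), ENNReal.sq_rpow_half, traceNorm_eq_hsSq]
        gcongr
        exact enorm_mul_le_of_le_one (by rwa [norm_star])
      · exact ENNReal.sum_le_tsum F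
    · rw [Finset.sum_const, nsmul_eq_mul, ENNReal.ofReal_mul (by positivity : (0 : ℝ) ≤ F.card),
        ENNReal.ofReal_natCast]
  refine ge_of_tendsto (x := 𝓝[>] (0 : ℝ)) (f := fun ε =>
    ‖U‖ₑ * (traceNorm A ^ (1 / 2 : ℝ) * hsSq (sqrtAbs A * W) ^ (1 / 2 : ℝ)) +
          ENNReal.ofReal (F.card * (‖U‖ * (ε * ‖W‖)))) ?_ ?_
  · have : Tendsto (fun ε : ℝ => ENNReal.ofReal (F.card * (‖U‖ * (ε * ‖W‖)))) (𝓝[>] 0) (𝓝 0) := by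
      have : Continuous fun ε : ℝ => ENNReal.ofReal (F.card * (‖U‖ * (ε * ‖W‖))) :=
        ENNReal.continuous_ofReal.comp (by fun_prop)
      simpa using (this.tendsto 0).mono_left nhdsWithin_le_nhds
    simpa using tendsto_const_nhds.add this
  · filter_upwards [self_mem_nhdsWithin] with ε hε using key ε hε

/-- The cruder form, in which `W` is only bounded. The version above keeps the Hilbert–Schmidt norm
of `S W`, which is small when `W` is merely strongly small. -/
theorem sum_enorm_inner_le (A U W : H →L[ℂ] H) (F : Finset (traceIndex H)) :
    ∑ i ∈ F, ‖inner ℂ (U (traceBasis H i)) (A (W (traceBasis H i)))‖ₑ ≤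
      ‖U‖ₑ * ‖W‖ₑ * traceNorm A := by
  refine (sum_enorm_inner_le_sqrt A U W F).trans ?_
  rw [mul_assoc ‖U‖ₑ]
  refine mul_le_mul_right ?_ _
  calc traceNorm A ^ (1 / 2 : ℝ) * hsSq (sqrtAbs A * W) ^ (1 / 2 : ℝ)
      ≤ traceNorm A ^ (1 / 2 : ℝ) * (‖W‖ₑ * traceNorm A ^ (1 / 2 : ℝ)) := by
        gcongr
        refine (ENNReal.rpow_le_rpow (hsSq_mul_le_right _ W) (by norm_num)).trans ?_
        rw [ENNReal.mul_rpow_of_nonneg _ _ (by norm_num), ENNReal.sq_rpow_half, traceNorm_eq_hsSq]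
    _ = ‖W‖ₑ * traceNorm A := by
        rw [mul_left_comm, ENNReal.rpow_half_mul_self]

/-- The trace norm is the supremum of the pairings with contractions. -/
theorem traceNorm_le_of_forall {A : H →L[ℂ] H} {M : ℝ≥0∞}
    (h : ∀ U : H →L[ℂ] H, ‖U‖ ≤ 1 → ∀ F : Finset (traceIndex H),
      ‖∑ i ∈ F, inner ℂ (U (traceBasis H i)) (A (traceBasis H i))‖ₑ ≤ M) :
    traceNorm A ≤ M := by
  have hn : ∀ i, ‖traceBasis H i‖ = 1 := (traceBasis H).orthonormal.1
  rw [traceNorm, posTrace, ENNReal.tsum_eq_iSup_sum]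
  refine iSup_le fun F => ?_
  have key : ∀ ε : ℝ, 0 < ε →
      ∑ i ∈ F, ENNReal.ofReal (inner ℂ (traceBasis H i) (CFC.abs A (traceBasis H i))).re ≤
        M + ENNReal.ofReal (F.card * ε) := by
    intro ε hε
    obtain ⟨T, hT, -, hAT⟩ := exists_approx_polar A hε
    have hpos : ∀ i, 0 ≤ (inner ℂ (traceBasis H i) (CFC.abs A (traceBasis H i))).re := by
      intro i
      have := (ContinuousLinearMap.nonneg_iff_isPositive _).1 (CFC.abs_nonneg A)
      exact (this.re_inner_nonneg_right (traceBasis H i))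
    rw [← ENNReal.ofReal_sum_of_nonneg fun i _ => hpos i]
    have hle : ∑ i ∈ F, (inner ℂ (traceBasis H i) (CFC.abs A (traceBasis H i))).re ≤
        ‖∑ i ∈ F, inner ℂ (T (traceBasis H i)) (A (traceBasis H i))‖ + F.card * ε := by
      have h1 : ∀ i, (inner ℂ (traceBasis H i) (CFC.abs A (traceBasis H i))).re ≤
          (inner ℂ (T (traceBasis H i)) (A (traceBasis H i))).re + ε := by
        intro i
        set e := traceBasis H i
        -- The contraction that nearly attains the supremum is the approximate polar factor `T`:
        -- `|A|` is `T* A` up to `ε`.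
        have : inner ℂ e (CFC.abs A e) =
            inner ℂ (T e) (A e) + inner ℂ e ((CFC.abs A - star T * A) e) := by
          rw [← ContinuousLinearMap.adjoint_inner_right, ← inner_add_right]
          simp [ContinuousLinearMap.star_eq_adjoint]
        rw [this, Complex.add_re]
        gcongr
        refine (Complex.re_le_norm _).trans ((norm_inner_le_norm _ _).trans ?_)
        have h4 := (CFC.abs A - star T * A).le_of_opNorm_le hAT e
        rw [hn] at h4 ⊢
        linarith
      refine (Finset.sum_le_sum fun i _ => h1 i).trans ?_
      rw [Finset.sum_add_distrib, Finset.sum_const, nsmul_eq_mul, ← Complex.re_sum]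
      gcongr
      exact Complex.re_le_norm _
    refine (ENNReal.ofReal_le_ofReal hle).trans ?_
    rw [ENNReal.ofReal_add (by positivity) (by positivity), ofReal_norm]
    gcongr
    exact h T hT F
  refine ge_of_tendsto (x := 𝓝[>] (0 : ℝ)) (f := fun ε => M + ENNReal.ofReal (F.card * ε)) ?_ ?_
  · have : Tendsto (fun ε : ℝ => ENNReal.ofReal (F.card * ε)) (𝓝[>] 0) (𝓝 0) := by
      have : Continuous fun ε : ℝ => ENNReal.ofReal (F.card * ε) :=
        ENNReal.continuous_ofReal.comp (by fun_prop)
      simpa using (this.tendsto 0).mono_left nhdsWithin_le_nhds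
    simpa using tendsto_const_nhds.add this
  · filter_upwards [self_mem_nhdsWithin] with ε hε using key ε hε

theorem enorm_sum_inner_le_traceNorm (A : H →L[ℂ] H) {U : H →L[ℂ] H} (hU : ‖U‖ ≤ 1)
    (F : Finset (traceIndex H)) :
    ‖∑ i ∈ F, inner ℂ (U (traceBasis H i)) (A (traceBasis H i))‖ₑ ≤ traceNorm A := by
  refine (enorm_sum_le _ _).trans ?_
  have := sum_enorm_inner_le A U 1 F
  simp only [one_apply_eq_self] at this
  refine this.trans ?_
  have h1 : ‖U‖ₑ * ‖(1 : H →L[ℂ] H)‖ₑ ≤ 1 := by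
    rw [← ofReal_norm, ← ofReal_norm, ← ENNReal.ofReal_mul (norm_nonneg _)]
    refine ENNReal.ofReal_le_one.2 ?_
    exact mul_le_one₀ hU (norm_nonneg _) ContinuousLinearMap.norm_id_le
  exact (mul_le_mul_left h1 _).trans_eq (one_mul _)

/-- The absolute value is not subadditive as an operator; the pairings with a fixed contraction are
additive. -/
theorem traceNorm_add_le (A B : H →L[ℂ] H) : traceNorm (A + B) ≤ traceNorm A + traceNorm B := by
  refine traceNorm_le_of_forall fun U hU F => ?_
  simp only [_root_.add_apply, inner_add_right, Finset.sum_add_distrib]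
  exact (enorm_add_le _ _).trans (add_le_add (enorm_sum_inner_le_traceNorm A hU F)
    (enorm_sum_inner_le_traceNorm B hU F))

theorem traceNorm_mul_le_left (B A : H →L[ℂ] H) : traceNorm (B * A) ≤ ‖B‖ₑ * traceNorm A := by
  refine traceNorm_le_of_forall fun U hU F => ?_
  have := sum_enorm_inner_le A (star B * U) 1 F
  simp only [mul_apply_eq_comp, ContinuousLinearMap.star_eq_adjoint,
    ContinuousLinearMap.adjoint_inner_left, one_apply_eq_self] at this ⊢
  refine (enorm_sum_le _ _).trans (this.trans ?_)
  gcongr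
  rw [← ofReal_norm, ← ofReal_norm, ← ofReal_norm, ← ENNReal.ofReal_mul (norm_nonneg _)]
  refine ENNReal.ofReal_le_ofReal ?_
  have h1 : ‖ContinuousLinearMap.adjoint B * U‖ ≤ ‖B‖ * 1 :=
    (norm_mul_le _ _).trans (mul_le_mul (by simp) hU (norm_nonneg _) (norm_nonneg _))
  calc _ ≤ ‖ContinuousLinearMap.adjoint B * U‖ * 1 := by
        gcongr; exact ContinuousLinearMap.norm_id_le
    _ ≤ _ := by simpa using h1

theorem traceNorm_mul_le_right (A B : H →L[ℂ] H) : traceNorm (A * B) ≤ traceNorm A * ‖B‖ₑ := by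
  refine traceNorm_le_of_forall fun U hU F => ?_
  have := sum_enorm_inner_le A U B F
  simp only [mul_apply_eq_comp] at this ⊢
  refine (enorm_sum_le _ _).trans (this.trans ?_)
  rw [mul_comm (traceNorm A)]
  gcongr
  rw [← ofReal_norm, ← ofReal_norm, ← ENNReal.ofReal_mul (norm_nonneg _)]
  exact ENNReal.ofReal_le_ofReal (mul_le_of_le_one_left (norm_nonneg _) hU)

theorem traceNorm_star_le (A : H →L[ℂ] H) : traceNorm (star A) ≤ traceNorm A := by
  refine traceNorm_le_of_forall fun U hU F => ?_
  have := sum_enorm_inner_le A 1 U F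
  refine (enorm_sum_le _ _).trans (le_trans (le_of_eq ?_) (this.trans ?_))
  · refine Finset.sum_congr rfl fun i _ => ?_
    rw [ContinuousLinearMap.star_eq_adjoint, ContinuousLinearMap.adjoint_inner_right,
      ← inner_conj_symm, RCLike.enorm_conj]
    rfl
  have h1 : ‖(1 : H →L[ℂ] H)‖ₑ * ‖U‖ₑ ≤ 1 := by
    rw [← ofReal_norm, ← ofReal_norm, ← ENNReal.ofReal_mul (norm_nonneg _)]
    refine ENNReal.ofReal_le_one.2 ?_
    exact mul_le_one₀ ContinuousLinearMap.norm_id_le (norm_nonneg _) hU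
  exact (mul_le_mul_left h1 _).trans_eq (one_mul _)

theorem traceNorm_star (A : H →L[ℂ] H) : traceNorm (star A) = traceNorm A :=
  le_antisymm (traceNorm_star_le A) (by simpa using traceNorm_star_le (star A))

theorem traceNorm_neg (A : H →L[ℂ] H) : traceNorm (-A) = traceNorm A := by
  rw [traceNorm, CFC.abs_neg, traceNorm]

theorem traceNorm_sub_comm (A B : H →L[ℂ] H) : traceNorm (A - B) = traceNorm (B - A) := by
  rw [← traceNorm_neg, neg_sub]

theorem traceNorm_sub_le (A B : H →L[ℂ] H) : traceNorm (A - B) ≤ traceNorm A + traceNorm B := by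
  rw [sub_eq_add_neg, ← traceNorm_neg B]
  exact traceNorm_add_le _ _

theorem traceNorm_zero : traceNorm (0 : H →L[ℂ] H) = 0 := by
  rw [traceNorm, CFC.abs_zero, posTrace]; simp

theorem traceNorm_smul_le (c : ℂ) (A : H →L[ℂ] H) : traceNorm (c • A) ≤ ‖c‖ₑ * traceNorm A := by
  refine traceNorm_le_of_forall fun U hU F => ?_
  simp only [_root_.smul_apply, inner_smul_right, ← Finset.mul_sum, enorm_mul]
  gcongr
  exact enorm_sum_inner_le_traceNorm A hU F

theorem traceNorm_of_nonneg {A : H →L[ℂ] H} (h : 0 ≤ A) : traceNorm A = posTrace A := by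
  rw [traceNorm, CFC.abs_of_nonneg A h]

theorem tsum_enorm_inner_le_traceNorm (A : H →L[ℂ] H) :
    ∑' i, ‖inner ℂ (traceBasis H i) (A (traceBasis H i))‖ₑ ≤ traceNorm A := by
  rw [ENNReal.tsum_eq_iSup_sum]
  refine iSup_le fun F => ?_
  refine (sum_enorm_inner_le A 1 1 F).trans ?_
  have h1 : ‖(1 : H →L[ℂ] H)‖ₑ * ‖(1 : H →L[ℂ] H)‖ₑ ≤ 1 := by
    rw [← ofReal_norm]
    exact mul_le_one' (ENNReal.ofReal_le_one.2 ContinuousLinearMap.norm_id_le)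
      (ENNReal.ofReal_le_one.2 ContinuousLinearMap.norm_id_le)
  exact (mul_le_mul_left h1 _).trans_eq (one_mul _)

theorem summable_inner_of_traceNorm {A : H →L[ℂ] H} (h : traceNorm A < ∞) :
    Summable fun i => inner ℂ (traceBasis H i) (A (traceBasis H i)) := by
  refine Summable.of_norm ?_
  have := (tsum_enorm_inner_le_traceNorm A).trans_lt h
  exact (ENNReal.summable_toReal this.ne).congr fun i => by simp

theorem enorm_opTrace_le (A : H →L[ℂ] H) : ‖opTrace A‖ₑ ≤ traceNorm A :=
  enorm_tsum_le_tsum_enorm.trans (tsum_enorm_inner_le_traceNorm A)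

theorem opTrace_add {A B : H →L[ℂ] H} (hA : traceNorm A < ∞) (hB : traceNorm B < ∞) :
    opTrace (A + B) = opTrace A + opTrace B := by
  simp only [opTrace, _root_.add_apply, inner_add_right]
  exact (summable_inner_of_traceNorm hA).tsum_add (summable_inner_of_traceNorm hB)

theorem opTrace_sub {A B : H →L[ℂ] H} (hA : traceNorm A < ∞) (hB : traceNorm B < ∞) :
    opTrace (A - B) = opTrace A - opTrace B := by
  simp only [opTrace, _root_.sub_apply, inner_sub_right]
  exact (summable_inner_of_traceNorm hA).tsum_sub (summable_inner_of_traceNorm hB)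

end TraceNorm

/-! ### Testing on dense sets, and differentiation in trace norm. -/

section TraceDeriv

variable {H : Type} [NormedAddCommGroup H] [InnerProductSpace ℂ H] [CompleteSpace H]

/-- The finite rank operator that maps the basis vector `e i` to `f i` for `i ∈ F`. -/
def finiteRank (F : Finset (traceIndex H)) (f : traceIndex H → H) : H →L[ℂ] H :=
  ∑ i ∈ F, (innerSL ℂ (traceBasis H i)).smulRight (f i)

theorem finiteRank_apply (F : Finset (traceIndex H)) (f : traceIndex H → H) (x : H) :
    finiteRank F f x = ∑ i ∈ F, inner ℂ (traceBasis H i) x • f i := by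
  simp [finiteRank]

theorem finiteRank_apply_basis (F : Finset (traceIndex H)) (f : traceIndex H → H)
    {j : traceIndex H} (hj : j ∈ F) : finiteRank F f (traceBasis H j) = f j := by
  classical
  rw [finiteRank_apply]
  simp_rw [orthonormal_iff_ite.1 (traceBasis H).orthonormal]
  simp [hj]

/-- The operator is the orthogonal projection onto the span of finitely many basis vectors. -/
theorem norm_finiteRank_basis_le (F : Finset (traceIndex H)) :
    ‖finiteRank F (traceBasis H)‖ ≤ 1 := by
  refine ContinuousLinearMap.opNorm_le_bound _ zero_le_one fun x => ?_
  rw [one_mul]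
  set y := finiteRank F (traceBasis H) x with hy
  have h : inner ℂ y y = inner ℂ x y := by
    rw [hy, finiteRank_apply, (traceBasis H).orthonormal.inner_sum, inner_sum]
    refine Finset.sum_congr rfl fun i _ => ?_
    rw [inner_smul_right, inner_conj_symm, mul_comm]
  have h2 : ‖y‖ ^ 2 ≤ ‖x‖ * ‖y‖ := by
    have := norm_inner_le_norm (𝕜 := ℂ) x y
    rw [← h, inner_self_eq_norm_sq_to_K] at this
    simpa using this
  by_contra! hlt
  nlinarith [norm_nonneg x]

theorem finiteRank_comp_basis (F : Finset (traceIndex H)) (U : H →L[ℂ] H) :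
    finiteRank F (fun i => U (traceBasis H i)) = U * finiteRank F (traceBasis H) := by
  ext x
  simp [finiteRank_apply]

theorem continuous_finiteRank (F : Finset (traceIndex H)) :
    Continuous (finiteRank F : (traceIndex H → H) → H →L[ℂ] H) := by
  refine continuous_finsetSum F fun i _ => ?_
  exact ((ContinuousLinearMap.smulRightL ℂ H H (innerSL ℂ (traceBasis H i))).continuous).comp
    (continuous_apply i)

/-- The families `f`, `g` enter through the norms of finite rank operators, so the right side
depends continuously on them. This allows restricting to a dense set of vectors. -/
theorem norm_sum_inner_le_of_traceNorm_le {A : H →L[ℂ] H} {M : ℝ} (hM : 0 ≤ M)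
    (hA : traceNorm A ≤ ENNReal.ofReal M) (F : Finset (traceIndex H)) (f g : traceIndex H → H) :
    ‖∑ i ∈ F, inner ℂ (f i) (A (g i))‖ ≤ ‖finiteRank F f‖ * ‖finiteRank F g‖ * M := by
  have h := (sum_enorm_inner_le A (finiteRank F f) (finiteRank F g) F).trans
    (mul_le_mul_right hA _)
  have h2 : ‖∑ i ∈ F, inner ℂ (f i) (A (g i))‖ₑ ≤
      ‖finiteRank F f‖ₑ * ‖finiteRank F g‖ₑ * ENNReal.ofReal M := by
    refine (enorm_sum_le _ _).trans (le_trans (le_of_eq ?_) h)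
    refine Finset.sum_congr rfl fun i hi => ?_
    rw [finiteRank_apply_basis F f hi, finiteRank_apply_basis F g hi]
  rw [← ofReal_norm, ← ofReal_norm, ← ofReal_norm, ← ENNReal.ofReal_mul (norm_nonneg _),
    ← ENNReal.ofReal_mul (by positivity), ENNReal.ofReal_le_ofReal_iff (by positivity)] at h2
  exact h2

/-- The trace norm is determined by the pairings with families from a dense set. -/
theorem traceNorm_le_of_dense {S : Set H} (hS : Dense S) {A : H →L[ℂ] H} {M : ℝ} (hM : 0 ≤ M)
    (h : ∀ (F : Finset (traceIndex H)) (f g : traceIndex H → H), (∀ i, f i ∈ S) → (∀ i, g i ∈ S) →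
      ‖∑ i ∈ F, inner ℂ (f i) (A (g i))‖ ≤ ‖finiteRank F f‖ * ‖finiteRank F g‖ * M) :
    traceNorm A ≤ ENNReal.ofReal M := by
  have key : ∀ (F : Finset (traceIndex H)) (z : (traceIndex H → H) × (traceIndex H → H)),
      ‖∑ i ∈ F, inner ℂ (z.1 i) (A (z.2 i))‖ ≤
        ‖finiteRank F z.1‖ * ‖finiteRank F z.2‖ * M := by
    intro F
    have hd : Dense ((Set.univ.pi fun _ : traceIndex H => S) ×ˢ
        (Set.univ.pi fun _ : traceIndex H => S)) :=
      (dense_pi _ fun _ _ => hS).prod (dense_pi _ fun _ _ => hS)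
    have hc1 := continuous_finiteRank (H := H) F
    refine isClosed_property hd.denseRange_val (isClosed_le ?_ ?_) ?_
    · refine Continuous.norm (continuous_finsetSum F fun i _ => Continuous.inner ?_ ?_)
      · fun_prop
      · fun_prop
    · exact ((hc1.comp continuous_fst).norm.mul (hc1.comp continuous_snd).norm).mul_const M
    · rintro ⟨z, hz1, hz2⟩
      exact h F _ _ (fun i => hz1 i trivial) (fun i => hz2 i trivial)
  refine traceNorm_le_of_forall fun U hU F => ?_
  rw [← ofReal_norm]
  refine ENNReal.ofReal_le_ofReal ((key F (fun i => U (traceBasis H i), traceBasis H)).trans ?_)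
  have h1 := norm_finiteRank_basis_le F
  have h2 : ‖finiteRank F fun i => U (traceBasis H i)‖ ≤ 1 := by
    rw [finiteRank_comp_basis]
    exact (norm_mul_le _ _).trans (mul_le_one₀ hU (norm_nonneg _) h1)
  exact mul_le_of_le_one_left hM (mul_le_one₀ h2 (norm_nonneg _) h1)

/-- Multiplication from the right with contractions is trace norm continuous. -/
theorem tendsto_traceNorm_mul_sub {α : Type*} {l : Filter α} {K : H →L[ℂ] H}
    (hK : traceNorm K < ∞) {U : α → H →L[ℂ] H} (hU : ∀ a, ‖U a‖ ≤ 1)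
    (hconv : ∀ x, Tendsto (fun a => star (U a) x) l (𝓝 x)) :
    Tendsto (fun a => traceNorm (K * U a - K)) l (𝓝 0) := by
  set S := sqrtAbs K with hS
  have hfin : hsSq S < ∞ := by rwa [hS, ← traceNorm_eq_hsSq]
  have hsum : Summable fun i => ‖S (traceBasis H i)‖ ^ 2 :=
    (ENNReal.summable_toReal hfin.ne).congr fun i => by simp
  -- Factoring `K` through `S = |K|^{1/2}` leaves the Hilbert–Schmidt norm of `(U* - 1)S`. It tends
  -- to zero by dominated convergence over the basis, as `U*` converges strongly to the identity.
  have h1 : ∀ a, traceNorm (K * U a - K) ≤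
      traceNorm K ^ (1 / 2 : ℝ) * hsSq (star (U a) * S - S) ^ (1 / 2 : ℝ) := by
    intro a
    refine traceNorm_le_of_forall fun V hV F => ?_
    have := sum_enorm_inner_le_sqrt K V (U a - 1) F
    refine (enorm_sum_le _ _).trans (le_trans (le_of_eq ?_) (this.trans ?_))
    · simp
    · rw [← hS, ← hsSq_star (S * (U a - 1))]
      have : star (S * (U a - 1)) = star (U a) * S - S := by
        rw [star_mul, hS, star_sqrtAbs, star_sub, star_one, sub_mul, one_mul]
      rw [this]
      refine mul_le_of_le_one_left' ?_
      rw [← ofReal_norm]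
      exact ENNReal.ofReal_le_one.2 hV
  have h2 : Tendsto (fun a => ∑' i, ‖(star (U a) * S - S) (traceBasis H i)‖ ^ 2) l
      (𝓝 (∑' _ : traceIndex H, 0)) := by
    refine tendsto_tsum_of_dominated_convergence (bound := fun i => 4 * ‖S (traceBasis H i)‖ ^ 2)
      (hsum.mul_left 4) (fun i => ?_) (Eventually.of_forall fun a i => ?_)
    · have := (tendsto_iff_norm_sub_tendsto_zero.1 (hconv (S (traceBasis H i)))).pow 2
      simpa using this
    · have h3 : ‖star (U a) (S (traceBasis H i))‖ ≤ 1 * ‖S (traceBasis H i)‖ :=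
        (star (U a)).le_of_opNorm_le (by rw [norm_star]; exact hU a) _
      have h4 : ‖(star (U a) * S - S) (traceBasis H i)‖ ≤ 2 * ‖S (traceBasis H i)‖ := by
        refine (norm_sub_le (star (U a) (S (traceBasis H i))) (S (traceBasis H i))).trans ?_
        linarith
      rw [Real.norm_of_nonneg (by positivity)]
      calc _ ≤ (2 * ‖S (traceBasis H i)‖) ^ 2 := by gcongr
        _ = _ := by ring
  have h5 : Tendsto (fun a => hsSq (star (U a) * S - S)) l (𝓝 0) := by
    have h6 : ∀ a, hsSq (star (U a) * S - S) =
        ENNReal.ofReal (∑' i, ‖(star (U a) * S - S) (traceBasis H i)‖ ^ 2) := by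
      intro a
      have hfin' : hsSq (star (U a) * S - S) < ∞ := by
        have : star (U a) * S - S = (star (U a) - 1) * S := by rw [sub_mul, one_mul]
        rw [this]
        exact (hsSq_mul_le_left _ _).trans_lt (ENNReal.mul_lt_top (by finiteness) hfin)
      have hs : Summable fun i => ‖(star (U a) * S - S) (traceBasis H i)‖ ^ 2 :=
        (ENNReal.summable_toReal hfin'.ne).congr fun i => by simp
      rw [ENNReal.ofReal_tsum_of_nonneg (fun _ => by positivity) hs, hsSq]
      congr! 2 with i
      rw [ENNReal.ofReal_pow (norm_nonneg _), ofReal_norm]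
    simp_rw [h6]
    have := ENNReal.tendsto_ofReal h2
    simpa using this
  refine tendsto_of_tendsto_of_tendsto_of_le_of_le tendsto_const_nhds ?_
    (fun _ => bot_le) h1
  have h7 := ENNReal.Tendsto.const_mul (a := traceNorm K ^ (1 / 2 : ℝ))
    ((ENNReal.continuous_rpow_const (y := (1 / 2 : ℝ))).tendsto 0 |>.comp h5)
    (Or.inr (by finiteness))
  simpa using h7

/-- Differentiability with respect to the trace norm. -/
def HasTraceDerivAt (D : ℝ → H →L[ℂ] H) (D' : H →L[ℂ] H) (t : ℝ) : Prop :=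
  ∀ ε > 0, ∀ᶠ s in 𝓝 t,
    traceNorm (D s - D t - ((s - t : ℝ) : ℂ) • D') ≤ ENNReal.ofReal (ε * |s - t|)

theorem HasTraceDerivAt.sub {D E : ℝ → H →L[ℂ] H} {D' E' : H →L[ℂ] H} {t : ℝ}
    (hD : HasTraceDerivAt D D' t) (hE : HasTraceDerivAt E E' t) :
    HasTraceDerivAt (fun s => D s - E s) (D' - E') t := by
  intro ε hε
  filter_upwards [hD (ε / 2) (by positivity), hE (ε / 2) (by positivity)] with s h1 h2
  have : D s - E s - (D t - E t) - ((s - t : ℝ) : ℂ) • (D' - E') =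
      (D s - D t - ((s - t : ℝ) : ℂ) • D') - (E s - E t - ((s - t : ℝ) : ℂ) • E') := by
    rw [smul_sub]; abel
  rw [this]
  refine (traceNorm_sub_le _ _).trans ((add_le_add h1 h2).trans_eq ?_)
  rw [← ENNReal.ofReal_add (by positivity) (by positivity)]
  ring_nf

theorem HasTraceDerivAt.mul_mul {D : ℝ → H →L[ℂ] H} {D' : H →L[ℂ] H} {t : ℝ}
    (hD : HasTraceDerivAt D D' t) {V W : H →L[ℂ] H} (hV : ‖V‖ ≤ 1) (hW : ‖W‖ ≤ 1) :
    HasTraceDerivAt (fun s => V * D s * W) (V * D' * W) t := by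
  intro ε hε
  filter_upwards [hD ε hε] with s h1
  have : V * D s * W - V * D t * W - ((s - t : ℝ) : ℂ) • (V * D' * W) =
      V * (D s - D t - ((s - t : ℝ) : ℂ) • D') * W := by
    simp only [mul_sub, sub_mul, mul_smul_comm, smul_mul_assoc]
  rw [this]
  have h2 : ∀ {X : H →L[ℂ] H}, ‖X‖ ≤ 1 → ‖X‖ₑ ≤ 1 := fun h => by
    rw [← ofReal_norm]; exact ENNReal.ofReal_le_one.2 h
  refine (traceNorm_mul_le_right _ _).trans ((mul_le_of_le_one_right' (h2 hW)).trans ?_)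
  exact (traceNorm_mul_le_left _ _).trans ((mul_le_of_le_one_left' (h2 hV)).trans h1)

theorem HasTraceDerivAt.comp_neg {D : ℝ → H →L[ℂ] H} {D' : H →L[ℂ] H} {t : ℝ}
    (hD : HasTraceDerivAt D D' (-t)) : HasTraceDerivAt (fun s => D (-s)) (-D') t := by
  intro ε hε
  have : Tendsto (fun s : ℝ => -s) (𝓝 t) (𝓝 (-t)) := tendsto_id.neg
  filter_upwards [this.eventually (hD ε hε)] with s hs
  have h1 : |s - t| = |-s - -t| := by rw [← abs_neg]; ring_nf
  rw [h1]
  convert hs using 3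
  rw [smul_neg, ← neg_smul]
  congr 1
  push_cast
  ring

/-- A weak derivative that is trace norm continuous is a derivative in trace norm. -/
theorem hasTraceDerivAt_of_weak {S : Set H} (hS : Dense S) {D G : ℝ → H →L[ℂ] H} {t : ℝ}
    (hG : Tendsto (fun s => traceNorm (G s - G t)) (𝓝 t) (𝓝 0))
    (hw : ∀ f ∈ S, ∀ g ∈ S, ∀ s, HasDerivAt (fun s => inner ℂ f (D s g)) (inner ℂ f (G s g)) s) :
    HasTraceDerivAt D (G t) t := by
  intro ε hε
  have h1 : ∀ᶠ s in 𝓝 t, traceNorm (G s - G t) ≤ ENNReal.ofReal ε :=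
    hG.eventually_le_const (by simpa using hε)
  obtain ⟨δ, hδ, hball⟩ := Metric.eventually_nhds_iff_ball.1 h1
  filter_upwards [Metric.ball_mem_nhds t hδ] with s hs
  refine traceNorm_le_of_dense hS (by positivity) fun F f g hf hg => ?_
  -- The derivative of `Φ` at `r` is the pairing with `G r - G t`, of trace norm at most `ε` near
  -- `t`. The mean value inequality is therefore uniform in the test families.
  set Φ : ℝ → ℂ := fun r => ∑ i ∈ F, inner ℂ (f i) (D r (g i)) -
    (r : ℂ) * ∑ i ∈ F, inner ℂ (f i) (G t (g i)) with hΦ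
  have hder : ∀ r ∈ Metric.ball t δ, HasDerivWithinAt Φ
      (∑ i ∈ F, inner ℂ (f i) ((G r - G t) (g i))) (Metric.ball t δ) r := by
    intro r _
    have h2 := (HasDerivAt.fun_sum fun i (_ : i ∈ F) => hw (f i) (hf i) (g i) (hg i) r).sub
      ((Complex.ofRealCLM.hasDerivAt (x := r)).mul_const (∑ i ∈ F, inner ℂ (f i) (G t (g i))))
    refine HasDerivAt.hasDerivWithinAt ?_
    refine HasDerivAt.congr_deriv (f := Φ) h2 ?_
    simp only [_root_.sub_apply, inner_sub_right, Finset.sum_sub_distrib, Complex.ofRealCLM_apply,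
      Complex.ofReal_one, one_mul]
  have hmv := (convex_ball t δ).norm_image_sub_le_of_norm_hasDerivWithin_le hder
    (fun r hr => norm_sum_inner_le_of_traceNorm_le hε.le (hball r hr) F f g)
    (Metric.mem_ball_self hδ) hs
  have h3 : ∑ i ∈ F, inner ℂ (f i) ((D s - D t - ((s - t : ℝ) : ℂ) • G t) (g i)) = Φ s - Φ t := by
    simp only [hΦ, _root_.sub_apply, _root_.smul_apply, inner_sub_right, inner_smul_right,
      Finset.sum_sub_distrib, ← Finset.mul_sum]
    push_cast
    ring
  rw [h3]
  refine hmv.trans_eq ?_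
  rw [Real.norm_eq_abs]
  ring

end TraceDeriv

/-! ### Growth of ideal norms along `D' = i[A, D] + R`. -/

section Gronwall

variable {H : Type} [NormedAddCommGroup H] [InnerProductSpace ℂ H] [CompleteSpace H]

/-- A subadditive size of operators with the ideal property that is dominated by the
trace norm. -/
structure IsIdealNorm (ν : (H →L[ℂ] H) → ℝ≥0∞) : Prop where
  add_le : ∀ A B, ν (A + B) ≤ ν A + ν B
  mul_left_le : ∀ B A, ν (B * A) ≤ ‖B‖ₑ * ν A
  mul_right_le : ∀ A B, ν (A * B) ≤ ν A * ‖B‖ₑ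
  le_traceNorm : ∀ A, ν A ≤ traceNorm A

theorem isIdealNorm_traceNorm : IsIdealNorm (traceNorm (H := H)) :=
  ⟨traceNorm_add_le, traceNorm_mul_le_left, traceNorm_mul_le_right, fun _ => le_rfl⟩

/-- Besides the trace norm, the operator norm is needed to know that the Hartree solution stays a
contraction. -/
theorem isIdealNorm_enorm : IsIdealNorm (fun A : H →L[ℂ] H => ‖A‖ₑ) where
  add_le := enorm_add_le
  mul_left_le B A := by
    rw [← ofReal_norm, ← ofReal_norm, ← ofReal_norm, ← ENNReal.ofReal_mul (norm_nonneg _)]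
    exact ENNReal.ofReal_le_ofReal (norm_mul_le _ _)
  mul_right_le B A := by
    rw [← ofReal_norm, ← ofReal_norm, ← ofReal_norm, ← ENNReal.ofReal_mul (norm_nonneg _)]
    exact ENNReal.ofReal_le_ofReal (norm_mul_le _ _)
  le_traceNorm := enorm_le_traceNorm

namespace IsIdealNorm

variable {ν : (H →L[ℂ] H) → ℝ≥0∞} (hν : IsIdealNorm ν)

include hν

theorem smul_le (c : ℂ) (A : H →L[ℂ] H) : ν (c • A) ≤ ‖c‖ₑ * ν A := by
  have : c • A = (c • (1 : H →L[ℂ] H)) * A := by rw [smul_mul_assoc, one_mul]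
  rw [this]
  refine (hν.mul_left_le _ _).trans ?_
  gcongr
  rw [← ofReal_norm, ← ofReal_norm]
  refine ENNReal.ofReal_le_ofReal ?_
  rw [norm_smul]
  exact mul_le_of_le_one_right (norm_nonneg _) ContinuousLinearMap.norm_id_le

theorem neg_eq (A : H →L[ℂ] H) : ν (-A) = ν A := by
  have key : ∀ A, ν (-A) ≤ ν A := fun A => by
    have := hν.smul_le (-1) A
    simpa using this
  exact le_antisymm (key A) (by simpa using key (-A))

end IsIdealNorm

/-- For imaginary `c` and self-adjoint `A` the terms linear in `c` cancel in `(1 - cA)(1 + cA) = 1 -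
c²A²`, so `1 + cA` is unitary to first order. -/
theorem norm_one_add_smul_sq_le {A : H →L[ℂ] H} (hA : star A = A) {c : ℂ}
    (hc : star c = -c) : ‖1 + c • A‖ * ‖1 - c • A‖ ≤ 1 + ‖c‖ ^ 2 * ‖A‖ ^ 2 := by
  have h1 : star (1 + c • A) = 1 - c • A := by
    rw [star_add, star_smul, star_one, hA, hc, neg_smul, sub_eq_add_neg]
  rw [← h1, norm_star, ← CStarRing.norm_star_mul_self, h1]
  have : (1 - c • A) * (1 + c • A) = 1 - (c ^ 2) • (A * A) := by
    simp only [mul_add, sub_mul, mul_one, one_mul, smul_mul_smul_comm, sq]; abel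
  rw [this]
  refine (norm_sub_le _ _).trans (add_le_add ContinuousLinearMap.norm_id_le ?_)
  rw [norm_smul, norm_pow, sq ‖A‖]
  gcongr
  exact norm_mul_le _ _

/-- A barrier argument: the norm of `D` has upper right slope at most the norm of `R`, because the
commutator generates an almost unitary conjugation. The bound on `R` is required only where the norm
touches the barrier `B`, so it may depend on the norm itself. -/
theorem IsIdealNorm.le_of_hasTraceDerivAt_of_nonneg {ν : (H →L[ℂ] H) → ℝ≥0∞} (hν : IsIdealNorm ν)
    {D A R : ℝ → H →L[ℂ] H} (hD : ∀ t, traceNorm (D t) < ∞) (hR : ∀ t, traceNorm (R t) < ∞)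
    (hA : ∀ t, star (A t) = A t)
    (hder : ∀ t, HasTraceDerivAt D (Complex.I • (A t * D t - D t * A t) + R t) t)
    {B B' : ℝ → ℝ} (hB : ∀ t, 0 ≤ t → HasDerivAt B (B' t) t) (h0 : (ν (D 0)).toReal ≤ B 0)
    {t : ℝ} (hbd : ∀ s, 0 ≤ s → s ≤ t → (ν (D s)).toReal = B s → (ν (R s)).toReal < B' s)
    (ht : 0 ≤ t) : (ν (D t)).toReal ≤ B t := by
  have hνD : ∀ t, ν (D t) ≠ ∞ := fun t => ((hν.le_traceNorm _).trans_lt (hD t)).ne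
  have hνR : ∀ t, ν (R t) ≠ ∞ := fun t => ((hν.le_traceNorm _).trans_lt (hR t)).ne
  set f : ℝ → ℝ := fun t => (ν (D t)).toReal with hf
  set G : ℝ → H →L[ℂ] H := fun t => Complex.I • (A t * D t - D t * A t) + R t with hG
  have hGfin : ∀ t, traceNorm (G t) < ∞ := fun t => by
    refine (traceNorm_add_le _ _).trans_lt (ENNReal.add_lt_top.2 ⟨?_, hR t⟩)
    refine (traceNorm_smul_le _ _).trans_lt (ENNReal.mul_lt_top (by finiteness) ?_)
    refine (traceNorm_sub_le _ _).trans_lt (ENNReal.add_lt_top.2 ⟨?_, ?_⟩)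
    · exact (traceNorm_mul_le_left _ _).trans_lt (ENNReal.mul_lt_top (by finiteness) (hD t))
    · exact (traceNorm_mul_le_right _ _).trans_lt (ENNReal.mul_lt_top (hD t) (by finiteness))
  have hcont : ∀ t, ContinuousAt f t := by
    intro t
    set g := (ν (G t)).toReal + 1
    have hg : ν (G t) ≠ ∞ := ((hν.le_traceNorm _).trans_lt (hGfin t)).ne
    have hev : ∀ᶠ s in 𝓝 t, |f s - f t| ≤ g * |s - t| := by
      filter_upwards [hder t 1 one_pos] with s hs
      have h1 : ν (D s - D t) ≤ ENNReal.ofReal (g * |s - t|) := by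
        have : D s - D t = (D s - D t - ((s - t : ℝ) : ℂ) • G t) + ((s - t : ℝ) : ℂ) • G t := by
          abel
        rw [this]
        refine (hν.add_le _ _).trans ((add_le_add ((hν.le_traceNorm _).trans hs)
          (hν.smul_le _ _)).trans_eq ?_)
        rw [← ofReal_norm, Complex.norm_real, Real.norm_eq_abs, ← ENNReal.ofReal_toReal hg,
          ← ENNReal.ofReal_mul (abs_nonneg _), ← ENNReal.ofReal_add (by positivity) (by positivity)]
        congr 1
        simp only [g]
        ring
      have h2 : f s ≤ f t + g * |s - t| := by
        have : ν (D s) ≤ ν (D t) + ENNReal.ofReal (g * |s - t|) := by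
          have e : D s = D t + (D s - D t) := by abel
          conv_lhs => rw [e]
          exact (hν.add_le _ _).trans (by gcongr)
        have := ENNReal.toReal_mono (ENNReal.add_ne_top.2 ⟨hνD t, ENNReal.ofReal_ne_top⟩) this
        rwa [ENNReal.toReal_add (hνD t) ENNReal.ofReal_ne_top,
          ENNReal.toReal_ofReal (by positivity)] at this
      have h3 : f t ≤ f s + g * |s - t| := by
        have : ν (D t) ≤ ν (D s) + ENNReal.ofReal (g * |s - t|) := by
          have e : D t = D s + -(D s - D t) := by abel
          conv_lhs => rw [e]
          refine (hν.add_le _ _).trans ?_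
          rw [hν.neg_eq]
          gcongr
        have := ENNReal.toReal_mono (ENNReal.add_ne_top.2 ⟨hνD s, ENNReal.ofReal_ne_top⟩) this
        rwa [ENNReal.toReal_add (hνD s) ENNReal.ofReal_ne_top,
          ENNReal.toReal_ofReal (by positivity)] at this
      rw [abs_le]; constructor <;> linarith
    rw [ContinuousAt, tendsto_iff_norm_sub_tendsto_zero]
    refine squeeze_zero' (Eventually.of_forall fun _ => norm_nonneg _) hev ?_
    have : Continuous fun s => g * |s - t| := by fun_prop
    simpa using this.tendsto t
  refine image_le_of_liminf_slope_right_lt_deriv_boundary' (f := f)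
    (f' := fun t => (ν (R t)).toReal) (a := 0) (b := t)
    (fun s _ => (hcont s).continuousWithinAt) ?_ h0
    (fun s hs => (hB s hs.1).continuousAt.continuousWithinAt)
    (fun s hs => (hB s hs.1).hasDerivWithinAt) (fun s hs h => hbd s hs.1 hs.2.le h) ⟨ht, le_rfl⟩
  intro x _ r hr
  refine Eventually.frequently ?_
  -- Half of the gap pays for the trace norm remainder of the derivative, the other half for the
  -- terms of order `h²`.
  set ε := (r - (ν (R x)).toReal) / 2 with hε
  have hε0 : 0 < ε := by rw [hε]; linarith
  have hsmall : ∀ᶠ s in 𝓝[>] x, (s - x) * (2 * ‖A x‖ ^ 2 * f x) < ε := by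
    have : Continuous fun s => (s - x) * (2 * ‖A x‖ ^ 2 * f x) := by fun_prop
    refine ((this.tendsto x).mono_left nhdsWithin_le_nhds).eventually_lt_const ?_
    simpa using hε0
  filter_upwards [nhdsWithin_le_nhds (hder x ε hε0), hsmall, self_mem_nhdsWithin] with s hs hsm hsx
  set h := s - x with hh
  have hpos : 0 < h := sub_pos.2 hsx
  set c : ℂ := Complex.I * h with hc
  have hcs : star c = -c := by simp [hc]
  have hcn : ‖c‖ = h := by simp [hc, abs_of_pos hpos]
  -- An Euler step: up to the quadratic term, the commutator is absorbed in the conjugation of `D x`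
  -- by `1 + ihA`.
  have hdec : D s = (1 + c • A x) * D x * (1 - c • A x) + (c ^ 2) • (A x * D x * A x) +
      (h : ℂ) • R x + (D s - D x - (h : ℂ) • G x) := by
    have : (1 + c • A x) * D x * (1 - c • A x) = D x + c • (A x * D x - D x * A x) -
        (c ^ 2) • (A x * D x * A x) := by
      simp only [add_mul, mul_sub, mul_one, one_mul, smul_mul_assoc, mul_smul_comm]
      module
    rw [this]
    simp only [hG, smul_add, smul_smul, hc]
    rw [mul_comm (h : ℂ) Complex.I]
    abel
  have hE : ∀ X : H →L[ℂ] H, ‖X‖ₑ = ENNReal.ofReal ‖X‖ := fun X => (ofReal_norm X).symm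
  have hEc : ∀ X : ℂ, ‖X‖ₑ = ENNReal.ofReal ‖X‖ := fun X => (ofReal_norm X).symm
  have hbound : ν (D s) ≤ ENNReal.ofReal ((1 + h ^ 2 * ‖A x‖ ^ 2) * f x + h ^ 2 * ‖A x‖ ^ 2 * f x +
      h * (ν (R x)).toReal + ε * h) := by
    rw [hdec]
    have hfx : ν (D x) = ENNReal.ofReal (f x) := (ENNReal.ofReal_toReal (hνD x)).symm
    have hf0 : 0 ≤ f x := ENNReal.toReal_nonneg
    have b1 : ν ((1 + c • A x) * D x * (1 - c • A x)) ≤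
        ENNReal.ofReal ((1 + h ^ 2 * ‖A x‖ ^ 2) * f x) := by
      refine (hν.mul_right_le _ _).trans ((mul_le_mul_left (hν.mul_left_le _ _) _).trans ?_)
      rw [hE, hE, hfx, ← ENNReal.ofReal_mul (norm_nonneg _), ← ENNReal.ofReal_mul (by positivity)]
      refine ENNReal.ofReal_le_ofReal ?_
      have := norm_one_add_smul_sq_le (hA x) hcs
      rw [hcn] at this
      calc _ = (‖1 + c • A x‖ * ‖1 - c • A x‖) * f x := by ring
        _ ≤ _ := by gcongr
    have b2 : ν ((c ^ 2) • (A x * D x * A x)) ≤ ENNReal.ofReal (h ^ 2 * ‖A x‖ ^ 2 * f x) := by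
      refine (hν.smul_le _ _).trans ((mul_le_mul_right ((hν.mul_right_le _ _).trans
        (mul_le_mul_left (hν.mul_left_le _ _) _)) _).trans_eq ?_)
      rw [hE, hfx, hEc, norm_pow, hcn, ← ENNReal.ofReal_mul (norm_nonneg _),
        ← ENNReal.ofReal_mul (by positivity), ← ENNReal.ofReal_mul (by positivity)]
      ring_nf
    have b3 : ν ((h : ℂ) • R x) ≤ ENNReal.ofReal (h * (ν (R x)).toReal) := by
      refine (hν.smul_le _ _).trans_eq ?_
      rw [hEc, Complex.norm_real, Real.norm_of_nonneg hpos.le, ENNReal.ofReal_mul hpos.le,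
        ENNReal.ofReal_toReal (hνR x)]
    have b4 : ν (D s - D x - (h : ℂ) • G x) ≤ ENNReal.ofReal (ε * h) := by
      refine (hν.le_traceNorm _).trans (hs.trans_eq ?_)
      rw [abs_of_pos hpos]
    refine (hν.add_le _ _).trans ((add_le_add ((hν.add_le _ _).trans (add_le_add
      ((hν.add_le _ _).trans (add_le_add b1 b2)) b3)) b4).trans_eq ?_)
    have : 0 ≤ (ν (R x)).toReal := ENNReal.toReal_nonneg
    rw [← ENNReal.ofReal_add (by positivity) (by positivity),
      ← ENNReal.ofReal_add (by positivity) (by positivity),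
      ← ENNReal.ofReal_add (by positivity) (by positivity)]
  have hf0 : 0 ≤ f x := ENNReal.toReal_nonneg
  have hr0 : 0 ≤ (ν (R x)).toReal := ENNReal.toReal_nonneg
  have hfs : f s ≤ (1 + h ^ 2 * ‖A x‖ ^ 2) * f x + h ^ 2 * ‖A x‖ ^ 2 * f x +
      h * (ν (R x)).toReal + ε * h :=
    ENNReal.toReal_le_of_le_ofReal (by positivity) hbound
  rw [slope_def_field, ← hh, div_lt_iff₀ hpos]
  have : r = (ν (R x)).toReal + 2 * ε := by rw [hε]; ring
  rw [this]
  nlinarith [mul_lt_mul_of_pos_left hsm hpos]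

/-- Comparison principle for the equation `D' = i [A, D] + R` in trace norm, for both signs of
the time. -/
theorem IsIdealNorm.le_of_hasTraceDerivAt {ν : (H →L[ℂ] H) → ℝ≥0∞} (hν : IsIdealNorm ν)
    {D A R : ℝ → H →L[ℂ] H} (hD : ∀ t, traceNorm (D t) < ∞) (hR : ∀ t, traceNorm (R t) < ∞)
    (hA : ∀ t, star (A t) = A t)
    (hder : ∀ t, HasTraceDerivAt D (Complex.I • (A t * D t - D t * A t) + R t) t)
    {B B' : ℝ → ℝ} (hB : ∀ t, 0 ≤ t → HasDerivAt B (B' t) t) (h0 : (ν (D 0)).toReal ≤ B 0)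
    {t : ℝ} (hbd : ∀ s, 0 ≤ s * t → |s| ≤ |t| → (ν (D s)).toReal = B |s| →
      (ν (R s)).toReal < B' |s|) :
    (ν (D t)).toReal ≤ B |t| := by
  rcases le_total 0 t with ht | ht
  · rw [abs_of_nonneg ht]
    refine hν.le_of_hasTraceDerivAt_of_nonneg hD hR hA hder hB h0 (fun s hs hst h => ?_) ht
    have := hbd s (mul_nonneg hs ht) (by rwa [abs_of_nonneg hs, abs_of_nonneg ht])
    rw [abs_of_nonneg hs] at this
    exact this h
  · rw [abs_of_nonpos ht]
    have := hν.le_of_hasTraceDerivAt_of_nonneg (D := fun s => D (-s)) (A := fun s => -A (-s))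
      (R := fun s => -R (-s)) (fun s => hD _) (fun s => by rw [traceNorm_neg]; exact hR _)
      (fun s => by rw [star_neg, hA]) (fun s => ?_) hB (by simpa using h0) (fun s hs hst h => ?_)
      (neg_nonneg.2 ht)
    · simpa using this
    · convert (hder (-s)).comp_neg using 1
      simp only [neg_mul, mul_neg, neg_add, ← smul_neg]
      congr 2
      abel
    · have := hbd (-s) (by nlinarith) (by rwa [abs_neg, abs_of_nonneg hs, abs_of_nonpos ht])
      rw [abs_neg, abs_of_nonneg hs] at this
      rw [hν.neg_eq]
      exact this h

/-- The strict comparison is applied to the steeper barrier `B s + ε s`, and `ε` tends to zero. -/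
theorem IsIdealNorm.le_of_hasTraceDerivAt_of_le {ν : (H →L[ℂ] H) → ℝ≥0∞} (hν : IsIdealNorm ν)
    {D A R : ℝ → H →L[ℂ] H} (hD : ∀ t, traceNorm (D t) < ∞) (hR : ∀ t, traceNorm (R t) < ∞)
    (hA : ∀ t, star (A t) = A t)
    (hder : ∀ t, HasTraceDerivAt D (Complex.I • (A t * D t - D t * A t) + R t) t)
    {B B' : ℝ → ℝ} (hB : ∀ t, 0 ≤ t → HasDerivAt B (B' t) t) (h0 : (ν (D 0)).toReal ≤ B 0)
    {t : ℝ} (hbd : ∀ s, 0 ≤ s * t → |s| ≤ |t| → (ν (R s)).toReal ≤ B' |s|) :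
    (ν (D t)).toReal ≤ B |t| := by
  have key : ∀ ε : ℝ, 0 < ε → (ν (D t)).toReal ≤ B |t| + ε * |t| := fun ε hε =>
    hν.le_of_hasTraceDerivAt hD hR hA hder (B := fun s => B s + ε * s) (B' := fun s => B' s + ε)
      (fun s hs => (hB s hs).add (by simpa using (hasDerivAt_id s).const_mul ε)) (by simpa using h0)
      (fun s hs hst _ => (hbd s hs hst).trans_lt (lt_add_of_pos_right _ hε))
  have hlim : Tendsto (fun ε : ℝ => B |t| + ε * |t|) (𝓝[>] 0) (𝓝 (B |t|)) := by
    have : Continuous fun ε : ℝ => B |t| + ε * |t| := by fun_prop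
    simpa using (this.tendsto 0).mono_left nhdsWithin_le_nhds
  exact ge_of_tendsto hlim (eventually_mem_nhdsWithin.mono fun ε hε => key ε hε)

end Gronwall

/-! ### Multiplication operators, plane waves and translations. -/

section Multiplication

theorem memLp_top_of_measurable {φ : R3 → ℂ} (hφ : Measurable φ) {M : ℝ} (hM : ∀ x, ‖φ x‖ ≤ M) :
    MemLp φ ∞ (volume : Measure R3) :=
  memLp_top_of_bound hφ.aestronglyMeasurable M (Eventually.of_forall hM)

theorem norm_sq_eq_integral (f : L2R3) : ‖f‖ ^ 2 = ∫ x, ‖f x‖ ^ 2 := by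
  have h : (inner ℂ f f : ℂ) = ∫ x, inner ℂ (f x) (f x) := L2.inner_def f f
  rw [inner_self_eq_norm_sq_to_K] at h
  simp_rw [inner_self_eq_norm_sq_to_K] at h
  have h2 : ((‖f‖ ^ 2 : ℝ) : ℂ) = ((∫ x, ‖f x‖ ^ 2 : ℝ) : ℂ) := by
    have h3 := integral_ofReal (𝕜 := ℂ) (μ := (volume : Measure R3)) (f := fun x => ‖f x‖ ^ 2)
    refine Eq.trans ?_ h3
    simpa using h
  exact_mod_cast h2

theorem norm_mulOp_le {φ : R3 → ℂ} {M : ℝ} (h0 : 0 ≤ M) (hM : ∀ x, ‖φ x‖ ≤ M) :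
    ‖mulOp φ‖ ≤ M := by
  by_cases h : MemLp φ ∞ (volume : Measure R3)
  · refine ContinuousLinearMap.opNorm_le_bound _ h0 fun f => ?_
    refine Lp.norm_le_mul_norm_of_ae_le_mul ?_
    filter_upwards [mulOp_apply φ h f] with x hx
    rw [hx, norm_mul]
    gcongr
    exact hM x
  · simp [mulOp, h, h0]

theorem mulOp_mul_mulOp {φ ψ : R3 → ℂ} (hφ : MemLp φ ∞ (volume : Measure R3))
    (hψ : MemLp ψ ∞ (volume : Measure R3)) : mulOp φ * mulOp ψ = mulOp (fun x => φ x * ψ x) := by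
  ext1 f
  apply Lp.ext
  rw [mul_apply_eq_comp]
  have h : MemLp (fun x => φ x * ψ x) ∞ (volume : Measure R3) := hψ.mul hφ
  filter_upwards [mulOp_apply φ hφ (mulOp ψ f), mulOp_apply ψ hψ f, mulOp_apply _ h f]
    with x h1 h2 h3
  rw [h1, h2, h3, mul_assoc]

theorem mulOp_one : mulOp (fun _ => 1) = 1 := by
  ext1 f
  apply Lp.ext
  filter_upwards [mulOp_apply (fun _ => 1) (memLp_top_const 1) f] with x h1
  rw [h1, one_mul]
  rfl

theorem mulOp_const (c : ℂ) : mulOp (fun _ => c) = c • (1 : Op) := by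
  ext1 f
  apply Lp.ext
  filter_upwards [mulOp_apply (fun _ => c) (memLp_top_const c) f, Lp.coeFn_smul c f] with x h1 h2
  rw [h1]
  exact h2.symm

theorem inner_L2_eq (f g : L2R3) : inner ℂ f g = ∫ x, g x * starRingEnd ℂ (f x) := by
  rw [L2.inner_def]
  rfl

theorem star_mulOp {φ : R3 → ℂ} (hφ : MemLp φ ∞ (volume : Measure R3)) :
    star (mulOp φ) = mulOp (fun x => starRingEnd ℂ (φ x)) := by
  have hφ' : MemLp (fun x => starRingEnd ℂ (φ x)) ∞ (volume : Measure R3) := hφ.star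
  rw [ContinuousLinearMap.star_eq_adjoint]
  symm
  rw [ContinuousLinearMap.eq_adjoint_iff]
  intro f g
  rw [inner_L2_eq, inner_L2_eq]
  refine integral_congr_ae ?_
  filter_upwards [mulOp_apply _ hφ' f, mulOp_apply φ hφ g] with x h1 h2
  rw [h1, h2, map_mul, Complex.conj_conj]
  ring

/-- Multiplication operators are strongly continuous in the function. -/
theorem tendsto_mulOp_apply {α : Type*} {l : Filter α} [l.IsCountablyGenerated]
    {φ : α → R3 → ℂ} {ψ : R3 → ℂ} (hφ : ∀ a, Measurable (φ a)) (hψ : Measurable ψ) {M : ℝ}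
    (hM : ∀ a x, ‖φ a x‖ ≤ M) (hM' : ∀ x, ‖ψ x‖ ≤ M)
    (hlim : ∀ x, Tendsto (fun a => φ a x) l (𝓝 (ψ x))) (f : L2R3) :
    Tendsto (fun a => mulOp (φ a) f) l (𝓝 (mulOp ψ f)) := by
  have hφ' := fun a => memLp_top_of_measurable (hφ a) (hM a)
  have hψ' := memLp_top_of_measurable hψ hM'
  rw [tendsto_iff_norm_sub_tendsto_zero]
  have hsq : Tendsto (fun a => ‖mulOp (φ a) f - mulOp ψ f‖ ^ 2) l (𝓝 0) := by
    have h1 : ∀ a, ‖mulOp (φ a) f - mulOp ψ f‖ ^ 2 = ∫ x, ‖(φ a x - ψ x) * f x‖ ^ 2 := by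
      intro a
      rw [norm_sq_eq_integral]
      refine integral_congr_ae ?_
      filter_upwards [mulOp_apply (φ a) (hφ' a) f, mulOp_apply ψ hψ' f,
        Lp.coeFn_sub (mulOp (φ a) f) (mulOp ψ f)] with x h1 h2 h3
      rw [h3, Pi.sub_apply, h1, h2, sub_mul]
    simp_rw [h1]
    have hf : Integrable fun x => ‖f x‖ ^ 2 := (Lp.memLp f).integrable_norm_pow (by norm_num)
    have : (0 : ℝ) = ∫ _ : R3, (0 : ℝ) := by simp
    rw [this]
    refine tendsto_integral_filter_of_dominated_convergence
      (fun x => (2 * M) ^ 2 * ‖f x‖ ^ 2) (Eventually.of_forall fun a => ?_)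
      (Eventually.of_forall fun a => Eventually.of_forall fun x => ?_) (hf.const_mul _)
      (Eventually.of_forall fun x => ?_)
    · exact ((((hφ a).sub hψ).aestronglyMeasurable.mul (Lp.aestronglyMeasurable f)).norm.pow 2)
    · rw [Real.norm_of_nonneg (by positivity), norm_mul, mul_pow]
      gcongr
      refine (norm_sub_le _ _).trans ?_
      linarith [hM a x, hM' x]
    · have h2 : Tendsto (fun a => (φ a x - ψ x) * f x) l (𝓝 0) := by
        have := ((hlim x).sub_const (ψ x)).mul_const (f x)
        simpa using this
      simpa using h2.norm.pow 2
  have := (Real.continuous_sqrt.tendsto 0).comp hsq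
  simpa [Function.comp_def] using this

theorem norm_planeWave (p x : R3) : ‖planeWave p x‖ = 1 := by
  rw [planeWave, mul_comm, Complex.norm_exp_ofReal_mul_I]

theorem continuous_planeWave (p : R3) : Continuous (planeWave p) := by
  unfold planeWave
  fun_prop

theorem memLp_planeWave (p : R3) : MemLp (planeWave p) ∞ (volume : Measure R3) :=
  memLp_top_of_measurable (continuous_planeWave p).measurable fun x => (norm_planeWave p x).le

theorem planeWave_mul (p q x : R3) : planeWave p x * planeWave q x = planeWave (p + q) x := by
  simp only [planeWave, ← Complex.exp_add, inner_add_left]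
  push_cast
  ring_nf

theorem planeWave_add (p x y : R3) : planeWave p (x + y) = planeWave p x * planeWave p y := by
  simp only [planeWave, ← Complex.exp_add, inner_add_right]
  push_cast
  ring_nf

theorem conj_planeWave (p x : R3) : starRingEnd ℂ (planeWave p x) = planeWave (-p) x := by
  simp only [planeWave, ← Complex.exp_conj, map_mul, Complex.conj_I, Complex.conj_ofReal,
    inner_neg_left]
  push_cast
  ring_nf

/-- Multiplication with a plane wave. -/
def waveOp (p : R3) : Op := mulOp (planeWave p)

theorem waveOp_mul (p q : R3) : waveOp p * waveOp q = waveOp (p + q) := by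
  rw [waveOp, waveOp, mulOp_mul_mulOp (memLp_planeWave p) (memLp_planeWave q)]
  simp_rw [planeWave_mul]
  rfl

theorem waveOp_zero : waveOp 0 = 1 := by
  rw [← mulOp_one, waveOp]
  congr 1
  ext x
  simp [planeWave]

theorem star_waveOp (p : R3) : star (waveOp p) = waveOp (-p) := by
  rw [waveOp, star_mulOp (memLp_planeWave p)]
  simp_rw [conj_planeWave]
  rfl

theorem norm_waveOp_le (p : R3) : ‖waveOp p‖ ≤ 1 :=
  norm_mulOp_le zero_le_one fun x => (norm_planeWave p x).le

theorem translationOp_apply (a : R3) (f : L2R3) :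
    translationOp a f =ᵐ[volume] fun x => f (x + a) :=
  Lp.coeFn_compMeasurePreserving f (measurePreserving_add_right volume a)

theorem norm_translationOp_apply (a : R3) (f : L2R3) : ‖translationOp a f‖ = ‖f‖ :=
  Lp.norm_compMeasurePreserving f (measurePreserving_add_right volume a)

theorem norm_translationOp_le (a : R3) : ‖translationOp a‖ ≤ 1 :=
  ContinuousLinearMap.opNorm_le_bound _ zero_le_one fun f => by
    rw [norm_translationOp_apply, one_mul]

theorem ae_comp_add_right {P : R3 → Prop} (a : R3) (h : ∀ᵐ x, P x) : ∀ᵐ x, P (x + a) :=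
  (measurePreserving_add_right volume a).quasiMeasurePreserving.ae h

theorem translationOp_mul (a b : R3) : translationOp a * translationOp b =
    translationOp (a + b) := by
  ext1 f
  apply Lp.ext
  rw [mul_apply_eq_comp]
  filter_upwards [translationOp_apply a (translationOp b f), translationOp_apply (a + b) f,
    ae_comp_add_right a (translationOp_apply b f)] with x h1 h2 h3
  rw [h1, h2, h3, add_assoc]

theorem translationOp_zero : translationOp 0 = 1 := by
  ext1 f
  apply Lp.ext
  filter_upwards [translationOp_apply 0 f] with x h1
  rw [h1, add_zero]
  rfl

theorem star_translationOp (a : R3) : star (translationOp a) = translationOp (-a) := by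
  rw [ContinuousLinearMap.star_eq_adjoint]
  symm
  rw [ContinuousLinearMap.eq_adjoint_iff]
  intro f g
  have h : translationOp a (translationOp (-a) f) = f := by
    rw [← mul_apply_eq_comp, translationOp_mul, add_neg_cancel, translationOp_zero]
    rfl
  conv_rhs => rw [← h]
  rw [inner_L2_eq, inner_L2_eq]
  rw [← integral_add_right_eq_self (fun x => g x * starRingEnd ℂ (translationOp (-a) f x)) a]
  refine integral_congr_ae ?_
  filter_upwards [translationOp_apply a g, translationOp_apply a (translationOp (-a) f)]
    with x h1 h2
  rw [h1, h2]

theorem translationOp_mul_mulOp (a : R3) {φ : R3 → ℂ} (hφ : MemLp φ ∞ (volume : Measure R3)) :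
    translationOp a * mulOp φ = mulOp (fun x => φ (x + a)) * translationOp a := by
  have hφ' : MemLp (fun x => φ (x + a)) ∞ (volume : Measure R3) :=
    hφ.comp_measurePreserving (measurePreserving_add_right volume a)
  ext1 f
  apply Lp.ext
  rw [mul_apply_eq_comp, mul_apply_eq_comp]
  filter_upwards [translationOp_apply a (mulOp φ f), translationOp_apply a f,
    mulOp_apply _ hφ' (translationOp a f), ae_comp_add_right a (mulOp_apply φ hφ f)]
    with x h1 h2 h3 h4
  rw [h1, h3, h4, h2]

theorem translationOp_mul_waveOp (a p : R3) :
    translationOp a * waveOp p = planeWave p a • (waveOp p * translationOp a) := by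
  rw [waveOp, translationOp_mul_mulOp a (memLp_planeWave p), ← smul_mul_assoc]
  congr 1
  simp_rw [planeWave_add]
  rw [← mulOp_mul_mulOp (memLp_planeWave p) (memLp_top_const _), mulOp_const, mul_smul_comm,
    mul_one]

end Multiplication

/-! ### Unitary groups with Fourier multiplier `e^{isθ}`. -/

section PhaseGroup

/-- The Fourier transform as a bounded operator on `L²(ℝ³)`. -/
def fourierOp : Op := (Lp.fourierTransformₗᵢ R3 ℂ).toLinearIsometry.toContinuousLinearMap

theorem fourierOp_apply (f : L2R3) : fourierOp f = Lp.fourierTransformₗᵢ R3 ℂ f := rfl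

theorem star_fourierOp_apply (f : L2R3) :
    star fourierOp f = (Lp.fourierTransformₗᵢ R3 ℂ).symm f := by
  refine ext_inner_left ℂ fun g => ?_
  rw [ContinuousLinearMap.star_eq_adjoint, ContinuousLinearMap.adjoint_inner_right,
    fourierOp_apply, ← LinearIsometryEquiv.inner_map_eq_flip]

theorem star_fourierOp_mul_self : star fourierOp * fourierOp = 1 := by
  ext1 f
  rw [mul_apply_eq_comp, star_fourierOp_apply, fourierOp_apply]
  exact LinearIsometryEquiv.symm_apply_apply _ _

theorem fourierOp_mul_star_self : fourierOp * star fourierOp = 1 := by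
  ext1 f
  rw [mul_apply_eq_comp, star_fourierOp_apply, fourierOp_apply]
  exact LinearIsometryEquiv.apply_symm_apply _ _

theorem norm_fourierOp_le : ‖fourierOp‖ ≤ 1 :=
  LinearIsometry.norm_toContinuousLinearMap_le _

theorem fourierOp_schwartz (f : 𝓢(R3, ℂ)) : fourierOp (schwartzL2 f) = schwartzL2 (𝓕 f) :=
  SchwartzMap.toLp_fourier_eq f

theorem star_fourierOp_schwartz (f : 𝓢(R3, ℂ)) :
    star fourierOp (schwartzL2 f) = schwartzL2 (𝓕⁻ f) := by
  rw [star_fourierOp_apply]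
  exact SchwartzMap.toLp_fourierInv_eq f

theorem dense_range_schwartzL2 : Dense (Set.range schwartzL2) :=
  SchwartzMap.denseRange_toLpCLM (E := R3) (F := ℂ) (p := 2) (μ := volume)
    ENNReal.ofNat_ne_top

theorem op_ext_schwartz {A B : Op} (h : ∀ f, A (schwartzL2 f) = B (schwartzL2 f)) : A = B := by
  refine DFunLike.coe_injective (Continuous.ext_on dense_range_schwartzL2 A.continuous
    B.continuous ?_)
  rintro _ ⟨f, rfl⟩
  exact h f

theorem schwartzL2_coeFn (f : 𝓢(R3, ℂ)) : schwartzL2 f =ᵐ[volume] f :=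
  f.coeFn_toLp 2 volume

theorem mulOp_schwartz {φ : R3 → ℂ} (hφ : MemLp φ ∞ (volume : Measure R3))
    (hg : φ.HasTemperateGrowth) (f : 𝓢(R3, ℂ)) :
    mulOp φ (schwartzL2 f) = schwartzL2 (SchwartzMap.smulLeftCLM ℂ φ f) := by
  apply Lp.ext
  filter_upwards [mulOp_apply φ hφ (schwartzL2 f), schwartzL2_coeFn f,
    schwartzL2_coeFn (SchwartzMap.smulLeftCLM ℂ φ f)] with x h1 h2 h3
  rw [h1, h2, h3, SchwartzMap.smulLeftCLM_apply_apply hg, smul_eq_mul]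

/-- All derivatives are bounded by one. Composition with a symbol of temperate growth then shows
that `phase` multiplies the Schwartz space into itself. -/
theorem hasTemperateGrowth_exp_mul_I :
    (fun t : ℝ => Complex.exp (Complex.I * t)).HasTemperateGrowth := by
  have hd : ∀ t : ℝ, HasDerivAt (fun t : ℝ => Complex.exp (Complex.I * t))
      (Complex.I * Complex.exp (Complex.I * t)) t := fun t => by
    have := ((Complex.ofRealCLM.hasDerivAt (x := t)).const_mul Complex.I).cexp
    refine this.congr_deriv ?_
    simp [mul_comm]
  have hi : ∀ n : ℕ, iteratedDeriv n (fun t : ℝ => Complex.exp (Complex.I * t)) =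
      fun t : ℝ => Complex.I ^ n * Complex.exp (Complex.I * t) := by
    intro n
    induction n with
    | zero => ext; simp
    | succ n ih =>
      rw [iteratedDeriv_succ, ih]
      ext t
      rw [((hd t).const_mul _).deriv, pow_succ]
      ring
  refine ⟨(contDiff_const.mul Complex.ofRealCLM.contDiff).cexp, fun n => ⟨0, 1, fun t => ?_⟩⟩
  rw [norm_iteratedFDeriv_eq_norm_iteratedDeriv, hi, norm_mul, norm_pow, Complex.norm_I,
    Complex.norm_exp_I_mul_ofReal]
  norm_num

/-- The function `e^{i s θ}`. -/
def phase (θ : R3 → ℝ) (s : ℝ) (x : R3) : ℂ := Complex.exp (Complex.I * ((s * θ x : ℝ) : ℂ))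

theorem norm_phase (θ : R3 → ℝ) (s : ℝ) (x : R3) : ‖phase θ s x‖ = 1 :=
  Complex.norm_exp_I_mul_ofReal _

theorem hasTemperateGrowth_phase {θ : R3 → ℝ} (hθ : θ.HasTemperateGrowth) (s : ℝ) :
    (phase θ s).HasTemperateGrowth := by
  have h : (fun x => s * θ x).HasTemperateGrowth := by fun_prop
  exact hasTemperateGrowth_exp_mul_I.comp h

theorem continuous_phase {θ : R3 → ℝ} (hθ : θ.HasTemperateGrowth) (s : ℝ) :
    Continuous (phase θ s) :=
  (hasTemperateGrowth_phase hθ s).1.continuous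

theorem memLp_phase {θ : R3 → ℝ} (hθ : θ.HasTemperateGrowth) (s : ℝ) :
    MemLp (phase θ s) ∞ (volume : Measure R3) :=
  memLp_top_of_measurable (continuous_phase hθ s).measurable fun x => (norm_phase θ s x).le

theorem phase_mul (θ : R3 → ℝ) (s t : ℝ) (x : R3) :
    phase θ s x * phase θ t x = phase θ (s + t) x := by
  simp only [phase, ← Complex.exp_add]
  push_cast
  ring_nf

theorem conj_phase (θ : R3 → ℝ) (s : ℝ) (x : R3) :
    starRingEnd ℂ (phase θ s x) = phase θ (-s) x := by
  simp only [phase, ← Complex.exp_conj, map_mul, Complex.conj_I, Complex.conj_ofReal]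
  push_cast
  ring_nf

/-- The unitary group with the Fourier multiplier `e^{i s θ}`. -/
def phaseOp (θ : R3 → ℝ) (s : ℝ) : Op := star fourierOp * mulOp (phase θ s) * fourierOp

theorem phaseOp_mul {θ : R3 → ℝ} (hθ : θ.HasTemperateGrowth) (s t : ℝ) :
    phaseOp θ s * phaseOp θ t = phaseOp θ (s + t) := by
  have h : mulOp (phase θ s) * mulOp (phase θ t) = mulOp (phase θ (s + t)) := by
    rw [mulOp_mul_mulOp (memLp_phase hθ s) (memLp_phase hθ t)]
    simp_rw [phase_mul]
  rw [phaseOp, phaseOp, phaseOp, ← h]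
  calc _ = star fourierOp * mulOp (phase θ s) * (fourierOp * star fourierOp) *
        mulOp (phase θ t) * fourierOp := by simp only [mul_assoc]
    _ = _ := by rw [fourierOp_mul_star_self]; simp only [mul_assoc, one_mul]

theorem phaseOp_zero (θ : R3 → ℝ) : phaseOp θ 0 = 1 := by
  have : phase θ 0 = fun _ => 1 := by ext x; simp [phase]
  rw [phaseOp, this, mulOp_one, mul_one, star_fourierOp_mul_self]

theorem star_phaseOp {θ : R3 → ℝ} (hθ : θ.HasTemperateGrowth) (s : ℝ) :
    star (phaseOp θ s) = phaseOp θ (-s) := by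
  rw [phaseOp, star_mul, star_mul, star_star, star_mulOp (memLp_phase hθ s), phaseOp]
  simp_rw [conj_phase]
  rw [mul_assoc]

theorem norm_phaseOp_le (θ : R3 → ℝ) (s : ℝ) : ‖phaseOp θ s‖ ≤ 1 := by
  refine (norm_mul_le _ _).trans (mul_le_one₀ ((norm_mul_le _ _).trans (mul_le_one₀ ?_
    (norm_nonneg _) ?_)) (norm_nonneg _) norm_fourierOp_le)
  · exact (norm_star fourierOp).trans_le norm_fourierOp_le
  · exact norm_mulOp_le zero_le_one fun x => (norm_phase θ s x).le

theorem continuous_phaseOp_apply {θ : R3 → ℝ} (hθ : θ.HasTemperateGrowth) (f : L2R3) :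
    Continuous fun s => phaseOp θ s f := by
  refine (star fourierOp).continuous.comp (continuous_iff_continuousAt.2 fun s => ?_)
  refine tendsto_mulOp_apply (fun r => (continuous_phase hθ r).measurable)
    (continuous_phase hθ s).measurable (fun r x => (norm_phase θ r x).le)
    (fun x => (norm_phase θ s x).le) (fun x => ?_) _
  have : Continuous fun r => phase θ r x := by unfold phase; fun_prop
  exact this.tendsto s

/-- Taylor's bound covers `|y| ≤ 1`; for larger `y` the left side is at most `2|y| ≤ 2y²`. An
estimate valid for all `y` is needed because the symbol is unbounded. -/
theorem norm_exp_I_mul_sub_le (y : ℝ) :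
    ‖Complex.exp (Complex.I * y) - 1 - Complex.I * y‖ ≤ 2 * y ^ 2 := by
  have hn : ‖Complex.I * (y : ℂ)‖ = |y| := by simp
  rcases le_total |y| 1 with h | h
  · refine (Complex.norm_exp_sub_one_sub_id_le (by rwa [hn])).trans ?_
    rw [hn, sq_abs]
    nlinarith [sq_nonneg y]
  · refine (norm_sub_le _ _).trans ?_
    rw [hn]
    have h1 := Real.norm_exp_I_mul_ofReal_sub_one_le (x := y)
    rw [Real.norm_eq_abs] at h1
    rw [← sq_abs]
    nlinarith

/-- The second order Taylor error is pointwise at most `2(r-s)²|θ²g|`, and `θ²g` is square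
integrable because `g` is Schwartz. -/
theorem hasDerivAt_mulOp_phase {θ : R3 → ℝ} (hθ : θ.HasTemperateGrowth) (g : 𝓢(R3, ℂ)) (s : ℝ) :
    HasDerivAt (fun s => mulOp (phase θ s) (schwartzL2 g))
      (mulOp (phase θ s) (Complex.I • schwartzL2
        (SchwartzMap.smulLeftCLM ℂ (fun x => (θ x : ℂ)) g))) s := by
  have hθc : (fun x => (θ x : ℂ)).HasTemperateGrowth := by fun_prop
  set T := SchwartzMap.smulLeftCLM ℂ (fun x => (θ x : ℂ)) with hT
  rw [hasDerivAt_iff_isLittleO]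
  have hbound : ∀ r, ‖mulOp (phase θ r) (schwartzL2 g) - mulOp (phase θ s) (schwartzL2 g) -
      (r - s) • mulOp (phase θ s) (Complex.I • schwartzL2 (T g))‖ ≤
        2 * ‖schwartzL2 (T (T g))‖ * ‖(r - s) ^ 2‖ := by
    intro r
    have : 2 * ‖schwartzL2 (T (T g))‖ * ‖(r - s) ^ 2‖ =
      (2 * ‖(r - s) ^ 2‖) * ‖schwartzL2 (T (T g))‖ := by ring
    rw [this]
    refine Lp.norm_le_mul_norm_of_ae_le_mul ?_
    filter_upwards [mulOp_apply _ (memLp_phase hθ r) (schwartzL2 g),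
      mulOp_apply _ (memLp_phase hθ s) (schwartzL2 g),
      mulOp_apply _ (memLp_phase hθ s) (Complex.I • schwartzL2 (T g)),
      Lp.coeFn_smul Complex.I (schwartzL2 (T g)), schwartzL2_coeFn g, schwartzL2_coeFn (T g),
      schwartzL2_coeFn (T (T g)),
      Lp.coeFn_smul (r - s) (mulOp (phase θ s) (Complex.I • schwartzL2 (T g))),
      Lp.coeFn_sub (mulOp (phase θ r) (schwartzL2 g)) (mulOp (phase θ s) (schwartzL2 g)),
      Lp.coeFn_sub (mulOp (phase θ r) (schwartzL2 g) - mulOp (phase θ s) (schwartzL2 g))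
        ((r - s) • mulOp (phase θ s) (Complex.I • schwartzL2 (T g)))]
      with x h1 h2 h3 h4 h5 h6 h7 h8 h9 h10
    rw [h10, Pi.sub_apply, h9, Pi.sub_apply, h8, Pi.smul_apply, h1, h2, h3, h4, Pi.smul_apply, h5,
      h6, h7, hT, SchwartzMap.smulLeftCLM_apply_apply hθc, SchwartzMap.smulLeftCLM_apply_apply hθc,
      SchwartzMap.smulLeftCLM_apply_apply hθc]
    have e1 : phase θ r x = phase θ s x * Complex.exp (Complex.I * (((r - s) * θ x : ℝ) : ℂ)) := by
      rw [← show s + (r - s) = r by ring, ← phase_mul]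
      simp [phase]
    have e2 : phase θ r x * g x - phase θ s x * g x -
        (r - s) • (phase θ s x * Complex.I • (θ x : ℂ) • g x) = phase θ s x *
          (Complex.exp (Complex.I * (((r - s) * θ x : ℝ) : ℂ)) - 1 -
            Complex.I * (((r - s) * θ x : ℝ) : ℂ)) * g x := by
      rw [e1]
      simp only [smul_eq_mul, Complex.real_smul]
      push_cast
      ring
    rw [e2, norm_mul, norm_mul, norm_phase, one_mul, norm_smul, norm_smul, Complex.norm_real,
      ← mul_assoc, ← mul_assoc]
    refine mul_le_mul_of_nonneg_right ((norm_exp_I_mul_sub_le _).trans_eq ?_) (norm_nonneg _)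
    rw [mul_pow, Real.norm_of_nonneg (sq_nonneg _), Real.norm_eq_abs, mul_assoc (2 * (r - s) ^ 2),
      abs_mul_abs_self]
    ring
  refine (Asymptotics.IsBigO.of_bound _ (Eventually.of_forall hbound)).trans_isLittleO ?_
  have h1 : Tendsto (fun r : ℝ => r - s) (𝓝 s) (𝓝 0) := by
    simpa using (by fun_prop : Continuous fun r : ℝ => r - s).tendsto s
  exact (Asymptotics.isLittleO_pow_id one_lt_two).comp_tendsto h1

theorem phaseOp_schwartz {θ : R3 → ℝ} (hθ : θ.HasTemperateGrowth) (s : ℝ) (f : 𝓢(R3, ℂ)) :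
    phaseOp θ s (schwartzL2 f) =
      schwartzL2 (SchwartzMap.fourierMultiplierCLM ℂ (phase θ s) f) := by
  rw [phaseOp, mul_apply_eq_comp, mul_apply_eq_comp, fourierOp_schwartz,
    mulOp_schwartz (memLp_phase hθ s) (hasTemperateGrowth_phase hθ s), star_fourierOp_schwartz]
  rfl

theorem hasDerivAt_phaseOp {θ : R3 → ℝ} (hθ : θ.HasTemperateGrowth) (f : 𝓢(R3, ℂ)) (s : ℝ) :
    HasDerivAt (fun s => phaseOp θ s (schwartzL2 f))
      (Complex.I • schwartzL2 (SchwartzMap.fourierMultiplierCLM ℂ (fun x => (θ x : ℂ))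
        (SchwartzMap.fourierMultiplierCLM ℂ (phase θ s) f))) s := by
  have hθc : (fun x => (θ x : ℂ)).HasTemperateGrowth := by fun_prop
  have h1 := ((star fourierOp).restrictScalars ℝ).hasFDerivAt.comp_hasDerivAt s
    (hasDerivAt_mulOp_phase hθ (𝓕 f) s)
  have h2 : (fun s => phaseOp θ s (schwartzL2 f)) =
      fun s => (star fourierOp : Op) (mulOp (phase θ s) (schwartzL2 (𝓕 f))) := by
    ext1 s
    rw [phaseOp, mul_apply_eq_comp, mul_apply_eq_comp, fourierOp_schwartz]
  rw [h2]
  refine HasDerivAt.congr_deriv h1 ?_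
  change (star fourierOp : Op) _ = _
  rw [map_smul, map_smul]
  congr 1
  rw [mulOp_schwartz (memLp_phase hθ s) (hasTemperateGrowth_phase hθ s), star_fourierOp_schwartz,
    SchwartzMap.fourierMultiplierCLM_fourierMultiplierCLM_apply hθc (hasTemperateGrowth_phase hθ s),
    SchwartzMap.fourierMultiplierCLM_apply,
    SchwartzMap.smulLeftCLM_smulLeftCLM_apply (hasTemperateGrowth_phase hθ s) hθc, mul_comm]

end PhaseGroup

/-! ### Translations, free Schrödinger group and phase space shifts. -/

section Weyl

theorem translationOp_schwartz (a : R3) (f : 𝓢(R3, ℂ)) :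
    translationOp a (schwartzL2 f) = schwartzL2 (f.compSubConstCLM ℂ (-a)) := by
  apply Lp.ext
  filter_upwards [translationOp_apply a (schwartzL2 f), ae_comp_add_right a (schwartzL2_coeFn f),
    schwartzL2_coeFn (f.compSubConstCLM ℂ (-a))] with x h1 h2 h3
  rw [h1, h2, h3, SchwartzMap.compSubConstCLM_apply, sub_neg_eq_add]

/-- The symbol of the directional derivative. -/
def shiftSymbol (a x : R3) : ℝ := 2 * Real.pi * inner ℝ x a

theorem hasTemperateGrowth_shiftSymbol (a : R3) : (shiftSymbol a).HasTemperateGrowth := by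
  unfold shiftSymbol
  fun_prop

theorem fourierOp_mul_translationOp (s : ℝ) (a : R3) :
    fourierOp * translationOp (s • a) = mulOp (phase (shiftSymbol a) s) * fourierOp := by
  have hθ := hasTemperateGrowth_shiftSymbol a
  refine op_ext_schwartz fun f => ?_
  rw [mul_apply_eq_comp, mul_apply_eq_comp, translationOp_schwartz, fourierOp_schwartz,
    fourierOp_schwartz, mulOp_schwartz (memLp_phase hθ s) (hasTemperateGrowth_phase hθ s)]
  congr 1
  ext w
  rw [SchwartzMap.smulLeftCLM_apply_apply (hasTemperateGrowth_phase hθ s), SchwartzMap.fourier_coe,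
    SchwartzMap.fourier_coe, Real.fourier_eq', Real.fourier_eq', ← integral_smul]
  rw [← integral_sub_right_eq_self _ (s • a)]
  refine integral_congr_ae (Eventually.of_forall fun v => ?_)
  simp only [SchwartzMap.compSubConstCLM_apply, sub_neg_eq_add, sub_add_cancel, smul_eq_mul,
    ← mul_assoc, phase, ← Complex.exp_add]
  congr 2
  simp only [shiftSymbol, inner_sub_left, real_inner_smul_left, real_inner_comm w a]
  push_cast
  ring

theorem fourierOp_mul_waveOp (q : R3) :
    fourierOp * waveOp q = translationOp (-((2 * Real.pi)⁻¹ • q)) * fourierOp := by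
  have hπ : (2 * Real.pi : ℝ) ≠ 0 := by positivity
  have hg : (planeWave q).HasTemperateGrowth := by
    have h : (fun x : R3 => inner ℝ q x).HasTemperateGrowth := by fun_prop
    exact hasTemperateGrowth_exp_mul_I.comp h
  refine op_ext_schwartz fun f => ?_
  rw [mul_apply_eq_comp, mul_apply_eq_comp, waveOp, mulOp_schwartz (memLp_planeWave q) hg,
    fourierOp_schwartz, fourierOp_schwartz, translationOp_schwartz]
  congr 1
  ext w
  rw [SchwartzMap.compSubConstCLM_apply, SchwartzMap.fourier_coe, SchwartzMap.fourier_coe,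
    Real.fourier_eq', Real.fourier_eq']
  refine integral_congr_ae (Eventually.of_forall fun v => ?_)
  simp only [SchwartzMap.smulLeftCLM_apply_apply hg, smul_eq_mul, ← mul_assoc, planeWave,
    ← Complex.exp_add]
  congr 2
  simp only [neg_neg, inner_sub_right, real_inner_smul_right, real_inner_comm q v]
  push_cast
  field_simp
  ring

/-- Translations and the free evolution are thus both `phaseOp` groups; derivatives and commutation
follow from the common construction. -/
theorem translationOp_eq_phaseOp (s : ℝ) (a : R3) :
    translationOp (s • a) = phaseOp (shiftSymbol a) s := by
  rw [phaseOp, mul_assoc, ← fourierOp_mul_translationOp, ← mul_assoc, star_fourierOp_mul_self,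
    one_mul]

theorem lineDeriv_eq_multiplier (a : R3) (f : 𝓢(R3, ℂ)) :
    ∂_{a} f = Complex.I • SchwartzMap.fourierMultiplierCLM ℂ
      (fun x => ((shiftSymbol a x : ℝ) : ℂ)) f := by
  rw [SchwartzMap.lineDeriv_eq_fourierMultiplierCLM, ← SchwartzMap.fourierMultiplierCLM_ofReal ℂ
    (by fun_prop : (fun x : R3 => inner ℝ x a).HasTemperateGrowth)]
  have h : (fun x => ((shiftSymbol a x : ℝ) : ℂ)) =
      (2 * Real.pi : ℂ) • fun x => ((inner ℝ x a : ℝ) : ℂ) := by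
    ext x
    simp [shiftSymbol]
  rw [h, SchwartzMap.fourierMultiplierCLM_smul (by fun_prop), _root_.smul_apply, smul_smul]
  congr 1
  ring

theorem hasDerivAt_translationOp (a : R3) (f : 𝓢(R3, ℂ)) (s : ℝ) :
    HasDerivAt (fun s : ℝ => translationOp (s • a) (schwartzL2 f)) (schwartzL2
      (∂_{a} (SchwartzMap.fourierMultiplierCLM ℂ (phase (shiftSymbol a) s) f))) s := by
  simp_rw [translationOp_eq_phaseOp]
  refine (hasDerivAt_phaseOp (hasTemperateGrowth_shiftSymbol a) f s).congr_deriv ?_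
  rw [lineDeriv_eq_multiplier]
  rfl

/-- The symbol of the Laplacian. -/
def freeSymbol (x : R3) : ℝ := -(2 * Real.pi) ^ 2 * ‖x‖ ^ 2

theorem hasTemperateGrowth_freeSymbol : freeSymbol.HasTemperateGrowth := by
  unfold freeSymbol
  fun_prop

/-- The free Schrödinger group `e^{i s Δ}`. -/
def freeOp (s : ℝ) : Op := phaseOp freeSymbol s

/-- The free Schrödinger group on Schwartz functions. -/
def freeSchwartz (s : ℝ) (f : 𝓢(R3, ℂ)) : 𝓢(R3, ℂ) :=
  SchwartzMap.fourierMultiplierCLM ℂ (phase freeSymbol s) f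

theorem freeOp_schwartz (s : ℝ) (f : 𝓢(R3, ℂ)) :
    freeOp s (schwartzL2 f) = schwartzL2 (freeSchwartz s f) :=
  phaseOp_schwartz hasTemperateGrowth_freeSymbol s f

theorem laplacian_eq_multiplier (f : 𝓢(R3, ℂ)) :
    Δ f = SchwartzMap.fourierMultiplierCLM ℂ (fun x => ((freeSymbol x : ℝ) : ℂ)) f := by
  have h0 : (fun x : R3 => ‖x‖ ^ 2).HasTemperateGrowth := by fun_prop
  have h1 : (fun x : R3 => ((‖x‖ ^ 2 : ℝ) : ℂ)).HasTemperateGrowth := by fun_prop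
  rw [SchwartzMap.laplacian_eq_fourierMultiplierCLM, ← SchwartzMap.fourierMultiplierCLM_ofReal ℂ h0]
  have h : (fun x => ((freeSymbol x : ℝ) : ℂ)) =
      ((-(2 * Real.pi) ^ 2 : ℝ) : ℂ) • fun x : R3 => ((‖x‖ ^ 2 : ℝ) : ℂ) := by
    ext x
    simp [freeSymbol]
  rw [h, SchwartzMap.fourierMultiplierCLM_smul h1, _root_.smul_apply]
  ext x
  simp

theorem hasDerivAt_freeOp (f : 𝓢(R3, ℂ)) (s : ℝ) :
    HasDerivAt (fun s => freeOp s (schwartzL2 f))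
      (Complex.I • schwartzL2 (Δ (freeSchwartz s f))) s := by
  rw [laplacian_eq_multiplier]
  exact hasDerivAt_phaseOp hasTemperateGrowth_freeSymbol f s

theorem norm_freeOp_le (s : ℝ) : ‖freeOp s‖ ≤ 1 := norm_phaseOp_le _ _

theorem star_freeOp (s : ℝ) : star (freeOp s) = freeOp (-s) :=
  star_phaseOp hasTemperateGrowth_freeSymbol s

theorem freeOp_mul_star (s : ℝ) : freeOp s * star (freeOp s) = 1 := by
  rw [star_freeOp, freeOp, freeOp, phaseOp_mul hasTemperateGrowth_freeSymbol, add_neg_cancel,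
    phaseOp_zero]

theorem freeOp_zero : freeOp 0 = 1 := phaseOp_zero _

theorem freeOp_mul_translationOp (s : ℝ) (a : R3) :
    freeOp s * translationOp a = translationOp a * freeOp s := by
  have ha : translationOp a = phaseOp (shiftSymbol a) 1 := by
    rw [← translationOp_eq_phaseOp, one_smul]
  have key : ∀ A B : Op, star fourierOp * A * fourierOp * (star fourierOp * B * fourierOp) =
      star fourierOp * (A * B) * fourierOp := fun A B => by
    calc _ = star fourierOp * A * (fourierOp * star fourierOp) * B * fourierOp := by
          simp only [mul_assoc]
      _ = _ := by rw [fourierOp_mul_star_self, mul_one, mul_assoc _ A B]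
  have h1 := memLp_phase hasTemperateGrowth_freeSymbol s
  have h2 := memLp_phase (hasTemperateGrowth_shiftSymbol a) 1
  rw [ha, freeOp, phaseOp, phaseOp, key, key, mulOp_mul_mulOp h1 h2, mulOp_mul_mulOp h2 h1]
  simp_rw [mul_comm]

/-- Galilean covariance: a momentum boost by `q` before the free flow is a boost together with a
displacement by `2sq` after it. The phase is irrelevant, since only conjugations occur later. -/
theorem freeOp_mul_waveOp (s : ℝ) (q : R3) :
    ∃ c : ℂ, ‖c‖ = 1 ∧
      freeOp s * waveOp q = c • (waveOp q * translationOp (-(2 * s) • q) * freeOp s) := by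
  have hπ : (2 * Real.pi : ℝ) ≠ 0 := by positivity
  set b : R3 := (2 * Real.pi)⁻¹ • q with hb
  set m := phase freeSymbol s with hm
  have hmL : MemLp m ∞ (volume : Measure R3) := memLp_phase hasTemperateGrowth_freeSymbol s
  have hmb : MemLp (fun x => m (x + -b)) ∞ (volume : Measure R3) :=
    hmL.comp_measurePreserving (measurePreserving_add_right volume (-b))
  have hsh := memLp_phase (hasTemperateGrowth_shiftSymbol q) (-(2 * s))
  set c0 : ℂ := Complex.exp (Complex.I * ((s * ‖q‖ ^ 2 : ℝ) : ℂ)) with hc0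
  -- Completion of the square: in Fourier variables the boost shifts by `b = q/2π`, and `|x|² =
  -- |x-b|² + 2x·b - |b|²`. The linear term is the symbol of the translation, the constant one is
  -- `c0`.
  have hm' : mulOp m = c0 • (mulOp (phase (shiftSymbol q) (-(2 * s))) *
      mulOp (fun x => m (x + -b))) := by
    have hsc : ∀ ψ : R3 → ℂ, MemLp ψ ∞ (volume : Measure R3) →
        c0 • mulOp ψ = mulOp fun x => c0 * ψ x := fun ψ hψ => by
      rw [← mulOp_mul_mulOp (memLp_top_const c0) hψ, mulOp_const, smul_mul_assoc, one_mul]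
    rw [mulOp_mul_mulOp hsh hmb]
    refine Eq.trans ?_ (hsc _ (hmb.mul hsh)).symm
    congr 1
    ext x
    simp only [hm, phase, hc0, Pi.mul_apply, ← Complex.exp_add]
    congr 1
    rw [← mul_add, ← mul_add]
    congr 1
    rw [← Complex.ofReal_add, ← Complex.ofReal_add]
    congr 1
    simp only [freeSymbol, shiftSymbol, ← sub_eq_add_neg, norm_sub_sq_real, hb, norm_smul,
      real_inner_smul_right, norm_inv, mul_pow, inv_pow, Real.norm_eq_abs, sq_abs]
    field_simp
    ring
  have h1 : freeOp s * waveOp q =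
      c0 • (translationOp (-(2 * s) • q) * waveOp q * freeOp s) := by
    have e1 : fourierOp * waveOp q = translationOp (-b) * fourierOp := fourierOp_mul_waveOp q
    have e2 : translationOp (-b) * mulOp m = mulOp (fun x => m (x + -b)) * translationOp (-b) :=
      translationOp_mul_mulOp (-b) hmL
    have e3 : star fourierOp * mulOp (phase (shiftSymbol q) (-(2 * s))) =
        translationOp (-(2 * s) • q) * star fourierOp := by
      rw [translationOp_eq_phaseOp, phaseOp, mul_assoc _ fourierOp, fourierOp_mul_star_self,
        mul_one]
    have e4 : waveOp q * star fourierOp = star fourierOp * translationOp (-b) := by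
      calc waveOp q * star fourierOp
          = star fourierOp * (fourierOp * waveOp q) * star fourierOp := by
            rw [← mul_assoc, star_fourierOp_mul_self, one_mul]
        _ = star fourierOp * translationOp (-b) * (fourierOp * star fourierOp) := by
            rw [e1]; simp only [mul_assoc]
        _ = _ := by rw [fourierOp_mul_star_self, mul_one]
    calc freeOp s * waveOp q = star fourierOp * mulOp m * (fourierOp * waveOp q) := by
          rw [freeOp, phaseOp, mul_assoc]
      _ = c0 • (star fourierOp * mulOp (phase (shiftSymbol q) (-(2 * s))) *
            (mulOp (fun x => m (x + -b)) * translationOp (-b)) * fourierOp) := by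
          rw [e1, hm']
          simp only [mul_smul_comm, smul_mul_assoc, mul_assoc]
      _ = c0 • (translationOp (-(2 * s) • q) * (star fourierOp * translationOp (-b)) *
            mulOp m * fourierOp) := by
          rw [e3, ← e2]
          simp only [mul_assoc]
      _ = _ := by
          rw [← e4, freeOp, phaseOp]
          simp only [mul_assoc]
          rfl
  refine ⟨c0 * planeWave q (-(2 * s) • q), ?_, ?_⟩
  · rw [norm_mul, norm_planeWave, hc0, Complex.norm_exp_I_mul_ofReal, mul_one]
  · rw [h1, translationOp_mul_waveOp, smul_mul_assoc, smul_smul]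

/-- The Weyl operators, up to a phase. -/
def shiftOp (q a : R3) : Op := waveOp q * translationOp a

theorem shiftOp_mul_star (q a : R3) : shiftOp q a * star (shiftOp q a) = 1 := by
  rw [shiftOp, star_mul, star_waveOp, star_translationOp]
  calc _ = waveOp q * (translationOp a * translationOp (-a)) * waveOp (-q) := by
        simp only [mul_assoc]
    _ = 1 := by
        rw [translationOp_mul, add_neg_cancel, translationOp_zero, mul_one, waveOp_mul,
          add_neg_cancel, waveOp_zero]

theorem star_shiftOp_mul (q a : R3) : star (shiftOp q a) * shiftOp q a = 1 := by
  rw [shiftOp, star_mul, star_waveOp, star_translationOp]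
  calc _ = translationOp (-a) * (waveOp (-q) * waveOp q) * translationOp a := by
        simp only [mul_assoc]
    _ = 1 := by
        rw [waveOp_mul, neg_add_cancel, waveOp_zero, mul_one, translationOp_mul, neg_add_cancel,
          translationOp_zero]

theorem norm_shiftOp_le (q a : R3) : ‖shiftOp q a‖ ≤ 1 :=
  (norm_mul_le _ _).trans (mul_le_one₀ (norm_waveOp_le q) (norm_nonneg _)
    (norm_translationOp_le a))

theorem freeOp_mul_shiftOp (s : ℝ) (q a : R3) :
    ∃ c : ℂ, ‖c‖ = 1 ∧
      freeOp s * shiftOp q a = c • (shiftOp q (a - (2 * s) • q) * freeOp s) := by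
  obtain ⟨c, hc, h⟩ := freeOp_mul_waveOp s q
  refine ⟨c, hc, ?_⟩
  rw [shiftOp, ← mul_assoc, h, smul_mul_assoc, mul_assoc _ (freeOp s), freeOp_mul_translationOp,
    ← mul_assoc, mul_assoc (waveOp q), translationOp_mul, shiftOp, neg_smul, neg_add_eq_sub]

/-- Conjugation with a Weyl operator in the free evolution. -/
theorem conj_shiftOp_conj_freeOp (s : ℝ) (q a : R3) (A : Op) :
    star (shiftOp q a) * (star (freeOp s) * A * freeOp s) * shiftOp q a =
      star (freeOp s) * (star (shiftOp q (a - (2 * s) • q)) * A *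
        shiftOp q (a - (2 * s) • q)) * freeOp s := by
  obtain ⟨c, hc, h⟩ := freeOp_mul_shiftOp s q a
  have h' : star (shiftOp q a) * star (freeOp s) =
      star c • (star (freeOp s) * star (shiftOp q (a - (2 * s) • q))) := by
    rw [← star_mul, h, star_smul, star_mul]
  have hcc : star c * c = 1 := by
    rw [← starRingEnd_apply, ← Complex.normSq_eq_conj_mul_self, Complex.normSq_eq_norm_sq, hc]
    norm_num
  calc _ = (star (shiftOp q a) * star (freeOp s)) * A * (freeOp s * shiftOp q a) := by
        simp only [mul_assoc]
    _ = (star c * c) • ((star (freeOp s) * star (shiftOp q (a - (2 * s) • q))) * A *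
        (shiftOp q (a - (2 * s) • q) * freeOp s)) := by
        rw [h', h]
        simp only [smul_mul_assoc, mul_smul_comm, smul_smul]
        rw [mul_comm]
    _ = _ := by rw [hcc, one_smul]; simp only [mul_assoc]

/-- The plane wave factor of the shift commutes with `waveOp k`, so only the translation
contributes, with a scalar. -/
theorem conj_shiftOp_waveOp (q a k : R3) :
    star (shiftOp q a) * waveOp k * shiftOp q a = planeWave k (-a) • waveOp k := by
  rw [shiftOp, star_mul, star_waveOp, star_translationOp]
  calc _ = translationOp (-a) * (waveOp (-q) * waveOp k * waveOp q) * translationOp a := by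
        simp only [mul_assoc]
    _ = translationOp (-a) * waveOp k * translationOp a := by
        rw [waveOp_mul, waveOp_mul]
        congr 3
        abel
    _ = _ := by
        rw [translationOp_mul_waveOp, smul_mul_assoc, mul_assoc, translationOp_mul,
          neg_add_cancel, translationOp_zero, mul_one]

theorem traceNorm_mul_mul_le {V W : Op} (hV : ‖V‖ ≤ 1) (hW : ‖W‖ ≤ 1) (A : Op) :
    traceNorm (V * A * W) ≤ traceNorm A := by
  have h2 : ∀ {X : Op}, ‖X‖ ≤ 1 → ‖X‖ₑ ≤ 1 := fun h => by
    rw [← ofReal_norm]; exact ENNReal.ofReal_le_one.2 h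
  refine (traceNorm_mul_le_right _ _).trans ((mul_le_of_le_one_right' (h2 hW)).trans ?_)
  exact (traceNorm_mul_le_left _ _).trans (mul_le_of_le_one_left' (h2 hV))

/-- Multiplication by a unitary preserves the trace norm. The conjugation form is preferred because
it is compatible with the flow. -/
theorem traceNorm_sub_conj_shiftOp (q a : R3) (A : Op) :
    traceNorm (A - star (shiftOp q a) * A * shiftOp q a) =
      traceNorm (shiftOp q a * A - A * shiftOp q a) := by
  have h1 : A - star (shiftOp q a) * A * shiftOp q a =
      star (shiftOp q a) * (shiftOp q a * A - A * shiftOp q a) * 1 := by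
    rw [mul_sub, ← mul_assoc, star_shiftOp_mul, one_mul, mul_one, mul_assoc]
  have h2 : shiftOp q a * A - A * shiftOp q a =
      shiftOp q a * (A - star (shiftOp q a) * A * shiftOp q a) * 1 := by
    rw [mul_sub, ← mul_assoc, ← mul_assoc, shiftOp_mul_star, one_mul, mul_one]
  have h3 : ‖star (shiftOp q a)‖ ≤ 1 := (norm_star _).trans_le (norm_shiftOp_le q a)
  have h4 : ‖(1 : Op)‖ ≤ 1 := ContinuousLinearMap.norm_id_le
  refine le_antisymm ?_ ?_
  · rw [h1]; exact traceNorm_mul_mul_le h3 h4 _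
  · conv_lhs => rw [h2]
    exact traceNorm_mul_mul_le (norm_shiftOp_le q a) h4 _

end Weyl

/-! ### Operator integrals in the sense of forms. -/

section WeakIntegral

variable {H : Type} [NormedAddCommGroup H] [InnerProductSpace ℂ H] [CompleteSpace H]

/-- `B = ∫ c(p) T(p) dp` in the sense of sesquilinear forms. -/
structure IsWeakIntegral {P : Type} [MeasurableSpace P] (μ : Measure P) (c : P → ℂ)
    (T : P → H →L[ℂ] H) (B : H →L[ℂ] H) : Prop where
  integrable : ∀ f g, Integrable (fun p => c p * inner ℂ f (T p g)) μ
  inner_eq : ∀ f g, inner ℂ f (B g) = ∫ p, c p * inner ℂ f (T p g) ∂μ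

namespace IsWeakIntegral

variable {P : Type} [MeasurableSpace P] {μ : Measure P} {c c' : P → ℂ} {T T' : P → H →L[ℂ] H}
  {B B' : H →L[ℂ] H}

omit [CompleteSpace H] in
theorem sub_op (h : IsWeakIntegral μ c T B) (h' : IsWeakIntegral μ c T' B') :
    IsWeakIntegral μ c (fun p => T p - T' p) (B - B') where
  integrable f g := by
    simp only [_root_.sub_apply, inner_sub_right, mul_sub]
    exact (h.integrable f g).sub (h'.integrable f g)
  inner_eq f g := by
    simp only [_root_.sub_apply, inner_sub_right, mul_sub]
    rw [h.inner_eq, h'.inner_eq, integral_sub (h.integrable f g) (h'.integrable f g)]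

omit [CompleteSpace H] in
theorem sub_coeff (h : IsWeakIntegral μ c T B) (h' : IsWeakIntegral μ c' T B') :
    IsWeakIntegral μ (fun p => c p - c' p) T (B - B') where
  integrable f g := by
    simp only [sub_mul]
    exact (h.integrable f g).sub (h'.integrable f g)
  inner_eq f g := by
    simp only [_root_.sub_apply, inner_sub_right, sub_mul]
    rw [h.inner_eq, h'.inner_eq, integral_sub (h.integrable f g) (h'.integrable f g)]

theorem mul_mul (h : IsWeakIntegral μ c T B) (A A' : H →L[ℂ] H) :
    IsWeakIntegral μ c (fun p => A * T p * A') (A * B * A') := by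
  have key : ∀ (X : H →L[ℂ] H) (f g : H), inner ℂ f ((A * X * A') g) =
      inner ℂ (star A f) (X (A' g)) := fun X f g => by
    simp [ContinuousLinearMap.star_eq_adjoint, ContinuousLinearMap.adjoint_inner_left]
  refine ⟨fun f g => ?_, fun f g => ?_⟩
  · simpa only [key] using h.integrable (star A f) (A' g)
  · simpa only [key] using h.inner_eq (star A f) (A' g)

theorem commutator (h : IsWeakIntegral μ c T B) (A : H →L[ℂ] H) :
    IsWeakIntegral μ c (fun p => T p * A - A * T p) (B * A - A * B) := by
  simpa only [one_mul, mul_one] using (h.mul_mul 1 A).sub_op (h.mul_mul A 1)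

/-- Each dual pairing is a finite sum and can be taken inside the integral; this avoids Bochner
integration of trace class operators. -/
theorem traceNorm_le (h : IsWeakIntegral μ c T B) {w b : P → ℝ} (hw0 : ∀ p, 0 ≤ w p)
    (hw : ∀ p, traceNorm (T p) ≤ ENNReal.ofReal (w p)) (hb : ∀ p, ‖c p‖ * w p ≤ b p)
    (hint : Integrable b μ) : traceNorm B ≤ ENNReal.ofReal (∫ p, b p ∂μ) := by
  refine traceNorm_le_of_forall fun U hU F => ?_
  rw [← ofReal_norm]
  refine ENNReal.ofReal_le_ofReal ?_
  simp_rw [h.inner_eq]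
  rw [← integral_finsetSum _ fun i _ => h.integrable _ _]
  refine norm_integral_le_of_norm_le hint (Eventually.of_forall fun p => le_trans ?_ (hb p))
  rw [← Finset.mul_sum, norm_mul]
  gcongr
  have := (enorm_sum_inner_le_traceNorm (T p) hU F).trans (hw p)
  rwa [← ofReal_norm, ENNReal.ofReal_le_ofReal_iff (hw0 p)] at this

omit [CompleteSpace H] in
theorem norm_le (h : IsWeakIntegral μ c T B) {b : P → ℝ} (hb : ∀ p, ‖c p‖ * ‖T p‖ ≤ b p)
    (hint : Integrable b μ) : ‖B‖ ≤ ∫ p, b p ∂μ := by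
  have hI : 0 ≤ ∫ p, b p ∂μ := integral_nonneg fun p =>
    (mul_nonneg (norm_nonneg (c p)) (norm_nonneg (T p))).trans (hb p)
  refine ContinuousLinearMap.opNorm_le_bound _ hI fun g => ?_
  -- Testing with `f = B g` gives `‖B g‖²` on the left; one factor `‖B g‖` is then divided out.
  have h1 : ‖inner ℂ (B g) (B g)‖ ≤ ∫ p, b p * (‖B g‖ * ‖g‖) ∂μ := by
    rw [h.inner_eq]
    refine norm_integral_le_of_norm_le (hint.mul_const _) (Eventually.of_forall fun p => ?_)
    refine le_trans ?_ (mul_le_mul_of_nonneg_right (hb p) (by positivity))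
    rw [norm_mul, mul_assoc]
    gcongr
    refine (norm_inner_le_norm _ _).trans ?_
    calc _ ≤ ‖B g‖ * (‖T p‖ * ‖g‖) := by
          gcongr
          exact (T p).le_opNorm g
      _ = _ := by ring
  rw [integral_mul_const, inner_self_eq_norm_sq_to_K] at h1
  have h2 : ‖B g‖ ^ 2 ≤ (∫ p, b p ∂μ) * (‖B g‖ * ‖g‖) := by simpa using h1
  by_contra! hlt
  have h3 : 0 < ‖B g‖ := (mul_nonneg hI (norm_nonneg g)).trans_lt hlt
  nlinarith

end IsWeakIntegral

end WeakIntegral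

/-! ### Fubini for an integrable coefficient and a bounded kernel. -/

section Fubini

variable {Z : Type} [MeasurableSpace Z] {ν : Measure Z} [SFinite ν] {c : R3 → ℂ} {F : Z → ℂ}
  {h : R3 × Z → ℂ}

omit [SFinite ν] in
theorem integrable_mul_prod_of_norm_le_one (hc : Integrable c) (hF : Integrable F ν)
    (hm : Measurable h) (h1 : ∀ z, ‖h z‖ ≤ 1) :
    Integrable (fun q : R3 × Z => c q.1 * (h q * F q.2)) (volume.prod ν) := by
  refine ((hc.mul_prod hF).bdd_mul hm.aestronglyMeasurable (c := 1)
    (Eventually.of_forall h1)).congr (Eventually.of_forall fun q => ?_)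
  ring

theorem integrable_mul_integral (hc : Integrable c) (hF : Integrable F ν)
    (hm : Measurable h) (h1 : ∀ z, ‖h z‖ ≤ 1) :
    Integrable (fun p => c p * ∫ z, h (p, z) * F z ∂ν) := by
  have := (integrable_mul_prod_of_norm_le_one hc hF hm h1).integral_prod_left
  simpa only [integral_const_mul] using this

theorem integral_mul_integral_swap (hc : Integrable c) (hF : Integrable F ν)
    (hm : Measurable h) (h1 : ∀ z, ‖h z‖ ≤ 1) :
    ∫ z, (∫ p, c p * h (p, z)) * F z ∂ν = ∫ p, c p * ∫ z, h (p, z) * F z ∂ν := by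
  have := integral_integral_swap (f := fun p z => c p * (h (p, z) * F z))
    (integrable_mul_prod_of_norm_le_one hc hF hm h1)
  simp only [integral_const_mul] at this
  rw [this]
  refine integral_congr_ae (Eventually.of_forall fun z => ?_)
  simp only [← integral_mul_const, mul_assoc]

end Fubini

/-! ### Almost everywhere Fourier inversion for the potential. -/

section Inversion

/-- The character `e^{2 π i p · x}`. -/
def wave (p x : R3) : ℂ := planeWave ((2 * Real.pi) • p) x

theorem norm_wave (p x : R3) : ‖wave p x‖ = 1 := norm_planeWave _ _

theorem continuous_wave : Continuous fun z : R3 × R3 => wave z.1 z.2 := by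
  unfold wave planeWave
  fun_prop

theorem fourierInv_eq_wave (f : R3 → ℂ) (p : R3) : 𝓕⁻ f p = ∫ x, wave p x * f x := by
  rw [Real.fourierInv_eq']
  refine integral_congr_ae (Eventually.of_forall fun x => ?_)
  simp only [wave, planeWave, smul_eq_mul, real_inner_smul_left, real_inner_comm p x]
  congr 2
  push_cast
  ring

theorem fourier_eq_wave (f : R3 → ℂ) (p : R3) : 𝓕 f p = ∫ x, wave p (-x) * f x := by
  rw [Real.fourier_eq']
  refine integral_congr_ae (Eventually.of_forall fun x => ?_)
  simp only [wave, planeWave, smul_eq_mul, real_inner_smul_left, inner_neg_right,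
    real_inner_comm p x]
  congr 2
  push_cast
  ring

theorem wave_comm (p x : R3) : wave p x = wave x p := by
  simp only [wave, planeWave, real_inner_smul_left, real_inner_comm p x]

/-- The inverse Fourier integral of an integrable function, in terms of `wave`. -/
def waveIntegral (c : R3 → ℂ) (x : R3) : ℂ := ∫ p, c p * wave p x

theorem continuous_waveIntegral {c : R3 → ℂ} (hc : Integrable c) : Continuous (waveIntegral c) := by
  refine continuous_of_dominated (bound := fun p => ‖c p‖) (fun x => ?_) (fun x => ?_) hc.norm ?_
  · have : Continuous fun p => wave p x := by unfold wave planeWave; fun_prop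
    exact hc.aestronglyMeasurable.mul this.aestronglyMeasurable
  · exact Eventually.of_forall fun p => by rw [norm_mul, norm_wave, mul_one]
  · refine Eventually.of_forall fun p => continuous_const.mul ?_
    unfold wave planeWave
    fun_prop

theorem norm_waveIntegral_le (c : R3 → ℂ) (x : R3) : ‖waveIntegral c x‖ ≤ ∫ p, ‖c p‖ := by
  refine (norm_integral_le_integral_norm _).trans_eq ?_
  simp only [norm_mul, norm_wave, mul_one]

/-- Fourier inversion almost everywhere. -/
theorem ae_eq_waveIntegral_fourier {V : R3 → ℂ} (hV : Integrable V) (hVhat : Integrable (𝓕 V)) :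
    V =ᵐ[volume] waveIntegral (𝓕 V) := by
  refine ae_eq_of_integral_contDiff_smul_eq hV.locallyIntegrable
    (continuous_waveIntegral hVhat).locallyIntegrable fun g hg hgc => ?_
  have hcc : HasCompactSupport fun x => (g x : ℂ) := hgc.comp_left Complex.ofReal_zero
  have hcd : ContDiff ℝ (↑(⊤ : ℕ∞)) fun x => (g x : ℂ) := Complex.ofRealCLM.contDiff.comp hg
  set φ : 𝓢(R3, ℂ) := hcc.toSchwartzMap hcd with hφ
  have hφa : ∀ x, φ x = g x := fun x => rfl
  have h1 : ∫ x, g x • waveIntegral (𝓕 V) x = ∫ p, 𝓕 V p * (𝓕⁻ φ) p := by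
    have hφi : Integrable φ (volume : Measure R3) := φ.integrable
    have := integral_mul_integral_swap (h := fun z => wave z.1 z.2) hVhat hφi
      continuous_wave.measurable fun z => (norm_wave _ _).le
    simp only [SchwartzMap.fourierInv_coe, fourierInv_eq_wave]
    rw [← this]
    refine integral_congr_ae (Eventually.of_forall fun x => ?_)
    simp only [waveIntegral, hφa, Complex.real_smul, mul_comm]
  -- The Fourier transform is moved from `V` to the test function, where inversion holds exactly on
  -- the Schwartz space.
  have h2 : ∫ x, g x • V x = ∫ p, 𝓕 V p * (𝓕⁻ φ) p := by
    have hψi : Integrable (⇑(𝓕⁻ φ : 𝓢(R3, ℂ))) (volume : Measure R3) := (𝓕⁻ φ).integrable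
    have hcont : Continuous fun z : R3 × R3 => wave z.2 (-z.1) := by
      unfold wave planeWave
      fun_prop
    have := integral_mul_integral_swap (h := fun z : R3 × R3 => wave z.2 (-z.1)) hV
      hψi hcont.measurable fun z => (norm_wave _ _).le
    simp only [fourier_eq_wave V, mul_comm (wave _ _) (V _)]
    rw [this]
    refine integral_congr_ae (Eventually.of_forall fun x => ?_)
    have h3 : φ x = ∫ z, wave z (-x) * (𝓕⁻ φ) z := by
      have hff : 𝓕 (𝓕⁻ φ : 𝓢(R3, ℂ)) = φ := FourierTransform.fourier_fourierInv_eq φ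
      conv_lhs => rw [← hff, SchwartzMap.fourier_coe, fourier_eq_wave]
      refine integral_congr_ae (Eventually.of_forall fun z => ?_)
      simp only [wave, planeWave, real_inner_smul_left, inner_neg_right, real_inner_comm x z]
    simp only [← h3, hφa, Complex.real_smul, mul_comm]
  rw [h1, h2]

end Inversion

/-! ### Plane wave representation of the direct and exchange terms. -/

section MeanField

/-- The multiplication operator with `e^{2 π i p · x}`. -/
def wOp (p : R3) : Op := waveOp ((2 * Real.pi) • p)

theorem norm_wOp_le (p : R3) : ‖wOp p‖ ≤ 1 := norm_waveOp_le _

theorem star_wOp (p : R3) : star (wOp p) = wOp (-p) := by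
  rw [wOp, star_waveOp, wOp, smul_neg]

theorem wOp_apply (p : R3) (f : L2R3) : wOp p f =ᵐ[volume] fun x => wave p x * f x :=
  mulOp_apply _ (memLp_planeWave _) f

theorem conj_wave (p x : R3) : starRingEnd ℂ (wave p x) = wave (-p) x := by
  rw [wave, conj_planeWave, wave, smul_neg]

theorem wave_neg_left (p x : R3) : wave (-p) x = wave p (-x) := by
  simp only [wave, planeWave, smul_neg, inner_neg_left, inner_neg_right]

theorem wave_add (p x y : R3) : wave p (x + y) = wave p x * wave p y := planeWave_add _ x y

theorem integrable_inner_mul (f g : L2R3) : Integrable fun x => starRingEnd ℂ (f x) * g x := by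
  have := L2.integrable_inner (𝕜 := ℂ) f g
  refine this.congr (Eventually.of_forall fun x => ?_)
  simp [mul_comm]

theorem inner_wOp (p : R3) (f g : L2R3) :
    inner ℂ f (wOp p g) = ∫ x, wave p x * (starRingEnd ℂ (f x) * g x) := by
  rw [inner_L2_eq]
  refine integral_congr_ae ?_
  filter_upwards [wOp_apply p g] with x hx
  rw [hx]
  ring

theorem isWeakIntegral_mulOp_waveIntegral {c : R3 → ℂ} (hc : Integrable c) :
    IsWeakIntegral volume c wOp (mulOp (waveIntegral c)) where
  integrable f g := by
    simp only [inner_wOp]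
    exact integrable_mul_integral (h := fun z => wave z.1 z.2) hc (integrable_inner_mul f g)
      continuous_wave.measurable fun z => (norm_wave _ _).le
  inner_eq f g := by
    have hm : MemLp (waveIntegral c) ∞ (volume : Measure R3) :=
      memLp_top_of_measurable (continuous_waveIntegral hc).measurable (norm_waveIntegral_le c)
    simp only [inner_wOp]
    rw [← integral_mul_integral_swap (h := fun z => wave z.1 z.2) hc (integrable_inner_mul f g)
      continuous_wave.measurable fun z => (norm_wave _ _).le, inner_L2_eq]
    refine integral_congr_ae ?_
    filter_upwards [mulOp_apply _ hm g] with x hx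
    rw [hx, waveIntegral]
    ring

/-- The Fourier transform of the density of `ω`. -/
def densityHat (N : ℕ) (ω : Op) (p : R3) : ℂ := (N : ℂ)⁻¹ * opTrace (wOp (-p) * ω)

theorem traceNorm_wOp_mul_le (p : R3) (ω : Op) : traceNorm (wOp p * ω) ≤ traceNorm ω := by
  have h1 : ‖(1 : Op)‖ ≤ 1 := ContinuousLinearMap.norm_id_le
  simpa using traceNorm_mul_mul_le (norm_wOp_le p) h1 ω

/-- The Fourier transform of the density is a trace against a contraction, so the trace norm
controls it without an `L¹` estimate of `ρ`. -/
theorem norm_densityHat_le {N : ℕ} {ω : Op} {M : ℝ} (hM : 0 ≤ M)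
    (h : traceNorm ω ≤ ENNReal.ofReal M) (p : R3) : ‖densityHat N ω p‖ ≤ (N : ℝ)⁻¹ * M := by
  rw [densityHat, norm_mul, norm_inv, Complex.norm_natCast]
  gcongr
  have := (enorm_opTrace_le _).trans ((traceNorm_wOp_mul_le (-p) ω).trans h)
  rwa [← ofReal_norm, ENNReal.ofReal_le_ofReal_iff hM] at this

theorem densityHat_sub (N : ℕ) {ω ω' : Op} (h : traceNorm ω < ∞) (h' : traceNorm ω' < ∞) (p : R3) :
    densityHat N (ω - ω') p = densityHat N ω p - densityHat N ω' p := by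
  rw [densityHat, mul_sub, opTrace_sub ((traceNorm_wOp_mul_le _ _).trans_lt h)
    ((traceNorm_wOp_mul_le _ _).trans_lt h'), mul_sub]
  rfl

theorem IsDensity.densityHat_eq {N : ℕ} (hN : 1 ≤ N) {ω : Op} {ρ : R3 → ℝ} (h : IsDensity N ω ρ)
    (p : R3) : densityHat N ω p = 𝓕 (fun x => (ρ x : ℂ)) p := by
  have hN' : (N : ℂ) ≠ 0 := by exact_mod_cast (by omega : N ≠ 0)
  have hc : Continuous (wave (-p)) := continuous_planeWave _
  rw [densityHat, wOp, waveOp, h.2 _ (continuous_planeWave _).measurable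
    ⟨1, fun x => (norm_planeWave _ x).le⟩, ← mul_assoc, inv_mul_cancel₀ hN', one_mul,
    fourier_eq_wave]
  simp only [← wave_neg_left]
  rfl

theorem IsDensity.continuous_densityHat {N : ℕ} (hN : 1 ≤ N) {ω : Op} {ρ : R3 → ℝ}
    (h : IsDensity N ω ρ) : Continuous (densityHat N ω) := by
  have : densityHat N ω = fun p => waveIntegral (fun x => (ρ x : ℂ)) (-p) := by
    ext p
    rw [h.densityHat_eq hN, fourier_eq_wave, waveIntegral]
    refine integral_congr_ae (Eventually.of_forall fun x => ?_)
    simp only [← wave_neg_left p x, wave_comm (-p) x, mul_comm]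
  rw [this]
  exact (continuous_waveIntegral h.1.ofReal).comp continuous_neg

variable {V : R3 → ℝ} {N : ℕ}

theorem integrable_mul_densityHat (hN : 1 ≤ N) (hVhat : Integrable (𝓕 fun x => (V x : ℂ)))
    {ω : Op} {ρ : R3 → ℝ} (h : IsDensity N ω ρ) :
    Integrable fun p => 𝓕 (fun x => (V x : ℂ)) p * densityHat N ω p := by
  refine (hVhat.mul_bdd (c := ∫ x, ‖(ρ x : ℂ)‖)
    (h.continuous_densityHat hN).aestronglyMeasurable (Eventually.of_forall fun p => ?_))
  rw [h.densityHat_eq hN, fourier_eq_wave]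
  refine (norm_integral_le_integral_norm _).trans_eq ?_
  simp only [norm_mul, norm_wave, one_mul]

/-- Convolution becomes multiplication of Fourier transforms. The identity holds at every `x`, as
for fixed `x` inversion is needed only for almost every `y`. -/
theorem directOp_eq (hN : 1 ≤ N) (hV : Integrable V) (hVhat : Integrable (𝓕 fun x => (V x : ℂ)))
    {ω : Op} {ρ : R3 → ℝ} (h : IsDensity N ω ρ) :
    directOp V ρ = mulOp (waveIntegral fun p => 𝓕 (fun x => (V x : ℂ)) p * densityHat N ω p) := by
  have hVc : Integrable fun x => (V x : ℂ) := hV.ofReal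
  have hinv := ae_eq_waveIntegral_fourier hVc hVhat
  rw [directOp]
  congr 1
  ext x
  have hcont : Continuous fun z : R3 × R3 => wave z.1 (x - z.2) := by
    unfold wave planeWave
    fun_prop
  have h1 := integral_mul_integral_swap (h := fun z : R3 × R3 => wave z.1 (x - z.2)) hVhat
    h.1.ofReal hcont.measurable fun z => (norm_wave _ _).le
  have h2 : ∀ᵐ y, (V (x - y) : ℂ) = waveIntegral (𝓕 fun x => (V x : ℂ)) (x - y) :=
    (quasiMeasurePreserving_sub_left (volume : Measure R3) x).ae hinv
  refine integral_ofReal.symm.trans ?_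
  calc ∫ y, ((V (x - y) * ρ y : ℝ) : ℂ)
      = ∫ y, (∫ p, 𝓕 (fun x => (V x : ℂ)) p * wave p (x - y)) * (ρ y : ℂ) := by
        refine integral_congr_ae ?_
        filter_upwards [h2] with y hy
        rw [Complex.ofReal_mul, hy]
        rfl
    _ = _ := by
        refine h1.trans (integral_congr_ae (Eventually.of_forall fun p => ?_))
        simp only [h.densityHat_eq hN, fourier_eq_wave (fun x => (ρ x : ℂ)), mul_assoc]
        congr 1
        rw [mul_comm, ← integral_const_mul]
        refine integral_congr_ae (Eventually.of_forall fun y => ?_)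
        simp only [sub_eq_add_neg, wave_add, mul_assoc]
        rfl

theorem isWeakIntegral_directOp (hN : 1 ≤ N) (hV : Integrable V)
    (hVhat : Integrable (𝓕 fun x => (V x : ℂ))) {ω : Op} {ρ : R3 → ℝ} (h : IsDensity N ω ρ) :
    IsWeakIntegral volume (fun p => 𝓕 (fun x => (V x : ℂ)) p * densityHat N ω p) wOp
      (directOp V ρ) := by
  rw [directOp_eq hN hV hVhat h]
  exact isWeakIntegral_mulOp_waveIntegral (integrable_mul_densityHat hN hVhat h)

theorem star_directOp (V ρ : R3 → ℝ) : star (directOp V ρ) = directOp V ρ := by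
  by_cases h : MemLp (fun x => ((∫ y, V (x - y) * ρ y : ℝ) : ℂ)) ∞ (volume : Measure R3)
  · rw [directOp, star_mulOp h]
    simp only [Complex.conj_ofReal]
  · rw [directOp, mulOp, dif_neg h, star_zero]

theorem memLp_prod (f g : L2R3) :
    MemLp (fun z : R3 × R3 => starRingEnd ℂ (f z.1) * g z.2) 2 (volume.prod volume) := by
  have hm : AEStronglyMeasurable (fun z : R3 × R3 => starRingEnd ℂ (f z.1) * g z.2)
      (volume.prod volume) :=
    (Lp.aestronglyMeasurable f).star.comp_fst.mul (Lp.aestronglyMeasurable g).comp_snd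
  rw [memLp_two_iff_integrable_sq_norm hm]
  have := ((Lp.memLp f).integrable_norm_pow (by norm_num : (2 : ℕ) ≠ 0)).mul_prod
    ((Lp.memLp g).integrable_norm_pow (by norm_num : (2 : ℕ) ≠ 0))
  refine this.congr (Eventually.of_forall fun z => ?_)
  simp [mul_pow]

theorem HasKernel.integrable {A : Op} {k : R3 × R3 → ℂ} (h : HasKernel A k) (f g : L2R3) :
    Integrable (fun z : R3 × R3 => k z * (starRingEnd ℂ (f z.1) * g z.2))
      (volume.prod volume) :=
  (show MemLp k 2 (volume.prod volume) from h.1).integrable_mul (memLp_prod f g)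

theorem HasKernel.inner_eq {A : Op} {k : R3 × R3 → ℂ} (h : HasKernel A k) (f g : L2R3) :
    inner ℂ f (A g) =
      ∫ z : R3 × R3, k z * (starRingEnd ℂ (f z.1) * g z.2) ∂(volume.prod volume) := by
  rw [integral_prod _ (h.integrable f g), inner_L2_eq]
  refine integral_congr_ae ?_
  filter_upwards [h.2 g] with x hx
  rw [hx, ← integral_mul_const]
  refine integral_congr_ae (Eventually.of_forall fun y => ?_)
  simp only
  ring

/-- The exchange operator is an average of conjugations with plane waves. -/
theorem isWeakIntegral_exchange (hV : Integrable V)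
    (hVhat : Integrable (𝓕 fun x => (V x : ℂ))) {ω X : Op} (h : IsExchange N V ω X) :
    IsWeakIntegral volume (fun p => (N : ℂ)⁻¹ * 𝓕 (fun x => (V x : ℂ)) p)
      (fun p => wOp p * ω * wOp (-p)) X := by
  obtain ⟨k, hk, hX⟩ := h
  have hVc : Integrable fun x => (V x : ℂ) := hV.ofReal
  have hinv := ae_eq_waveIntegral_fourier hVc hVhat
  have hcont : Continuous fun z : R3 × (R3 × R3) => wave z.1 (z.2.1 - z.2.2) := by
    unfold wave planeWave
    fun_prop
  -- Conjugation with a plane wave multiplies the kernel by `e^{2πip·(x-y)}`; integration against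
  -- the Fourier transform of `V` then restores `V(x-y)`.
  have key : ∀ f g p, inner ℂ f ((wOp p * ω * wOp (-p)) g) =
      ∫ z : R3 × R3, wave p (z.1 - z.2) * (k z * (starRingEnd ℂ (f z.1) * g z.2))
        ∂(volume.prod volume) := by
    intro f g p
    have h1 : inner ℂ f ((wOp p * ω * wOp (-p)) g) = inner ℂ (wOp (-p) f) (ω (wOp (-p) g)) := by
      rw [← star_wOp, ContinuousLinearMap.star_eq_adjoint, ContinuousLinearMap.adjoint_inner_left]
      rfl
    rw [h1, hk.inner_eq]
    refine integral_congr_ae ?_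
    have hf : ∀ᵐ z : R3 × R3 ∂(volume.prod volume), wOp (-p) f z.1 = wave (-p) z.1 * f z.1 :=
      Measure.quasiMeasurePreserving_fst.ae (wOp_apply (-p) f)
    have hg : ∀ᵐ z : R3 × R3 ∂(volume.prod volume), wOp (-p) g z.2 = wave (-p) z.2 * g z.2 :=
      Measure.quasiMeasurePreserving_snd.ae (wOp_apply (-p) g)
    filter_upwards [hf, hg] with z h2 h3
    rw [h2, h3, map_mul, conj_wave, neg_neg, sub_eq_add_neg, wave_add, ← wave_neg_left p z.2]
    ring
  have hc : Integrable fun p => (N : ℂ)⁻¹ * 𝓕 (fun x => (V x : ℂ)) p := hVhat.const_mul _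
  refine ⟨fun f g => ?_, fun f g => ?_⟩
  · simp only [key]
    exact integrable_mul_integral (h := fun z : R3 × (R3 × R3) => wave z.1 (z.2.1 - z.2.2)) hc
      (hk.integrable f g) hcont.measurable fun z => (norm_wave _ _).le
  · simp only [key]
    rw [← integral_mul_integral_swap (h := fun z : R3 × (R3 × R3) => wave z.1 (z.2.1 - z.2.2)) hc
      (hk.integrable f g) hcont.measurable fun z => (norm_wave _ _).le, hX.inner_eq]
    refine integral_congr_ae ?_
    filter_upwards [(quasiMeasurePreserving_sub (volume : Measure R3) volume).ae hinv] with z hz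
    rw [hz, waveIntegral]
    simp only [mul_assoc, integral_const_mul]

/-- Real Fourier coefficients are what makes the exchange operator of a self-adjoint `ω`
self-adjoint. -/
theorem conj_fourier_of_even (hVeven : ∀ᵐ x : R3, V (-x) = V x) (p : R3) :
    starRingEnd ℂ (𝓕 (fun x => (V x : ℂ)) p) = 𝓕 (fun x => (V x : ℂ)) p := by
  rw [fourier_eq_wave, ← integral_conj, ← integral_neg_eq_self]
  refine integral_congr_ae ?_
  filter_upwards [hVeven] with x hx
  rw [map_mul, Complex.conj_ofReal, hx, conj_wave, wave_neg_left, neg_neg]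

theorem star_exchange (hV : Integrable V) (hVeven : ∀ᵐ x : R3, V (-x) = V x)
    (hVhat : Integrable (𝓕 fun x => (V x : ℂ))) {ω X : Op} (h : IsExchange N V ω X)
    (hω : star ω = ω) : star X = X := by
  have hw := isWeakIntegral_exchange hV hVhat h
  rw [ContinuousLinearMap.star_eq_adjoint]
  symm
  rw [ContinuousLinearMap.eq_adjoint_iff]
  intro f g
  rw [← inner_conj_symm, hw.inner_eq, hw.inner_eq, ← integral_conj]
  refine integral_congr_ae (Eventually.of_forall fun p => ?_)
  simp only [map_mul, map_inv₀, Complex.conj_natCast, conj_fourier_of_even hVeven, inner_conj_symm]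
  congr 1
  have : star (wOp p * ω * wOp (-p)) = wOp p * ω * wOp (-p) := by
    rw [star_mul, star_mul, hω, star_wOp, star_wOp, neg_neg, mul_assoc]
  conv_rhs => rw [← this, ContinuousLinearMap.star_eq_adjoint,
    ContinuousLinearMap.adjoint_inner_right]

end MeanField

/-! ### The von Neumann equation in the interaction picture. -/

section Interaction

theorem real_smul_eq_complex_smul (r : ℝ) (x : L2R3) : r • x = (r : ℂ) • x := by
  apply Lp.ext
  filter_upwards [Lp.coeFn_smul r x, Lp.coeFn_smul (r : ℂ) x] with y h1 h2
  rw [h1, h2, Pi.smul_apply, Pi.smul_apply, Complex.coe_smul]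

/-- A product rule in which `ω` need only be norm continuous and differentiable in the single matrix
element between `u t` and `v t`, which is what the weak equation provides. -/
theorem hasDerivAt_inner_clm {u v : ℝ → L2R3} {u' v' : L2R3} {ω : ℝ → Op} {d : ℂ} {t : ℝ}
    (hu : HasDerivAt u u' t) (hv : HasDerivAt v v' t) (hω : ContinuousAt ω t)
    (hd : HasDerivAt (fun s => inner ℂ (u t) (ω s (v t))) d t) :
    HasDerivAt (fun s => inner ℂ (u s) (ω s (v s)))
      (inner ℂ u' (ω t (v t)) + inner ℂ (u t) (ω t v') + d) t := by
  have h1 : HasDerivAt (fun s => inner ℂ (u s - u t) (ω s (v s))) (inner ℂ u' (ω t (v t))) t := by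
    rw [hasDerivAt_iff_tendsto_slope]
    have h2 : Tendsto (fun s => inner ℂ (slope u t s) (ω s (v s))) (𝓝[≠] t)
        (𝓝 (inner ℂ u' (ω t (v t)))) :=
      (hasDerivAt_iff_tendsto_slope.1 hu).inner
        ((hω.clm_apply hv.continuousAt).tendsto.mono_left nhdsWithin_le_nhds)
    refine h2.congr fun s => ?_
    simp only [slope, vsub_eq_sub, sub_self, inner_zero_left, sub_zero]
    rw [real_smul_eq_complex_smul, inner_smul_left, Complex.conj_ofReal, Complex.real_smul]
  have h3 : HasDerivAt (fun s => inner ℂ (u t) (ω s (v s - v t))) (inner ℂ (u t) (ω t v')) t := by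
    rw [hasDerivAt_iff_tendsto_slope]
    have h2 : Tendsto (fun s => inner ℂ (u t) (ω s (slope v t s))) (𝓝[≠] t)
        (𝓝 (inner ℂ (u t) (ω t v'))) := by
      refine tendsto_const_nhds.inner ?_
      have h4 : Tendsto ω (𝓝[≠] t) (𝓝 (ω t)) := hω.tendsto.mono_left nhdsWithin_le_nhds
      exact isBoundedBilinearMap_apply.continuous.continuousAt.tendsto.comp
        (h4.prodMk_nhds (hasDerivAt_iff_tendsto_slope.1 hv))
    refine h2.congr fun s => ?_
    simp only [slope, vsub_eq_sub, sub_self, map_zero, inner_zero_right, sub_zero]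
    rw [real_smul_eq_complex_smul, map_smul, inner_smul_right, Complex.real_smul]
  refine ((h1.add h3).add hd).congr_of_eventuallyEq (Eventually.of_forall fun s => ?_)
  simp only [Pi.add_apply, inner_sub_left, map_sub, inner_sub_right]
  ring

theorem tendsto_enorm_sub_of_tendsto_traceNorm {ω : ℝ → Op} {t : ℝ}
    (h : Tendsto (fun s => traceNorm (ω s - ω t)) (𝓝 t) (𝓝 0)) : ContinuousAt ω t := by
  rw [ContinuousAt, tendsto_iff_edist_tendsto_0]
  refine tendsto_of_tendsto_of_tendsto_of_le_of_le tendsto_const_nhds h (fun _ => bot_le) fun s => ?_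
  rw [edist_eq_enorm_sub]
  exact enorm_le_traceNorm _

/-- The interaction picture of a path of operators. -/
def interaction (ħ : ℝ) (ω : ℝ → Op) (t : ℝ) : Op :=
  star (freeOp (ħ * t)) * ω t * freeOp (ħ * t)

variable {ħ : ℝ}

theorem norm_star_freeOp_le (s : ℝ) : ‖star (freeOp s)‖ ≤ 1 :=
  (norm_star _).trans_le (norm_freeOp_le s)

theorem interaction_zero (ω : ℝ → Op) : interaction ħ ω 0 = ω 0 := by
  rw [interaction, mul_zero, freeOp_zero, star_one, one_mul, mul_one]

theorem interaction_sub (ω ω' : ℝ → Op) (t : ℝ) :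
    interaction ħ (fun s => ω s - ω' s) t = interaction ħ ω t - interaction ħ ω' t := by
  simp only [interaction, mul_sub, sub_mul]

theorem interaction_mul (ω ω' : ℝ → Op) (t : ℝ) :
    interaction ħ (fun s => ω s * ω' s) t = interaction ħ ω t * interaction ħ ω' t := by
  simp only [interaction]
  calc _ = star (freeOp (ħ * t)) * ω t * 1 * ω' t * freeOp (ħ * t) := by
        simp only [mul_one, mul_assoc]
    _ = _ := by rw [← freeOp_mul_star (ħ * t)]; simp only [mul_assoc]

theorem star_interaction {ω : ℝ → Op} {t : ℝ} (h : star (ω t) = ω t) :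
    star (interaction ħ ω t) = interaction ħ ω t := by
  rw [interaction, star_mul, star_mul, star_star, h, mul_assoc]

theorem traceNorm_conj_freeOp (s : ℝ) (A : Op) :
    traceNorm (star (freeOp s) * A * freeOp s) = traceNorm A := by
  refine le_antisymm (traceNorm_mul_mul_le (norm_star_freeOp_le s) (norm_freeOp_le s) A) ?_
  have h : A = freeOp s * (star (freeOp s) * A * freeOp s) * star (freeOp s) := by
    calc A = (freeOp s * star (freeOp s)) * A * (freeOp s * star (freeOp s)) := by
          rw [freeOp_mul_star, one_mul, mul_one]
      _ = _ := by simp only [mul_assoc]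
  conv_lhs => rw [h]
  exact traceNorm_mul_mul_le (norm_freeOp_le s) (norm_star_freeOp_le s) _

theorem traceNorm_interaction (ω : ℝ → Op) (t : ℝ) :
    traceNorm (interaction ħ ω t) = traceNorm (ω t) := traceNorm_conj_freeOp _ _

theorem norm_interaction (ω : ℝ → Op) (t : ℝ) : ‖interaction ħ ω t‖ = ‖ω t‖ := by
  have key : ∀ V W A : Op, ‖V‖ ≤ 1 → ‖W‖ ≤ 1 → ‖V * A * W‖ ≤ ‖A‖ := fun V W A hV hW => by
    calc ‖V * A * W‖ ≤ ‖V‖ * ‖A‖ * ‖W‖ := (norm_mul_le _ _).trans (by gcongr; exact norm_mul_le _ _)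
      _ ≤ 1 * ‖A‖ * 1 := by gcongr
      _ = ‖A‖ := by ring
  refine le_antisymm (key _ _ _ (norm_star_freeOp_le _) (norm_freeOp_le _)) ?_
  have h : ω t = freeOp (ħ * t) * interaction ħ ω t * star (freeOp (ħ * t)) := by
    calc ω t = (freeOp (ħ * t) * star (freeOp (ħ * t))) * ω t *
          (freeOp (ħ * t) * star (freeOp (ħ * t))) := by
          rw [freeOp_mul_star, one_mul, mul_one]
      _ = _ := by simp only [interaction, mul_assoc]
  conv_lhs => rw [h]
  exact key _ _ _ (norm_freeOp_le _) (norm_star_freeOp_le _)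

/-- The free group is only strongly continuous; the trace class factor upgrades this to trace norm
continuity. -/
theorem tendsto_traceNorm_mul_freeOp {K : Op} (hK : traceNorm K < ∞) (t : ℝ) :
    Tendsto (fun s => traceNorm (K * freeOp (ħ * s) - K * freeOp (ħ * t))) (𝓝 t) (𝓝 0) := by
  have hK' : traceNorm (K * freeOp (ħ * t)) < ∞ :=
    (traceNorm_mul_le_right _ _).trans_lt (ENNReal.mul_lt_top hK (by finiteness))
  have := tendsto_traceNorm_mul_sub (l := 𝓝 t) hK' (U := fun s => freeOp (ħ * s - ħ * t))
    (fun s => norm_freeOp_le _) fun x => ?_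
  · refine this.congr fun s => ?_
    rw [mul_assoc, freeOp, freeOp, phaseOp_mul hasTemperateGrowth_freeSymbol, freeOp]
    congr 4
    ring
  · simp_rw [star_freeOp]
    have hc : Continuous fun s => freeOp (-(ħ * s - ħ * t)) x :=
      (continuous_phaseOp_apply hasTemperateGrowth_freeSymbol x).comp (by fun_prop)
    have := hc.tendsto t
    simpa [freeOp_zero] using this

theorem tendsto_traceNorm_interaction {K : ℝ → Op} {t : ℝ} (hK : traceNorm (K t) < ∞)
    (h : Tendsto (fun s => traceNorm (K s - K t)) (𝓝 t) (𝓝 0)) :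
    Tendsto (fun s => traceNorm (interaction ħ K s - interaction ħ K t)) (𝓝 t) (𝓝 0) := by
  have hKs : traceNorm (star (K t)) < ∞ := by rwa [traceNorm_star]
  have h1 := (h.add (tendsto_traceNorm_mul_freeOp (ħ := ħ) hK t)).add
    (tendsto_traceNorm_mul_freeOp (ħ := ħ) hKs t)
  rw [add_zero, add_zero] at h1
  refine tendsto_of_tendsto_of_tendsto_of_le_of_le tendsto_const_nhds h1 (fun _ => bot_le)
    fun s => ?_
  set U := freeOp (ħ * s)
  set U' := freeOp (ħ * t)
  have hU : ‖U‖ ≤ 1 := norm_freeOp_le _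
  have hU' : ‖U'‖ ≤ 1 := norm_freeOp_le _
  have hsU : ‖star U‖ ≤ 1 := norm_star_freeOp_le _
  have h1n : ‖(1 : Op)‖ ≤ 1 := ContinuousLinearMap.norm_id_le
  -- The last term is written as an adjoint, so that continuity of right multiplication suffices for
  -- both sides.
  have hdec : interaction ħ K s - interaction ħ K t = star U * (K s - K t) * U +
      star U * (K t * U - K t * U') * 1 + 1 * star (star (K t) * U - star (K t) * U') * U' := by
    simp only [interaction, star_sub, star_mul, star_star, mul_sub, sub_mul, mul_one, one_mul,
      mul_assoc, U, U']
    abel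
  rw [hdec]
  refine (traceNorm_add_le _ _).trans (add_le_add ((traceNorm_add_le _ _).trans (add_le_add ?_ ?_))
    ?_)
  · exact traceNorm_mul_mul_le hsU hU _
  · exact traceNorm_mul_mul_le hsU h1n _
  · refine (traceNorm_mul_mul_le h1n hU' _).trans_eq (traceNorm_star _)

theorem traceNorm_commutator_lt_top {A : Op} (B : Op) (hA : traceNorm A < ∞) :
    traceNorm (B * A - A * B) < ∞ :=
  (traceNorm_sub_le _ _).trans_lt (ENNReal.add_lt_top.2
    ⟨(traceNorm_mul_le_left _ _).trans_lt (ENNReal.mul_lt_top (by finiteness) hA),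
      (traceNorm_mul_le_right _ _).trans_lt (ENNReal.mul_lt_top hA (by finiteness))⟩)

theorem tendsto_traceNorm_commutator {B ω : ℝ → Op} {t : ℝ} (hB : ContinuousAt B t)
    (hfin : traceNorm (ω t) < ∞) (hω : Tendsto (fun s => traceNorm (ω s - ω t)) (𝓝 t) (𝓝 0)) :
    Tendsto (fun s => traceNorm ((B s * ω s - ω s * B s) - (B t * ω t - ω t * B t)))
      (𝓝 t) (𝓝 0) := by
  have hBn : Tendsto (fun s => ‖B s‖ₑ) (𝓝 t) (𝓝 ‖B t‖ₑ) := hB.enorm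
  have hBd : Tendsto (fun s => ‖B s - B t‖ₑ) (𝓝 t) (𝓝 0) := by
    have := tendsto_iff_edist_tendsto_0.1 hB.tendsto
    simpa only [edist_eq_enorm_sub] using this
  have h1 : Tendsto (fun s => ‖B s‖ₑ * traceNorm (ω s - ω t) + ‖B s - B t‖ₑ * traceNorm (ω t) +
      (traceNorm (ω s - ω t) * ‖B s‖ₑ + traceNorm (ω t) * ‖B s - B t‖ₑ)) (𝓝 t) (𝓝 0) := by
    have e1 := ENNReal.Tendsto.mul hBn (Or.inr ENNReal.zero_ne_top) hω
      (Or.inr (by finiteness))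
    have e2 := ENNReal.Tendsto.mul_const hBd (Or.inr hfin.ne)
    have e3 := ENNReal.Tendsto.mul hω (Or.inr (by finiteness)) hBn (Or.inr ENNReal.zero_ne_top)
    have e4 := ENNReal.Tendsto.const_mul hBd (Or.inr hfin.ne)
    simpa using (e1.add e2).add (e3.add e4)
  refine tendsto_of_tendsto_of_tendsto_of_le_of_le tendsto_const_nhds h1 (fun _ => bot_le)
    fun s => ?_
  have hdec : (B s * ω s - ω s * B s) - (B t * ω t - ω t * B t) =
      (B s * (ω s - ω t) + (B s - B t) * ω t) - ((ω s - ω t) * B s + ω t * (B s - B t)) := by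
    noncomm_ring
  rw [hdec]
  refine (traceNorm_sub_le _ _).trans (add_le_add ?_ ?_)
  · exact (traceNorm_add_le _ _).trans (add_le_add (traceNorm_mul_le_left _ _)
      (traceNorm_mul_le_left _ _))
  · exact (traceNorm_add_le _ _).trans (add_le_add (traceNorm_mul_le_right _ _)
      (traceNorm_mul_le_right _ _))

/-- The generator in the interaction picture. -/
def generator (ħ : ℝ) (B : ℝ → Op) (t : ℝ) : Op := ((-ħ⁻¹ : ℝ) : ℂ) • interaction ħ B t

theorem star_generator {B : ℝ → Op} {t : ℝ} (h : star (B t) = B t) :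
    star (generator ħ B t) = generator ħ B t := by
  rw [generator, star_smul, star_interaction h, ← starRingEnd_apply, Complex.conj_ofReal]

/-- The von Neumann equation in the interaction picture holds in trace norm. -/
theorem hasTraceDerivAt_interaction (hħ : 0 < ħ) {B ω : ℝ → Op} (hω : IsDensityPath ω)
    (hB : ∀ t, ContinuousAt B t) (hsol : SolvesVonNeumann ħ B ω) (t : ℝ) :
    HasTraceDerivAt (interaction ħ ω) (Complex.I • (generator ħ B t * interaction ħ ω t -
      interaction ħ ω t * generator ħ B t)) t := by
  have hħ' : (ħ : ℂ) ≠ 0 := by exact_mod_cast hħ.ne'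
  set K : ℝ → Op := fun s => (Complex.I * ħ)⁻¹ • (B s * ω s - ω s * B s) with hK
  have hgen : ∀ s, Complex.I • (generator ħ B s * interaction ħ ω s -
      interaction ħ ω s * generator ħ B s) = interaction ħ K s := by
    intro s
    have h1 : interaction ħ K s = (Complex.I * ħ)⁻¹ •
        interaction ħ (fun s => B s * ω s - ω s * B s) s := by
      simp only [interaction, hK, mul_smul_comm, smul_mul_assoc]
    rw [h1, interaction_sub, interaction_mul, interaction_mul, generator, smul_mul_assoc,
      mul_smul_comm, ← smul_sub, smul_smul]
    congr 1
    rw [mul_inv, Complex.inv_I]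
    push_cast
    ring
  rw [hgen]
  refine hasTraceDerivAt_of_weak dense_range_schwartzL2 (G := interaction ħ K) ?_ ?_
  · refine tendsto_traceNorm_interaction ?_ ?_
    · exact (traceNorm_smul_le _ _).trans_lt (ENNReal.mul_lt_top (by finiteness)
        (traceNorm_commutator_lt_top _ (hω.traceClass t)))
    · have h1 := ENNReal.Tendsto.const_mul (a := ‖(Complex.I * ħ)⁻¹‖ₑ)
        (tendsto_traceNorm_commutator (hB t) (hω.traceClass t) (hω.continuous t))
        (Or.inr (by finiteness))
      rw [mul_zero] at h1
      refine tendsto_of_tendsto_of_tendsto_of_le_of_le tendsto_const_nhds h1 (fun _ => bot_le)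
        fun s => ?_
      simp only [hK, ← smul_sub]
      exact traceNorm_smul_le _ _
  · rintro _ ⟨φ, rfl⟩ _ ⟨γ, rfl⟩ s
    have hU : ∀ χ : 𝓢(R3, ℂ), HasDerivAt (fun s => freeOp (ħ * s) (schwartzL2 χ))
        (ħ • (Complex.I • schwartzL2 (Δ (freeSchwartz (ħ * s) χ)))) s := by
      intro χ
      have h1 : HasDerivAt (fun s : ℝ => ħ * s) ħ s := by
        simpa using (hasDerivAt_id s).const_mul ħ
      exact (hasDerivAt_freeOp χ (ħ * s)).scomp s h1
    have hin : ∀ (A : ℝ → Op) (r : ℝ), inner ℂ (schwartzL2 φ) (interaction ħ A r (schwartzL2 γ)) =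
        inner ℂ (freeOp (ħ * r) (schwartzL2 φ)) (A r (freeOp (ħ * r) (schwartzL2 γ))) := by
      intro A r
      rw [interaction, mul_apply_eq_comp, mul_apply_eq_comp, ContinuousLinearMap.star_eq_adjoint,
        ContinuousLinearMap.adjoint_inner_right]
    simp only [hin]
    -- The free group preserves Schwartz functions, so the weak equation may be tested at time `s`
    -- with the evolved functions. The Laplacian terms then cancel against the derivatives of the
    -- free group.
    have hd := (hsol (freeSchwartz (ħ * s) φ) (freeSchwartz (ħ * s) γ) s).const_mul
      (Complex.I * ħ)⁻¹
    have hIħ : Complex.I * (ħ : ℂ) ≠ 0 := mul_ne_zero Complex.I_ne_zero hħ'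
    simp only [inv_mul_cancel_left₀ hIħ, ← freeOp_schwartz] at hd
    refine (hasDerivAt_inner_clm (hU φ) (hU γ)
      (tendsto_enorm_sub_of_tendsto_traceNorm (hω.continuous s)) hd).congr_deriv ?_
    simp only [real_smul_eq_complex_smul ħ]
    simp only [hK, _root_.smul_apply, map_smul, inner_smul_left, inner_smul_right,
      Complex.conj_I, Complex.conj_ofReal, map_neg, map_pow]
    field_simp
    ring_nf
    simp only [Complex.I_sq]
    ring

end Interaction

/-! ### Integrability and norm continuity of the mean field potentials. -/

section Potential

theorem continuous_fourier_R3 {f : R3 → ℂ} (hf : Integrable f) : Continuous (𝓕 f) := by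
  have : 𝓕 f = fun p => waveIntegral f (-p) := by
    ext p
    rw [fourier_eq_wave, waveIntegral]
    refine integral_congr_ae (Eventually.of_forall fun x => ?_)
    simp only [← wave_neg_left p x, wave_comm (-p) x, mul_comm]
  rw [this]
  exact (continuous_waveIntegral hf).comp continuous_neg

variable {V : R3 → ℝ} {N : ℕ}

theorem integrable_fourier_mul (hV : Integrable V)
    (hVhat : Integrable fun p : R3 => (1 + ‖p‖) ^ 2 * ‖𝓕 (fun x : R3 => (V x : ℂ)) p‖)
    {w : R3 → ℝ} (hw : Continuous w) {K : ℝ} (hK : ∀ p, |w p| ≤ K * (1 + ‖p‖) ^ 2) :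
    Integrable fun p : R3 => ‖𝓕 (fun x : R3 => (V x : ℂ)) p‖ * w p := by
  refine (hVhat.const_mul K).mono'
    ((continuous_fourier_R3 hV.ofReal).norm.mul hw).aestronglyMeasurable
    (Eventually.of_forall fun p => ?_)
  rw [norm_mul, norm_norm, Real.norm_eq_abs, mul_comm]
  calc _ ≤ K * (1 + ‖p‖) ^ 2 * ‖𝓕 (fun x : R3 => (V x : ℂ)) p‖ := by gcongr; exact hK p
    _ = _ := by ring

theorem integrable_fourier (hV : Integrable V)
    (hVhat : Integrable fun p : R3 => (1 + ‖p‖) ^ 2 * ‖𝓕 (fun x : R3 => (V x : ℂ)) p‖) :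
    Integrable (𝓕 fun x : R3 => (V x : ℂ)) := by
  have := integrable_fourier_mul hV hVhat (w := fun _ => 1) continuous_const (K := 1) fun p => by
    rw [abs_one, one_mul]
    nlinarith [norm_nonneg p]
  simp only [mul_one] at this
  exact (integrable_norm_iff (continuous_fourier_R3 hV.ofReal).aestronglyMeasurable).1 this

/-- The difference of the direct terms of two density matrices. -/
theorem isWeakIntegral_directOp_sub (hN : 1 ≤ N) (hV : Integrable V)
    (hVhat : Integrable (𝓕 fun x => (V x : ℂ))) {ω ω' : Op} {ρ ρ' : R3 → ℝ}
    (hω : traceNorm ω < ∞) (hω' : traceNorm ω' < ∞) (h : IsDensity N ω ρ)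
    (h' : IsDensity N ω' ρ') :
    IsWeakIntegral volume (fun p => 𝓕 (fun x => (V x : ℂ)) p * densityHat N (ω - ω') p) wOp
      (directOp V ρ - directOp V ρ') := by
  have := (isWeakIntegral_directOp hN hV hVhat h).sub_coeff
    (isWeakIntegral_directOp hN hV hVhat h')
  simpa only [densityHat_sub N hω hω', mul_sub] using this

theorem isWeakIntegral_exchange_sub (hV : Integrable V)
    (hVhat : Integrable (𝓕 fun x => (V x : ℂ))) {ω ω' X X' : Op} (h : IsExchange N V ω X)
    (h' : IsExchange N V ω' X') :
    IsWeakIntegral volume (fun p => (N : ℂ)⁻¹ * 𝓕 (fun x => (V x : ℂ)) p)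
      (fun p => wOp p * (ω - ω') * wOp (-p)) (X - X') := by
  have := (isWeakIntegral_exchange hV hVhat h).sub_op (isWeakIntegral_exchange hV hVhat h')
  simpa only [mul_sub, sub_mul] using this

theorem continuousAt_of_norm_sub_le {B ω : ℝ → Op} {K : ℝ} {t : ℝ}
    (hc : Tendsto (fun s => traceNorm (ω s - ω t)) (𝓝 t) (𝓝 0))
    (h : ∀ s, ‖B s - B t‖ ≤ K * (traceNorm (ω s - ω t)).toReal) : ContinuousAt B t := by
  rw [ContinuousAt, tendsto_iff_norm_sub_tendsto_zero]
  have h1 : Tendsto (fun s => K * (traceNorm (ω s - ω t)).toReal) (𝓝 t) (𝓝 0) := by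
    have := ((ENNReal.tendsto_toReal ENNReal.zero_ne_top).comp hc).const_mul K
    simpa using this
  exact squeeze_zero (fun _ => norm_nonneg _) h h1

variable (hN : 1 ≤ N) (hV : Integrable V) (hVhat : Integrable (𝓕 fun x => (V x : ℂ)))
  {ω : ℝ → Op} (hω : IsDensityPath ω)

theorem IsDensityPath.traceNorm_sub_lt_top {ω' : ℝ → Op} (hω : IsDensityPath ω)
    (hω' : IsDensityPath ω') (s t : ℝ) : traceNorm (ω s - ω' t) < ∞ :=
  (traceNorm_sub_le _ _).trans_lt (ENNReal.add_lt_top.2 ⟨hω.traceClass s, hω'.traceClass t⟩)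

include hN hV hVhat hω

theorem continuousAt_directOp {ρ : ℝ → R3 → ℝ} (h : ∀ t, IsDensity N (ω t) (ρ t)) (t : ℝ) :
    ContinuousAt (fun s => directOp V (ρ s)) t := by
  refine continuousAt_of_norm_sub_le
    (K := (∫ p, ‖𝓕 (fun x => (V x : ℂ)) p‖) * (N : ℝ)⁻¹) (hω.continuous t) fun s => ?_
  have hfin := (hω.traceNorm_sub_lt_top hω s t).ne
  have := (isWeakIntegral_directOp_sub hN hV hVhat (hω.traceClass s) (hω.traceClass t) (h s)
    (h t)).norm_le (b := fun p => ‖𝓕 (fun x => (V x : ℂ)) p‖ *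
      ((N : ℝ)⁻¹ * (traceNorm (ω s - ω t)).toReal)) (fun p => ?_) (hVhat.norm.mul_const _)
  · rwa [integral_mul_const, ← mul_assoc] at this
  · rw [norm_mul]
    calc _ ≤ ‖𝓕 (fun x => (V x : ℂ)) p‖ * ((N : ℝ)⁻¹ * (traceNorm (ω s - ω t)).toReal) * 1 := by
          gcongr
          · exact norm_densityHat_le ENNReal.toReal_nonneg (ENNReal.ofReal_toReal hfin).ge p
          · exact norm_wOp_le p
      _ = _ := mul_one _

omit hN in
theorem continuousAt_exchange {X : ℝ → Op} (h : ∀ t, IsExchange N V (ω t) (X t)) (t : ℝ) :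
    ContinuousAt X t := by
  refine continuousAt_of_norm_sub_le
    (K := (∫ p, ‖𝓕 (fun x => (V x : ℂ)) p‖) * (N : ℝ)⁻¹) (hω.continuous t) fun s => ?_
  have hfin := (hω.traceNorm_sub_lt_top hω s t).ne
  have hle : ‖ω s - ω t‖ ≤ (traceNorm (ω s - ω t)).toReal := by
    have := ENNReal.toReal_mono hfin (enorm_le_traceNorm (ω s - ω t))
    simpa using this
  have := (isWeakIntegral_exchange_sub hV hVhat (h s) (h t)).norm_le
    (b := fun p => ‖𝓕 (fun x => (V x : ℂ)) p‖ *
      ((N : ℝ)⁻¹ * (traceNorm (ω s - ω t)).toReal)) (fun p => ?_) (hVhat.norm.mul_const _)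
  · rwa [integral_mul_const, ← mul_assoc] at this
  · rw [norm_mul, norm_inv, Complex.norm_natCast]
    calc _ ≤ (N : ℝ)⁻¹ * ‖𝓕 (fun x => (V x : ℂ)) p‖ * (1 * (traceNorm (ω s - ω t)).toReal * 1) := by
          gcongr
          refine (norm_mul_le _ _).trans (mul_le_mul ((norm_mul_le _ _).trans ?_) (norm_wOp_le _)
            (norm_nonneg _) (by positivity))
          exact mul_le_mul (norm_wOp_le _) hle (norm_nonneg _) zero_le_one
      _ = _ := by ring

end Potential

/-! ### A priori bounds along the flow. -/

section Conservation

variable {ħ : ℝ} {B ω : ℝ → Op}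

/-- Unitarily invariant norms do not increase along the von Neumann equation. -/
theorem IsIdealNorm.interaction_le {ν : Op → ℝ≥0∞} (hν : IsIdealNorm ν) (hħ : 0 < ħ)
    (hω : IsDensityPath ω) (hB : ∀ t, ContinuousAt B t) (hBs : ∀ t, star (B t) = B t)
    (hsol : SolvesVonNeumann ħ B ω) (t : ℝ) : ν (interaction ħ ω t) ≤ ν (ω 0) := by
  have hfin : ∀ t, traceNorm (interaction ħ ω t) < ∞ := fun t => by
    rw [traceNorm_interaction]
    exact hω.traceClass t
  have h := hν.le_of_hasTraceDerivAt_of_le (D := interaction ħ ω) (A := generator ħ B)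
    (R := fun _ => 0) (B := fun _ => (ν (ω 0)).toReal) (B' := fun _ => 0) (t := t) hfin
    (fun _ => by simp [traceNorm_zero]) (fun t => star_generator (hBs t)) (fun t => by
      simpa using hasTraceDerivAt_interaction hħ hω hB hsol t)
    (fun s _ => hasDerivAt_const s _) (by rw [interaction_zero]) (fun s _ _ => ?_)
  · exact (ENNReal.toReal_le_toReal ((hν.le_traceNorm _).trans_lt (hfin t)).ne
      ((hν.le_traceNorm _).trans_lt (hω.traceClass 0)).ne).1 h
  · have : ν (0 : Op) = 0 := by
      have := hν.le_traceNorm (0 : Op)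
      rwa [traceNorm_zero, nonpos_iff_eq_zero] at this
    simp [this]

theorem traceNorm_le_of_solvesVonNeumann (hħ : 0 < ħ)
    (hω : IsDensityPath ω) (hB : ∀ t, ContinuousAt B t) (hBs : ∀ t, star (B t) = B t)
    (hsol : SolvesVonNeumann ħ B ω) (t : ℝ) : traceNorm (ω t) ≤ traceNorm (ω 0) := by
  rw [← traceNorm_interaction (ħ := ħ)]
  exact isIdealNorm_traceNorm.interaction_le hħ hω hB hBs hsol t

theorem norm_le_of_solvesVonNeumann (hħ : 0 < ħ)
    (hω : IsDensityPath ω) (hB : ∀ t, ContinuousAt B t) (hBs : ∀ t, star (B t) = B t)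
    (hsol : SolvesVonNeumann ħ B ω) (t : ℝ) : ‖ω t‖ ≤ ‖ω 0‖ := by
  rw [← norm_interaction (ħ := ħ)]
  have := isIdealNorm_enorm.interaction_le hħ hω hB hBs hsol t
  rwa [enorm_le_iff_norm_le] at this

variable {N : ℕ} {C : ℝ} {ω₀ : Op}

theorem IsSemiclassicalProjection.nonneg (h : IsSemiclassicalProjection N C ω₀) : 0 ≤ ω₀ :=
  h.isProjection.nonneg

theorem IsSemiclassicalProjection.traceNorm_eq (h : IsSemiclassicalProjection N C ω₀) :
    traceNorm ω₀ = N := by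
  rw [traceNorm_of_nonneg h.nonneg, h.trace_eq]

theorem IsSemiclassicalProjection.norm_le (h : IsSemiclassicalProjection N C ω₀) : ‖ω₀‖ ≤ 1 :=
  h.isProjection.norm_le

end Conservation

/-! ### A mean value inequality in trace norm. -/

section MeanValue

variable {H : Type} [NormedAddCommGroup H] [InnerProductSpace ℂ H] [CompleteSpace H]

theorem traceNorm_sub_le_of_weak {S : Set H} (hS : Dense S) {D G : ℝ → H →L[ℂ] H} {M : ℝ}
    (hM : 0 ≤ M) (hG : ∀ s, traceNorm (G s) ≤ ENNReal.ofReal M)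
    (hw : ∀ f ∈ S, ∀ g ∈ S, ∀ s, HasDerivAt (fun s => inner ℂ f (D s g)) (inner ℂ f (G s g)) s)
    (s t : ℝ) : traceNorm (D s - D t) ≤ ENNReal.ofReal (M * |s - t|) := by
  refine traceNorm_le_of_dense hS (by positivity) fun F f g hf hg => ?_
  have hmv := convex_univ.norm_image_sub_le_of_norm_hasDerivWithin_le (𝕜 := ℝ)
    (C := ‖finiteRank F f‖ * ‖finiteRank F g‖ * M)
    (f := fun r => ∑ i ∈ F, inner ℂ (f i) (D r (g i))) (x := t) (y := s)
    (fun r _ => (HasDerivAt.fun_sum fun i (_ : i ∈ F) =>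
      hw (f i) (hf i) (g i) (hg i) r).hasDerivWithinAt)
    (fun r _ => norm_sum_inner_le_of_traceNorm_le hM (hG r) F f g)
    (Set.mem_univ _) (Set.mem_univ _)
  simpa only [_root_.sub_apply, inner_sub_right, Finset.sum_sub_distrib, Real.norm_eq_abs,
    mul_assoc] using hmv

end MeanValue

/-! ### Phase space shifts of the initial datum. -/

section InitialDatum

theorem inner_conj (U A : Op) (f g : L2R3) :
    inner ℂ f ((star U * A * U) g) = inner ℂ (U f) (A (U g)) := by
  rw [mul_apply_eq_comp, mul_apply_eq_comp, ContinuousLinearMap.star_eq_adjoint,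
    ContinuousLinearMap.adjoint_inner_right]

/-- The change of `ω` under a translation is controlled by the commutator with the gradient. -/
theorem IsGradCommutator.traceNorm_sub_conj_translationOp {ħ : ℝ} (hħ : 0 < ħ) {j : Fin 3}
    {ω B : Op} (h : IsGradCommutator ħ j ω B) {M : ℝ} (hM : 0 ≤ M)
    (hB : traceNorm B ≤ ENNReal.ofReal M) (r : ℝ) :
    traceNorm (ω - star (translationOp (r • EuclideanSpace.single j (1 : ℝ))) * ω *
      translationOp (r • EuclideanSpace.single j (1 : ℝ))) ≤ ENNReal.ofReal (ħ⁻¹ * M * |r|) := by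
  set e : R3 := EuclideanSpace.single j (1 : ℝ)
  have hħ' : (ħ : ℂ) ≠ 0 := by exact_mod_cast hħ.ne'
  have key := traceNorm_sub_le_of_weak dense_range_schwartzL2
    -- The derivative of the translated operator is the translate of `-ħ⁻¹B`, with trace norm
    -- bounded uniformly in `s`.
    (D := fun s => star (translationOp (s • e)) * ω * translationOp (s • e))
    (G := fun s => star (translationOp (s • e)) * ((-(ħ : ℂ)⁻¹) • B) * translationOp (s • e))
    (M := ħ⁻¹ * M) (by positivity) (fun s => ?_) ?_ r 0
  · rw [traceNorm_sub_comm]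
    simpa [translationOp_zero] using key
  · have h1 : ‖star (translationOp (s • e))‖ ≤ 1 :=
      (norm_star _).trans_le (norm_translationOp_le _)
    refine (traceNorm_mul_mul_le h1 (norm_translationOp_le _) _).trans
      ((traceNorm_smul_le _ _).trans ?_)
    rw [← ofReal_norm, norm_neg, norm_inv, Complex.norm_real, Real.norm_of_nonneg hħ.le,
      ENNReal.ofReal_mul (by positivity)]
    gcongr
  · rintro _ ⟨φ, rfl⟩ _ ⟨γ, rfl⟩ s
    simp only [inner_conj]
    refine (hasDerivAt_inner_clm (hasDerivAt_translationOp e φ s) (hasDerivAt_translationOp e γ s)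
      continuousAt_const (hasDerivAt_const s _)).congr_deriv ?_
    have hs := h
      (SchwartzMap.fourierMultiplierCLM ℂ (phase (shiftSymbol e) s) φ)
      (SchwartzMap.fourierMultiplierCLM ℂ (phase (shiftSymbol e) s) γ)
    rw [translationOp_eq_phaseOp, phaseOp_schwartz (hasTemperateGrowth_shiftSymbol e),
      phaseOp_schwartz (hasTemperateGrowth_shiftSymbol e), _root_.smul_apply, inner_smul_right, hs]
    simp only [inner_smul_left, inner_smul_right, map_smul, Complex.conj_ofReal]
    field_simp
    ring

/-- Telescoping, with the second translation acting isometrically. It reduces a general translation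
to the three coordinate directions. -/
theorem traceNorm_sub_conj_translationOp_add (ω : Op) (a b : R3) :
    traceNorm (ω - star (translationOp (a + b)) * ω * translationOp (a + b)) ≤
      traceNorm (ω - star (translationOp a) * ω * translationOp a) +
        traceNorm (ω - star (translationOp b) * ω * translationOp b) := by
  have h1 : ‖star (translationOp b)‖ ≤ 1 := (norm_star _).trans_le (norm_translationOp_le _)
  have hdec : ω - star (translationOp (a + b)) * ω * translationOp (a + b) =
      (ω - star (translationOp b) * ω * translationOp b) + star (translationOp b) *
        (ω - star (translationOp a) * ω * translationOp a) * translationOp b := by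
    rw [← translationOp_mul, star_mul]
    simp only [mul_sub, sub_mul, mul_assoc]
    abel
  rw [hdec, add_comm (traceNorm _)]
  exact (traceNorm_add_le _ _).trans
    (add_le_add le_rfl (traceNorm_mul_mul_le h1 (norm_translationOp_le _) _))

theorem traceNorm_sub_conj_translationOp_sum (ω : Op) {ι : Type} (s : Finset ι) (a : ι → R3) :
    traceNorm (ω - star (translationOp (∑ i ∈ s, a i)) * ω * translationOp (∑ i ∈ s, a i)) ≤
      ∑ i ∈ s, traceNorm (ω - star (translationOp (a i)) * ω * translationOp (a i)) := by
  classical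
  induction s using Finset.induction_on with
  | empty => simp [translationOp_zero, traceNorm_zero]
  | insert i s hi ih =>
    rw [Finset.sum_insert hi, Finset.sum_insert hi]
    exact (traceNorm_sub_conj_translationOp_add ω _ _).trans (add_le_add le_rfl ih)

/-- Semiclassical structure of the initial datum in phase space form. -/
theorem IsSemiclassicalProjection.traceNorm_sub_conj_shiftOp_le {N : ℕ} {C : ℝ} (hC : 0 ≤ C)
    (hħ : 0 < planck N) {ω : Op}
    (h : IsSemiclassicalProjection N C ω) (q p : R3) :
    traceNorm (ω - star (shiftOp q (planck N • p)) * ω * shiftOp q (planck N • p)) ≤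
      ENNReal.ofReal (3 * C * N * planck N * (1 + ‖q‖ + ‖p‖)) := by
  set ħ := planck N
  set a := ħ • p
  have hτ : ‖star (translationOp a)‖ ≤ 1 := (norm_star _).trans_le (norm_translationOp_le _)
  have hdec : ω - star (shiftOp q a) * ω * shiftOp q a =
      (ω - star (translationOp a) * ω * translationOp a) + star (translationOp a) *
        (star (waveOp q) * (waveOp q * ω - ω * waveOp q)) * translationOp a := by
    have : star (waveOp q) * waveOp q = 1 := by
      rw [star_waveOp, waveOp_mul, neg_add_cancel, waveOp_zero]
    rw [mul_sub, ← mul_assoc, this, one_mul, shiftOp, star_mul]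
    simp only [mul_sub, sub_mul, mul_assoc]
    abel
  have h1 : traceNorm (ω - star (translationOp a) * ω * translationOp a) ≤
      ENNReal.ofReal (3 * C * N * ħ * ‖p‖) := by
    have ha : a = ∑ j, (ħ * p j) • EuclideanSpace.single j (1 : ℝ) := by
      ext i
      simp [a, Pi.single_apply]
    rw [ha]
    refine (traceNorm_sub_conj_translationOp_sum ω _ _).trans ?_
    have : ∀ j : Fin 3, traceNorm (ω - star (translationOp ((ħ * p j) •
        EuclideanSpace.single j (1 : ℝ))) * ω * translationOp ((ħ * p j) •
        EuclideanSpace.single j (1 : ℝ))) ≤ ENNReal.ofReal (C * N * ħ * ‖p‖) := by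
      intro j
      obtain ⟨B, hB, hBn⟩ := h.gradient j
      refine (hB.traceNorm_sub_conj_translationOp hħ (by positivity) hBn _).trans
        (ENNReal.ofReal_le_ofReal ?_)
      rw [abs_mul, abs_of_pos hħ]
      -- The shift has length `ħ|p j|`, which cancels the `ħ⁻¹` from the gradient bound. Each
      -- coordinate costs at most `‖p‖`, hence the factor 3 after summation.
      have hj : |p j| ≤ ‖p‖ := PiLp.norm_apply_le p j
      calc ħ⁻¹ * (C * N * ħ) * (ħ * |p j|) = (ħ⁻¹ * ħ) * (C * N * ħ * |p j|) := by ring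
        _ = C * N * ħ * |p j| := by rw [inv_mul_cancel₀ hħ.ne', one_mul]
        _ ≤ _ := by gcongr
    refine (Finset.sum_le_sum fun j _ => this j).trans_eq ?_
    rw [Finset.sum_const, Finset.card_univ, Fintype.card_fin, nsmul_eq_mul, Nat.cast_ofNat,
      ← ENNReal.ofReal_ofNat 3, ← ENNReal.ofReal_mul (by norm_num)]
    ring_nf
  have h2 : traceNorm (star (translationOp a) *
        (star (waveOp q) * (waveOp q * ω - ω * waveOp q)) * translationOp a) ≤
      ENNReal.ofReal (C * N * ħ * (1 + ‖q‖)) := by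
    have hw : ‖star (waveOp q)‖ ≤ 1 := (norm_star _).trans_le (norm_waveOp_le _)
    have h1n : ‖(1 : Op)‖ ≤ 1 := ContinuousLinearMap.norm_id_le
    refine (traceNorm_mul_mul_le hτ (norm_translationOp_le _) _).trans ?_
    have := traceNorm_mul_mul_le hw h1n (waveOp q * ω - ω * waveOp q)
    rw [mul_one] at this
    exact this.trans (h.position q)
  rw [hdec]
  refine (traceNorm_add_le _ _).trans ((add_le_add h1 h2).trans ?_)
  rw [← ENNReal.ofReal_add (by positivity) (by positivity)]
  refine ENNReal.ofReal_le_ofReal ?_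
  have : 0 ≤ C * N * ħ * (1 + ‖q‖) := by positivity
  nlinarith

end InitialDatum

/-! ### Propagation of the semiclassical structure along the Hartree flow. -/

section Propagation

/-- The change of `A` under conjugation with a phase space shift. -/
def shiftDefect (q a : R3) (A : Op) : Op := A - star (shiftOp q a) * A * shiftOp q a

theorem traceNorm_shiftDefect_le (q a : R3) (A : Op) :
    traceNorm (shiftDefect q a A) ≤ traceNorm A + traceNorm A :=
  (traceNorm_sub_le _ _).trans (add_le_add le_rfl (traceNorm_mul_mul_le
    ((norm_star _).trans_le (norm_shiftOp_le q a)) (norm_shiftOp_le q a) A))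

/-- Plane wave commutators are the special case without translation. Thus bounds on all shift
defects also control the commutators that enter the force term. -/
theorem traceNorm_commutator_wOp (k : R3) (A : Op) :
    traceNorm (wOp k * A - A * wOp k) = traceNorm (shiftDefect ((2 * Real.pi) • k) 0 A) := by
  rw [shiftDefect, traceNorm_sub_conj_shiftOp, shiftOp, translationOp_zero, mul_one]
  rfl

theorem norm_one_sub_planeWave_le (k a : R3) : ‖1 - planeWave k a‖ ≤ ‖k‖ * ‖a‖ := by
  rw [norm_sub_rev, planeWave]
  exact (Real.norm_exp_I_mul_ofReal_sub_one_le).trans (norm_inner_le_norm k a)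

/-- The scalar is at most `2π|k||a|`; for `a` of order `ħ` this is the gain that offsets the factor
`ħ⁻¹` in the generator. -/
theorem shiftDefect_wOp (q a k : R3) :
    shiftDefect q a (wOp k) = (1 - planeWave ((2 * Real.pi) • k) (-a)) • wOp k := by
  rw [shiftDefect, wOp, conj_shiftOp_waveOp, sub_smul, one_smul]

variable {ħ : ℝ}

theorem shiftDefect_interaction (q a : R3) (X : ℝ → Op) (t : ℝ) :
    shiftDefect q a (interaction ħ X t) =
      interaction ħ (fun s => shiftDefect q (a - (2 * (ħ * s)) • q) (X s)) t := by
  rw [shiftDefect, interaction, conj_shiftOp_conj_freeOp]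
  simp only [interaction, shiftDefect, mul_sub, sub_mul]

theorem shiftDefect_generator (q a : R3) (X : ℝ → Op) (t : ℝ) :
    shiftDefect q a (generator ħ X t) =
      generator ħ (fun s => shiftDefect q (a - (2 * (ħ * s)) • q) (X s)) t := by
  rw [generator, generator, ← shiftDefect_interaction]
  simp only [shiftDefect, smul_sub, mul_smul_comm, smul_mul_assoc]

theorem traceNorm_commutator_generator_le (hħ : 0 < ħ) (K ω : ℝ → Op) (t : ℝ) :
    traceNorm (Complex.I • (generator ħ K t * interaction ħ ω t -
      interaction ħ ω t * generator ħ K t)) ≤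
        ENNReal.ofReal ħ⁻¹ * traceNorm (K t * ω t - ω t * K t) := by
  have h : Complex.I • (generator ħ K t * interaction ħ ω t -
      interaction ħ ω t * generator ħ K t) = (Complex.I * ((-ħ⁻¹ : ℝ) : ℂ)) •
        interaction ħ (fun s => K s * ω s - ω s * K s) t := by
    rw [interaction_sub, interaction_mul, interaction_mul, generator, smul_mul_assoc,
      mul_smul_comm, ← smul_sub, smul_smul]
  rw [h]
  refine (traceNorm_smul_le _ _).trans ?_
  rw [traceNorm_interaction, ← ofReal_norm, norm_mul, Complex.norm_I, one_mul, Complex.norm_real,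
    norm_neg, Real.norm_of_nonneg (by positivity)]

/-- Comparison of a solution in the interaction picture with its conjugation by a shift. -/
theorem hasTraceDerivAt_shiftDefect {D G : ℝ → Op} {t : ℝ} (q a : R3)
    (h : HasTraceDerivAt D (Complex.I • (G t * D t - D t * G t)) t) :
    HasTraceDerivAt (fun s => shiftDefect q a (D s))
      (Complex.I • ((star (shiftOp q a) * G t * shiftOp q a) * shiftDefect q a (D t) -
        shiftDefect q a (D t) * (star (shiftOp q a) * G t * shiftOp q a)) +
        Complex.I • (shiftDefect q a (G t) * D t - D t * shiftDefect q a (G t))) t := by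
  have hW := norm_shiftOp_le q a
  have hW' : ‖star (shiftOp q a)‖ ≤ 1 := (norm_star _).trans_le hW
  have h1 := h.sub (h.mul_mul hW' hW)
  have hu := shiftOp_mul_star q a
  have hm : ∀ X Y : Op, star (shiftOp q a) * (X * Y) * shiftOp q a =
      (star (shiftOp q a) * X * shiftOp q a) * (star (shiftOp q a) * Y * shiftOp q a) := by
    intro X Y
    calc _ = star (shiftOp q a) * X * 1 * Y * shiftOp q a := by simp only [mul_one, mul_assoc]
      _ = _ := by rw [← hu]; simp only [mul_assoc]
  change HasTraceDerivAt (fun s => D s - star (shiftOp q a) * D s * shiftOp q a) _ t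
  convert h1 using 1
  rw [mul_smul_comm, smul_mul_assoc, mul_sub, sub_mul, hm, hm, ← smul_add, ← smul_sub]
  congr 1
  simp only [shiftDefect]
  noncomm_ring

variable {V : R3 → ℝ} {N : ℕ}

/-- The constant `∫ |V̂(k)| |2πk| (1 + |2πk|) dk`. -/
def forceConst (V : R3 → ℝ) : ℝ :=
  ∫ k, ‖𝓕 (fun x : R3 => (V x : ℂ)) k‖ * (2 * Real.pi * ‖k‖ * (1 + 2 * Real.pi * ‖k‖))

theorem forceConst_nonneg (V : R3 → ℝ) : 0 ≤ forceConst V :=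
  integral_nonneg fun k => by positivity

theorem integrable_forceConst (hV : Integrable V)
    (hVhat : Integrable fun p : R3 => (1 + ‖p‖) ^ 2 * ‖𝓕 (fun x : R3 => (V x : ℂ)) p‖) :
    Integrable fun k : R3 => ‖𝓕 (fun x : R3 => (V x : ℂ)) k‖ *
      (2 * Real.pi * ‖k‖ * (1 + 2 * Real.pi * ‖k‖)) := by
  refine integrable_fourier_mul hV hVhat (by fun_prop) (K := 2 * Real.pi * (1 + 2 * Real.pi))
    fun p => ?_
  rw [abs_of_nonneg (by positivity)]
  have hpi := Real.pi_pos
  have h1 : ‖p‖ ≤ 1 + ‖p‖ := by linarith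
  have h2 : 1 + 2 * Real.pi * ‖p‖ ≤ (1 + 2 * Real.pi) * (1 + ‖p‖) := by
    nlinarith [norm_nonneg p]
  calc _ ≤ 2 * Real.pi * (1 + ‖p‖) * ((1 + 2 * Real.pi) * (1 + ‖p‖)) := by gcongr
    _ = _ := by ring

/-- In the plane wave expansion one factor `2π|k||a|` comes from the shift and one factor `1 +
2π|k|` from the commutator with `A`. This is where the second moment of the Fourier transform of `V`
is used. -/
theorem traceNorm_commutator_shiftDefect_directOp_le (hN : 1 ≤ N) (hV : Integrable V)
    (hVhat : Integrable fun p : R3 => (1 + ‖p‖) ^ 2 * ‖𝓕 (fun x : R3 => (V x : ℂ)) p‖)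
    {ω : Op} {ρ : R3 → ℝ} (h : IsDensity N ω ρ) (hω : traceNorm ω ≤ ENNReal.ofReal N) {A : Op}
    {w : ℝ} (hw : 0 ≤ w) (hA : ∀ k, traceNorm (wOp k * A - A * wOp k) ≤
      ENNReal.ofReal (w * (1 + 2 * Real.pi * ‖k‖))) (q a : R3) :
    traceNorm (shiftDefect q a (directOp V ρ) * A - A * shiftDefect q a (directOp V ρ)) ≤
      ENNReal.ofReal (‖a‖ * w * forceConst V) := by
  have hd := isWeakIntegral_directOp hN hV (integrable_fourier hV hVhat) h
  have hd1 : IsWeakIntegral volume (fun p => 𝓕 (fun x => (V x : ℂ)) p * densityHat N ω p)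
      (fun k => shiftDefect q a (wOp k)) (shiftDefect q a (directOp V ρ)) :=
    hd.sub_op (hd.mul_mul _ _)
  have hpi := Real.pi_pos
  have := (hd1.commutator A).traceNorm_le
    (w := fun k => (2 * Real.pi * ‖k‖ * ‖a‖) * (w * (1 + 2 * Real.pi * ‖k‖)))
    (b := fun k => ‖a‖ * w * (‖𝓕 (fun x : R3 => (V x : ℂ)) k‖ *
      (2 * Real.pi * ‖k‖ * (1 + 2 * Real.pi * ‖k‖)))) (fun k => by positivity) (fun k => ?_)
    (fun k => ?_) ((integrable_forceConst hV hVhat).const_mul _)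
  · rwa [integral_const_mul] at this
  · rw [shiftDefect_wOp, smul_mul_assoc, mul_smul_comm, ← smul_sub]
    refine (traceNorm_smul_le _ _).trans ?_
    rw [← ofReal_norm, ENNReal.ofReal_mul (by positivity)]
    gcongr
    · refine (norm_one_sub_planeWave_le _ _).trans_eq ?_
      rw [norm_neg, norm_smul, Real.norm_of_nonneg (by positivity)]
    · exact hA k
  · have hN0 : (N : ℝ) ≠ 0 := by exact_mod_cast (by omega : N ≠ 0)
    have h1 : ‖densityHat N ω k‖ ≤ 1 := by
      refine (norm_densityHat_le (by positivity) hω k).trans_eq ?_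
      rw [inv_mul_cancel₀ hN0]
    rw [norm_mul]
    calc _ ≤ ‖𝓕 (fun x : R3 => (V x : ℂ)) k‖ * 1 *
          (2 * Real.pi * ‖k‖ * ‖a‖ * (w * (1 + 2 * Real.pi * ‖k‖))) := by gcongr
      _ = _ := by ring

theorem abs_sub_of_mul_nonneg {s t : ℝ} (h : 0 ≤ s * t) (hst : |s| ≤ |t|) :
    |t - s| = |t| - |s| := by
  rcases le_total 0 t with ht | ht
  · rcases le_total 0 s with hs | hs
    · rw [abs_of_nonneg hs, abs_of_nonneg ht] at *
      exact abs_of_nonneg (by linarith)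
    · rcases ht.eq_or_lt with rfl | ht
      · simp at hst; simp [hst]
      · have : s = 0 := le_antisymm hs (by by_contra! hneg; nlinarith)
        simp [this]
  · rcases le_total 0 s with hs | hs
    · rcases ht.eq_or_lt with rfl | ht
      · simp at hst; simp [hst]
      · have : s = 0 := le_antisymm (by by_contra! hpos; nlinarith) hs
        simp [this]
    · rw [abs_of_nonpos hs, abs_of_nonpos ht] at *
      rw [abs_of_nonpos (by linarith)]
      ring

variable (hħ : 0 < ħ) (hN : 1 ≤ N) (hV : Integrable V)
  (hVhat : Integrable fun p : R3 => (1 + ‖p‖) ^ 2 * ‖𝓕 (fun x : R3 => (V x : ℂ)) p‖)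
  {ω : ℝ → Op} (hω : IsDensityPath ω) {ρ : ℝ → R3 → ℝ} (hρ : ∀ t, IsDensity N (ω t) (ρ t))
  (hsol : SolvesVonNeumann ħ (fun t => directOp V (ρ t)) ω)
  (hmass : ∀ t, traceNorm (ω t) ≤ ENNReal.ofReal N) {A₀ : ℝ} (hA₀ : 0 ≤ A₀)
  (hinit : ∀ q p, traceNorm (shiftDefect q (ħ • p) (ω 0)) ≤
    ENNReal.ofReal (A₀ * (1 + ‖q‖ + ‖p‖)))

include hħ hN hV hVhat hω hρ hsol hmass hA₀ hinit

/-- Duhamel's formula in comparison form: the initial datum contributes `A₀`, the force contributes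
the assumed constant `A` with a factor at most `1/2`, thanks to the large exponential weight. -/
theorem propagation_step {A : ℝ} (hA : 0 ≤ A)
    (hclaim : ∀ t q p, traceNorm (shiftDefect q (ħ • p) (ω t)) ≤
      ENNReal.ofReal (A * Real.exp ((2 * forceConst V + 4) * |t|) * (1 + ‖q‖ + ‖p‖)))
    (t : ℝ) (q p : R3) : traceNorm (shiftDefect q (ħ • p) (ω t)) ≤
      ENNReal.ofReal ((A₀ + A / 2) * Real.exp ((2 * forceConst V + 4) * |t|) *
        (1 + ‖q‖ + ‖p‖)) := by
  set c := forceConst V with hc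
  have hc0 : 0 ≤ c := forceConst_nonneg V
  set w : ℝ := 1 + ‖q‖ + ‖p‖ with hw
  have hw0 : 0 ≤ w := by positivity
  -- The shift is chosen so that the free flow carries it to `ħp` exactly at time `t`; at time `s`
  -- it is `ħ(p + 2(t-s)q)`.
  set a : R3 := ħ • (p + (2 * t) • q) with ha
  have hshift : ∀ s, a - (2 * (ħ * s)) • q = ħ • (p + (2 * (t - s)) • q) := fun s => by
    rw [ha]
    module
  have hBc := continuousAt_directOp hN hV (integrable_fourier hV hVhat) hω hρ
  have hG : ∀ s, star (generator ħ (fun t => directOp V (ρ t)) s) =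
      generator ħ (fun t => directOp V (ρ t)) s := fun s =>
    star_generator (B := fun t => directOp V (ρ t)) (star_directOp V (ρ s))
  have hD : ∀ s, traceNorm (interaction ħ ω s) < ∞ := fun s => by
    rw [traceNorm_interaction]
    exact hω.traceClass s
  set R : ℝ → Op := fun s => Complex.I • (shiftDefect q a (generator ħ (fun t => directOp V (ρ t)) s)
    * interaction ħ ω s - interaction ħ ω s *
      shiftDefect q a (generator ħ (fun t => directOp V (ρ t)) s)) with hR
  have hRle : ∀ s, traceNorm (R s) ≤ ENNReal.ofReal
      (‖p + (2 * (t - s)) • q‖ * (A * Real.exp ((2 * c + 4) * |s|)) * c) := by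
    intro s
    rw [hR]
    simp only [shiftDefect_generator]
    refine (traceNorm_commutator_generator_le hħ _ _ _).trans ?_
    have := traceNorm_commutator_shiftDefect_directOp_le hN hV hVhat (hρ s) (hmass s) (A := ω s)
      (w := A * Real.exp ((2 * c + 4) * |s|)) (by positivity) (fun k => ?_) q
      (a - (2 * (ħ * s)) • q)
    · refine (mul_le_mul_right this _).trans_eq ?_
      rw [← ENNReal.ofReal_mul (by positivity), hshift, norm_smul, Real.norm_of_nonneg hħ.le]
      congr 1
      field_simp
      rw [hc]
    · rw [traceNorm_commutator_wOp]
      -- The assumed bound is used with pure momentum shifts `(2πk, 0)`, which are the commutators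
      -- with plane waves.
      have := hclaim s ((2 * Real.pi) • k) 0
      rwa [smul_zero, norm_zero, add_zero, norm_smul,
        Real.norm_of_nonneg (by positivity : (0:ℝ) ≤ 2 * Real.pi)] at this
  have hbound := isIdealNorm_traceNorm.le_of_hasTraceDerivAt_of_le
    (D := fun s => shiftDefect q a (interaction ħ ω s))
    (A := fun s => star (shiftOp q a) * generator ħ (fun t => directOp V (ρ t)) s * shiftOp q a)
    (R := R) (B := fun s => w * Real.exp (2 * |t|) *
      (A₀ + c * A * (Real.exp ((2 * c + 2) * s) / (2 * c + 2))))
    (B' := fun s => w * Real.exp (2 * |t|) * (c * A * Real.exp ((2 * c + 2) * s))) (t := t)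
    (fun s => (traceNorm_shiftDefect_le _ _ _).trans_lt (ENNReal.add_lt_top.2 ⟨hD s, hD s⟩))
    (fun s => (hRle s).trans_lt ENNReal.ofReal_lt_top)
    (fun s => by
      rw [star_mul, star_mul, star_star, hG, mul_assoc])
    (fun s => hasTraceDerivAt_shiftDefect q a (hasTraceDerivAt_interaction hħ hω hBc hsol s))
    (fun s _ => ?_) ?_ (fun s hs hst => ?_)
  · rw [shiftDefect_interaction, traceNorm_interaction, hshift, sub_self, mul_zero, zero_smul,
      add_zero] at hbound
    have hfin : traceNorm (shiftDefect q (ħ • p) (ω t)) ≠ ∞ :=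
      ((hclaim t q p).trans_lt ENNReal.ofReal_lt_top).ne
    rw [← ENNReal.ofReal_toReal hfin]
    refine ENNReal.ofReal_le_ofReal (hbound.trans ?_)
    have h1 : Real.exp (2 * |t|) * Real.exp ((2 * c + 2) * |t|) =
        Real.exp ((2 * c + 4) * |t|) := by
      rw [← Real.exp_add]
      ring_nf
    have h2 : Real.exp (2 * |t|) ≤ Real.exp ((2 * c + 4) * |t|) := by
      refine Real.exp_le_exp.2 (mul_le_mul_of_nonneg_right (by linarith) (abs_nonneg _))
    -- Integrating `c e^{(2c+2)s}` produces `c/(2c+2)`; this is why the rate contains `2c + 2`. The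
    -- remaining 2 in `2c + 4` pays for the spreading of shifts under the free flow.
    have h3 : c / (2 * c + 2) ≤ 1 / 2 := by
      rw [div_le_div_iff₀ (by positivity) (by norm_num)]
      linarith
    calc _ = w * (A₀ * Real.exp (2 * |t|) + A * (c / (2 * c + 2)) *
          (Real.exp (2 * |t|) * Real.exp ((2 * c + 2) * |t|))) := by ring
      _ ≤ w * (A₀ * Real.exp ((2 * c + 4) * |t|) + A * (1 / 2) *
          Real.exp ((2 * c + 4) * |t|)) := by
        rw [h1]
        gcongr
      _ = _ := by ring
  · have h1 : HasDerivAt (fun s : ℝ => Real.exp ((2 * c + 2) * s))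
        (Real.exp ((2 * c + 2) * s) * (2 * c + 2)) s := by
      simpa using ((hasDerivAt_id s).const_mul (2 * c + 2)).exp
    refine ((((h1.div_const (2 * c + 2)).const_mul (c * A)).const_add A₀).const_mul
      (w * Real.exp (2 * |t|))).congr_deriv ?_
    rw [mul_div_cancel_right₀ _ (by positivity)]
  · rw [interaction_zero]
    have h1 : (traceNorm (shiftDefect q a (ω 0))).toReal ≤
        A₀ * (1 + ‖q‖ + ‖p + (2 * t) • q‖) :=
      ENNReal.toReal_le_of_le_ofReal (by positivity) (hinit q _)
    refine h1.trans ?_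
    have h2 : ‖p + (2 * t) • q‖ ≤ ‖p‖ + 2 * |t| * ‖q‖ := by
      refine (norm_add_le _ _).trans_eq ?_
      rw [norm_smul, Real.norm_eq_abs, abs_mul, abs_two]
    have h3 : 1 + 2 * |t| ≤ Real.exp (2 * |t|) := by linarith [Real.add_one_le_exp (2 * |t|)]
    have h4 : 1 + ‖q‖ + ‖p + (2 * t) • q‖ ≤ w * (1 + 2 * |t|) := by
      rw [hw]
      nlinarith [norm_nonneg p, norm_nonneg q, abs_nonneg t,
        mul_nonneg (abs_nonneg t) (norm_nonneg p)]
    calc _ ≤ A₀ * (w * Real.exp (2 * |t|)) := by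
          gcongr
          exact h4.trans (by gcongr)
      _ = w * Real.exp (2 * |t|) * A₀ := by ring
      _ ≤ _ := by
        refine mul_le_mul_of_nonneg_left ?_ (by positivity)
        exact le_add_of_nonneg_right (by positivity)
  · have h1 := ENNReal.toReal_le_of_le_ofReal (by positivity) (hRle s)
    refine h1.trans ?_
    -- As `s` lies between `0` and `t`, `|t-s| = |t|-|s|`, and the linear growth of the shift is
    -- bounded by an exponential of the remaining time.
    have h2 : ‖p + (2 * (t - s)) • q‖ ≤ w * Real.exp (2 * (|t| - |s|)) := by
      have e1 : ‖p + (2 * (t - s)) • q‖ ≤ ‖p‖ + 2 * |t - s| * ‖q‖ := by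
        refine (norm_add_le _ _).trans_eq ?_
        rw [norm_smul, Real.norm_eq_abs, abs_mul, abs_two]
      have e2 : 1 + 2 * |t - s| ≤ Real.exp (2 * (|t| - |s|)) := by
        rw [abs_sub_of_mul_nonneg hs hst]
        linarith [Real.add_one_le_exp (2 * (|t| - |s|))]
      have e3 : ‖p‖ + 2 * |t - s| * ‖q‖ ≤ w * (1 + 2 * |t - s|) := by
        rw [hw]
        nlinarith [norm_nonneg p, norm_nonneg q, abs_nonneg (t - s),
          mul_nonneg (abs_nonneg (t - s)) (norm_nonneg p)]
      exact e1.trans (e3.trans (by gcongr))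
    have h3 : Real.exp (2 * (|t| - |s|)) * Real.exp ((2 * c + 4) * |s|) =
        Real.exp (2 * |t|) * Real.exp ((2 * c + 2) * |s|) := by
      rw [← Real.exp_add, ← Real.exp_add]
      ring_nf
    calc _ ≤ w * Real.exp (2 * (|t| - |s|)) * (A * Real.exp ((2 * c + 4) * |s|)) * c := by gcongr
      _ = w * A * c * (Real.exp (2 * (|t| - |s|)) * Real.exp ((2 * c + 4) * |s|)) := by ring
      _ = _ := by rw [h3]; ring

/-- Propagation of the semiclassical structure along the Hartree evolution. -/
theorem propagation (t : ℝ) (q p : R3) : traceNorm (shiftDefect q (ħ • p) (ω t)) ≤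
    ENNReal.ofReal (2 * A₀ * Real.exp ((2 * forceConst V + 4) * |t|) * (1 + ‖q‖ + ‖p‖)) := by
  -- The trivial bound `2N` starts the iteration `A ↦ A₀ + A/2`, whose fixed point is `2A₀`. The
  -- dependence on `2N` disappears in the limit.
  have key : ∀ n : ℕ, ∀ t q p, traceNorm (shiftDefect q (ħ • p) (ω t)) ≤
      ENNReal.ofReal ((2 * A₀ + (1 / 2) ^ n * (2 * N)) *
        Real.exp ((2 * forceConst V + 4) * |t|) * (1 + ‖q‖ + ‖p‖)) := by
    intro n
    induction n with
    | zero =>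
      intro t q p
      refine (traceNorm_shiftDefect_le _ _ _).trans ((add_le_add (hmass t) (hmass t)).trans ?_)
      rw [← ENNReal.ofReal_add (by positivity) (by positivity)]
      refine ENNReal.ofReal_le_ofReal ?_
      have h0 := forceConst_nonneg V
      have h1 : 1 ≤ Real.exp ((2 * forceConst V + 4) * |t|) := Real.one_le_exp (by positivity)
      have h2 : 1 ≤ 1 + ‖q‖ + ‖p‖ := by linarith [norm_nonneg p, norm_nonneg q]
      calc (N : ℝ) + N = 2 * N * 1 * 1 := by ring
        _ ≤ (2 * A₀ + (1 / 2) ^ 0 * (2 * N)) * Real.exp ((2 * forceConst V + 4) * |t|) *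
            (1 + ‖q‖ + ‖p‖) := by
          gcongr
          linarith
    | succ n ih =>
      intro t q p
      refine (propagation_step hħ hN hV hVhat hω hρ hsol hmass hA₀ hinit (by positivity) ih t q
        p).trans_eq ?_
      congr 1
      ring
  have hlim : Tendsto (fun n : ℕ => ENNReal.ofReal ((2 * A₀ + (1 / 2) ^ n * (2 * N)) *
      Real.exp ((2 * forceConst V + 4) * |t|) * (1 + ‖q‖ + ‖p‖))) atTop
      (𝓝 (ENNReal.ofReal (2 * A₀ * Real.exp ((2 * forceConst V + 4) * |t|) *
        (1 + ‖q‖ + ‖p‖)))) := by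
    refine ENNReal.tendsto_ofReal ?_
    have h1 := tendsto_pow_atTop_nhds_zero_of_lt_one (r := (1 / 2 : ℝ)) (by norm_num) (by norm_num)
    have h2 := (((h1.mul_const (2 * (N : ℝ))).const_add (2 * A₀)).mul_const
      (Real.exp ((2 * forceConst V + 4) * |t|))).mul_const (1 + ‖q‖ + ‖p‖)
    simpa only [zero_mul, add_zero] using h2
  exact ge_of_tendsto' hlim fun n => key n t q p

end Propagation

/-! ### The commutators of the two potential differences with the Hartree solution. -/

section Comparison

variable {V : R3 → ℝ} {N : ℕ}

/-- The constant `∫ |V̂(k)| (1 + |2πk|) dk`. -/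
def potentialConst (V : R3 → ℝ) : ℝ :=
  ∫ k, ‖𝓕 (fun x : R3 => (V x : ℂ)) k‖ * (1 + 2 * Real.pi * ‖k‖)

theorem potentialConst_nonneg (V : R3 → ℝ) : 0 ≤ potentialConst V :=
  integral_nonneg fun k => by positivity

theorem integrable_potentialConst (hV : Integrable V)
    (hVhat : Integrable fun p : R3 => (1 + ‖p‖) ^ 2 * ‖𝓕 (fun x : R3 => (V x : ℂ)) p‖) :
    Integrable fun k : R3 => ‖𝓕 (fun x : R3 => (V x : ℂ)) k‖ * (1 + 2 * Real.pi * ‖k‖) := by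
  refine integrable_fourier_mul hV hVhat (by fun_prop) (K := 1 + 2 * Real.pi) fun p => ?_
  rw [abs_of_nonneg (by positivity)]
  have hpi := Real.pi_pos
  have h0 := norm_nonneg p
  calc 1 + 2 * Real.pi * ‖p‖ ≤ (1 + 2 * Real.pi) * (1 + ‖p‖) := by nlinarith
    _ ≤ _ := by gcongr; nlinarith

variable (hV : Integrable V)
  (hVhat : Integrable fun p : R3 => (1 + ‖p‖) ^ 2 * ‖𝓕 (fun x : R3 => (V x : ℂ)) p‖)
  {ω ω' : Op} {w : ℝ} (hw : 0 ≤ w)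

include hV hVhat hw

/-- Each Fourier mode carries `N⁻¹ tr|ω-ω'|` from the densities and a commutator of size `w`. In the
application `w` is of order `Nħ`, which balances `N⁻¹` and the `ħ⁻¹` of the equation. -/
theorem traceNorm_commutator_directOp_sub_le (hN : 1 ≤ N) {ρ ρ' : R3 → ℝ}
    (h : IsDensity N ω ρ) (h' : IsDensity N ω' ρ') (hω : traceNorm ω < ∞)
    (hω' : traceNorm ω' < ∞) {A : Op}
    (hA : ∀ k, traceNorm (wOp k * A - A * wOp k) ≤
      ENNReal.ofReal (w * (1 + 2 * Real.pi * ‖k‖))) :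
    traceNorm ((directOp V ρ - directOp V ρ') * A - A * (directOp V ρ - directOp V ρ')) ≤
      ENNReal.ofReal ((N : ℝ)⁻¹ * (traceNorm (ω - ω')).toReal * w * potentialConst V) := by
  have hd := isWeakIntegral_directOp_sub hN hV (integrable_fourier hV hVhat) hω hω' h h'
  have hfin : traceNorm (ω - ω') ≠ ∞ :=
    ((traceNorm_sub_le _ _).trans_lt (ENNReal.add_lt_top.2 ⟨hω, hω'⟩)).ne
  have := (hd.commutator A).traceNorm_le (w := fun k => w * (1 + 2 * Real.pi * ‖k‖))
    (b := fun k => (N : ℝ)⁻¹ * (traceNorm (ω - ω')).toReal * w *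
      (‖𝓕 (fun x : R3 => (V x : ℂ)) k‖ * (1 + 2 * Real.pi * ‖k‖))) (fun k => by positivity) hA
    (fun k => ?_) ((integrable_potentialConst hV hVhat).const_mul _)
  · rwa [integral_const_mul] at this
  · rw [norm_mul]
    calc _ ≤ ‖𝓕 (fun x : R3 => (V x : ℂ)) k‖ * ((N : ℝ)⁻¹ * (traceNorm (ω - ω')).toReal) *
          (w * (1 + 2 * Real.pi * ‖k‖)) := by
          gcongr
          exact norm_densityHat_le ENNReal.toReal_nonneg (ENNReal.ofReal_toReal hfin).ge k
      _ = _ := by ring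

/-- Bounding `X` by its operator norm would lose `ħ⁻¹` in the application. Instead `e_k ω e_k*` is
compared with `ω'`, which drops out of the commutator with itself. -/
theorem traceNorm_commutator_exchange_le {X : Op} (h : IsExchange N V ω X)
    (hfin : traceNorm (ω - ω') ≠ ∞) (hω' : ‖ω'‖ ≤ 1)
    (hA : ∀ k, traceNorm (wOp k * ω' - ω' * wOp k) ≤
      ENNReal.ofReal (w * (1 + 2 * Real.pi * ‖k‖))) :
    traceNorm (X * ω' - ω' * X) ≤
      ENNReal.ofReal ((N : ℝ)⁻¹ * (2 * ((traceNorm (ω - ω')).toReal + w)) * potentialConst V) := by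
  set m := (traceNorm (ω - ω')).toReal with hm
  have hm0 : 0 ≤ m := ENNReal.toReal_nonneg
  have hX := isWeakIntegral_exchange hV (integrable_fourier hV hVhat) h
  have := (hX.commutator ω').traceNorm_le
    (w := fun k => 2 * (m + w) * (1 + 2 * Real.pi * ‖k‖))
    (b := fun k => (N : ℝ)⁻¹ * (2 * (m + w)) *
      (‖𝓕 (fun x : R3 => (V x : ℂ)) k‖ * (1 + 2 * Real.pi * ‖k‖))) (fun k => by positivity)
    (fun k => ?_) (fun k => ?_) ((integrable_potentialConst hV hVhat).const_mul _)
  · rwa [integral_const_mul] at this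
  · set M := wOp k with hM
    have hMs : wOp (-k) = star M := (star_wOp k).symm
    have hMM : M * star M = 1 := by
      rw [hM, star_wOp, wOp, wOp, waveOp_mul, smul_neg, add_neg_cancel, waveOp_zero]
    have hMn : ‖M‖ ≤ 1 := norm_wOp_le k
    have hMsn : ‖star M‖ ≤ 1 := (norm_star _).trans_le hMn
    have h1n : ‖(1 : Op)‖ ≤ 1 := ContinuousLinearMap.norm_id_le
    -- `Y` is `M ω M* - ω'`: the first summand measures the distance of the two solutions, the
    -- second one the commutator of `ω'` with the plane wave.
    set Y := M * (ω - ω') * star M + (M * ω' - ω' * M) * star M with hY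
    have hYω : M * ω * wOp (-k) = Y + ω' := by
      have : ω' * M * star M = ω' := by rw [mul_assoc, hMM, mul_one]
      rw [hMs, hY]
      simp only [mul_sub, sub_mul, this]
      abel
    have hYn : traceNorm Y ≤ ENNReal.ofReal ((m + w) * (1 + 2 * Real.pi * ‖k‖)) := by
      have h1 : traceNorm (M * (ω - ω') * star M) ≤ ENNReal.ofReal m :=
        (traceNorm_mul_mul_le hMn hMsn _).trans (ENNReal.ofReal_toReal hfin).ge
      have h2 : traceNorm ((M * ω' - ω' * M) * star M) ≤
          ENNReal.ofReal (w * (1 + 2 * Real.pi * ‖k‖)) := by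
        have := traceNorm_mul_mul_le h1n hMsn (M * ω' - ω' * M)
        rw [one_mul] at this
        exact this.trans (hA k)
      refine (traceNorm_add_le _ _).trans ((add_le_add h1 h2).trans ?_)
      rw [← ENNReal.ofReal_add hm0 (by positivity)]
      refine ENNReal.ofReal_le_ofReal ?_
      have : 0 ≤ m * (2 * Real.pi * ‖k‖) := by positivity
      nlinarith
    have hcomm : M * ω * wOp (-k) * ω' - ω' * (M * ω * wOp (-k)) = 1 * Y * ω' - ω' * Y * 1 := by
      rw [hYω]
      noncomm_ring
    rw [hcomm]
    refine (traceNorm_sub_le _ _).trans ((add_le_add (traceNorm_mul_mul_le h1n hω' Y)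
      (traceNorm_mul_mul_le hω' h1n Y)).trans ((add_le_add hYn hYn).trans_eq ?_))
    rw [← ENNReal.ofReal_add (by positivity) (by positivity)]
    congr 1
    ring
  · rw [norm_mul, norm_inv, Complex.norm_natCast]
    refine le_of_eq ?_
    ring

end Comparison

/-! ### The Grönwall argument for the two evolutions, and the transfer of bounds. -/

section Main

variable {V : R3 → ℝ} {N : ℕ} {C₀ : ℝ} {ωN : Op} {ω ω' : ℝ → Op}

theorem planck_pos (hN : 1 ≤ N) : 0 < planck N :=
  Real.rpow_pos_of_pos (by exact_mod_cast hN) _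

theorem one_le_mul_planck (hN : 1 ≤ N) : 1 ≤ N * planck N := by
  have h : (1 : ℝ) ≤ N := by exact_mod_cast hN
  have h1 : (N : ℝ) * planck N = (N : ℝ) ^ (2 / 3 : ℝ) := by
    conv_lhs => rw [planck, ← Real.rpow_one (N : ℝ)]
    rw [Real.rpow_one, ← Real.rpow_one_add' (by positivity) (by norm_num)]
    norm_num
  rw [h1]
  exact Real.one_le_rpow h (by norm_num)

/-- The semiclassical structure and the conservation laws along the Hartree evolution. -/
theorem IsHartreeSolution.bounds (hN : 1 ≤ N) (hV : Integrable V)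
    (hVhat : Integrable fun p : R3 => (1 + ‖p‖) ^ 2 * ‖𝓕 (fun x : R3 => (V x : ℂ)) p‖)
    (hC₀ : 0 ≤ C₀) (hωN : IsSemiclassicalProjection N C₀ ωN)
    (h : IsHartreeSolution N V ωN ω') (t : ℝ) :
    ‖ω' t‖ ≤ 1 ∧ ∀ k, traceNorm (wOp k * ω' t - ω' t * wOp k) ≤ ENNReal.ofReal
      (6 * C₀ * (N * planck N) * Real.exp ((2 * forceConst V + 4) * |t|) *
        (1 + 2 * Real.pi * ‖k‖)) := by
  obtain ⟨hpath, h0, ρ, hρ, hsol⟩ := h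
  have hħ := planck_pos hN
  have hB := continuousAt_directOp hN hV (integrable_fourier hV hVhat) hpath hρ
  have hmass : ∀ t, traceNorm (ω' t) ≤ ENNReal.ofReal N := fun t => by
    refine (traceNorm_le_of_solvesVonNeumann hħ hpath hB (fun _ => star_directOp _ _) hsol
      t).trans_eq ?_
    rw [h0, hωN.traceNorm_eq, ENNReal.ofReal_natCast]
  refine ⟨?_, fun k => ?_⟩
  · refine (norm_le_of_solvesVonNeumann hħ hpath hB (fun _ => star_directOp _ _) hsol t).trans ?_
    rw [h0]
    exact hωN.norm_le
  -- The initial constant is `3C₀Nħ`; propagation doubles it, hence `6C₀`.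
  · have := propagation hħ hN hV hVhat hpath hρ hsol hmass (A₀ := 3 * C₀ * N * planck N)
      (by positivity) (fun q p => ?_) t ((2 * Real.pi) • k) 0
    · rw [traceNorm_commutator_wOp]
      rw [smul_zero, norm_zero, add_zero, norm_smul,
        Real.norm_of_nonneg (by positivity : (0:ℝ) ≤ 2 * Real.pi)] at this
      refine this.trans_eq ?_
      congr 1
      ring
    · rw [h0]
      exact hωN.traceNorm_sub_conj_shiftOp_le hC₀ hħ q p

/-- The growth rate in the comparison of the two evolutions. -/
def comparisonRate (V : R3 → ℝ) (C₀ : ℝ) : ℝ := potentialConst V * (18 * C₀ + 2) + 1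

/-- The barrier `exp((g/l)e^{ls})` solves `y' = g e^{ls} y`. It is at least 1, so the inhomogeneous
term of the inequality can be absorbed in the linear one. -/
theorem traceNorm_sub_le_exp (hN : 1 ≤ N) (hV : Integrable V)
    (hVeven : ∀ᵐ x : R3, V (-x) = V x)
    (hVhat : Integrable fun p : R3 => (1 + ‖p‖) ^ 2 * ‖𝓕 (fun x : R3 => (V x : ℂ)) p‖)
    (hC₀ : 0 ≤ C₀) (hωN : IsSemiclassicalProjection N C₀ ωN)
    (h : IsHartreeFockSolution N V ωN ω) (h' : IsHartreeSolution N V ωN ω') (t : ℝ) :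
    traceNorm (ω t - ω' t) ≤ ENNReal.ofReal (Real.exp (comparisonRate V C₀ /
      (2 * forceConst V + 4) * Real.exp ((2 * forceConst V + 4) * |t|))) := by
  have hbounds := h'.bounds hN hV hVhat hC₀ hωN
  obtain ⟨hpath, h0, ρ, X, hρ, hX, hsol⟩ := h
  obtain ⟨hpath', h0', ρ', hρ', hsol'⟩ := h'
  have hħ := planck_pos hN
  have hNħ := one_le_mul_planck hN
  set ħ := planck N
  have hVi := integrable_fourier hV hVhat
  set B : ℝ → Op := fun t => directOp V (ρ t) - X t with hBdef
  set B' : ℝ → Op := fun t => directOp V (ρ' t) with hBdef'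
  have hBs : ∀ s, star (B s) = B s := fun s => by
    rw [hBdef, star_sub, star_directOp,
      star_exchange hV hVeven hVi (hX s) (hpath.selfAdjoint s).star_eq]
  have hBc : ∀ s, ContinuousAt B s := fun s =>
    (continuousAt_directOp hN hV hVi hpath hρ s).sub (continuousAt_exchange hV hVi hpath hX s)
  have hBc' : ∀ s, ContinuousAt B' s := continuousAt_directOp hN hV hVi hpath' hρ'
  set l := 2 * forceConst V + 4 with hl
  have hl0 : 0 < l := by linarith [forceConst_nonneg V]
  set F := potentialConst V
  have hF0 : 0 ≤ F := potentialConst_nonneg V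
  set g := comparisonRate V C₀ with hg
  have hfin : ∀ s, traceNorm (ω s - ω' s) < ∞ := fun s => hpath.traceNorm_sub_lt_top hpath' s s
  set K : ℝ → Op := fun s => B s - B' s with hK
  set R : ℝ → Op := fun s => Complex.I • (generator ħ K s * interaction ħ ω' s -
    interaction ħ ω' s * generator ħ K s) with hR
  -- The difference of the commutators is split so that the Hartree–Fock generator acts on `ω - ω'`
  -- and the difference of the generators acts on the Hartree solution.
  have hder : ∀ s, HasTraceDerivAt (interaction ħ fun r => ω r - ω' r)
      (Complex.I • (generator ħ B s * interaction ħ (fun r => ω r - ω' r) s -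
        interaction ħ (fun r => ω r - ω' r) s * generator ħ B s) + R s) s := by
    intro s
    have h1 := (hasTraceDerivAt_interaction hħ hpath hBc hsol s).sub
      (hasTraceDerivAt_interaction hħ hpath' hBc' hsol' s)
    have h2 : interaction ħ (fun r => ω r - ω' r) =
        fun r => interaction ħ ω r - interaction ħ ω' r := funext fun r => interaction_sub _ _ _
    have h3 : generator ħ K s = generator ħ B s - generator ħ B' s := by
      rw [generator, hK, interaction_sub, smul_sub]
      rfl
    rw [h2]
    convert h1 using 1
    rw [hR]
    simp only [h3]
    rw [← smul_add, ← smul_sub]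
    congr 1
    noncomm_ring
  have hRle : ∀ s, traceNorm (R s) ≤ ENNReal.ofReal (Real.exp (l * |s|) *
      (F * ((6 * C₀ + 2) * (traceNorm (ω s - ω' s)).toReal + 12 * C₀))) := by
    intro s
    set m := (traceNorm (ω s - ω' s)).toReal with hm
    have hm0 : 0 ≤ m := ENNReal.toReal_nonneg
    set e := Real.exp (l * |s|)
    have he : 1 ≤ e := Real.one_le_exp (by positivity)
    set w := 6 * C₀ * (N * ħ) * e with hw
    have hw0 : 0 ≤ w := by positivity
    refine (traceNorm_commutator_generator_le hħ _ _ _).trans ?_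
    have hdec : K s * ω' s - ω' s * K s =
        ((directOp V (ρ s) - directOp V (ρ' s)) * ω' s -
          ω' s * (directOp V (ρ s) - directOp V (ρ' s))) - (X s * ω' s - ω' s * X s) := by
      simp only [hK, hBdef, hBdef']
      noncomm_ring
    have h1 := traceNorm_commutator_directOp_sub_le hV hVhat hw0 hN (hρ s) (hρ' s)
      (hpath.traceClass s) (hpath'.traceClass s) (hbounds s).2
    have h2 := traceNorm_commutator_exchange_le hV hVhat hw0 (hX s) (hfin s).ne (hbounds s).1
      (hbounds s).2
    rw [hdec]
    refine (mul_le_mul_right ((traceNorm_sub_le _ _).trans (add_le_add h1 h2)) _).trans ?_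
    rw [← ENNReal.ofReal_add (by positivity) (by positivity), ← ENNReal.ofReal_mul (by positivity)]
    refine ENNReal.ofReal_le_ofReal ?_
    have hN0 : (0 : ℝ) < N := by exact_mod_cast hN
    -- The exchange term carries `(Nħ)⁻¹` in front of the trace norm, harmless since `Nħ = N^{2/3} ≥
    -- 1`.
    have hinv : ħ⁻¹ * (N : ℝ)⁻¹ ≤ 1 := by
      rw [← mul_inv, mul_comm]
      exact inv_le_one_of_one_le₀ hNħ
    have hwinv : ħ⁻¹ * (N : ℝ)⁻¹ * w = 6 * C₀ * e := by
      rw [hw]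
      field_simp
    calc _ = F * ((ħ⁻¹ * (N : ℝ)⁻¹ * w) * m + 2 * (ħ⁻¹ * (N : ℝ)⁻¹) * m +
          2 * (ħ⁻¹ * (N : ℝ)⁻¹ * w)) := by ring
      _ ≤ F * (6 * C₀ * e * m + 2 * e * m + 2 * (6 * C₀ * e)) := by
          rw [hwinv]
          gcongr
          exact hinv.trans he
      _ = _ := by ring
  have hmain := isIdealNorm_traceNorm.le_of_hasTraceDerivAt
    (D := interaction ħ fun r => ω r - ω' r) (A := generator ħ B) (R := R)
    (B := fun s => Real.exp (g / l * Real.exp (l * s)))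
    (B' := fun s => g * Real.exp (l * s) * Real.exp (g / l * Real.exp (l * s))) (t := t)
    (fun s => by rw [traceNorm_interaction]; exact hfin s)
    (fun s => (hRle s).trans_lt ENNReal.ofReal_lt_top) (fun s => star_generator (hBs s)) hder
    (fun s _ => ?_) ?_ (fun s _ _ hs => ?_)
  · rw [traceNorm_interaction] at hmain
    rw [← ENNReal.ofReal_toReal (hfin t).ne]
    exact ENNReal.ofReal_le_ofReal hmain
  · have h1 : HasDerivAt (fun s : ℝ => Real.exp (l * s)) (Real.exp (l * s) * l) s := by
      simpa using ((hasDerivAt_id s).const_mul l).exp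
    refine (h1.const_mul (g / l)).exp.congr_deriv ?_
    field_simp
  · rw [interaction_zero, h0, h0', sub_self, traceNorm_zero, ENNReal.toReal_zero]
    positivity
  · rw [traceNorm_interaction] at hs
    have h1 := ENNReal.toReal_le_of_le_ofReal (by positivity) (hRle s)
    rw [hs] at h1
    refine h1.trans_lt ?_
    set b := Real.exp (g / l * Real.exp (l * |s|))
    have hg0 : 0 ≤ g := by rw [hg, comparisonRate]; positivity
    have hb : 1 ≤ b := Real.one_le_exp (by positivity)
    have he : 0 < Real.exp (l * |s|) := Real.exp_pos _
    -- Using `b ≥ 1`, the constant `12C₀` is absorbed: `(6C₀+2) + 12C₀ = 18C₀+2`. The extra 1 in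
    -- `comparisonRate` makes the inequality strict.
    have h2 : F * ((6 * C₀ + 2) * b + 12 * C₀) < g * b := by
      have : 12 * C₀ ≤ 12 * C₀ * b := le_mul_of_one_le_right (by positivity) hb
      calc _ ≤ F * ((6 * C₀ + 2) * b + 12 * C₀ * b) := by gcongr
        _ = (F * (18 * C₀ + 2)) * b := by ring
        _ < g * b := by
          refine mul_lt_mul_of_pos_right ?_ (by positivity)
          rw [hg, comparisonRate]
          exact lt_add_one _
    calc _ < Real.exp (l * |s|) * (g * b) := mul_lt_mul_of_pos_left h2 he
      _ = _ := by ring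

/-- Adding the prefactors and both rates dominates each summand, so one triple of constants serves
all four bounds. -/
theorem doubleExp_add_le {K a b C a' b' : ℝ} (hK : 0 ≤ K) (hC : 0 ≤ C) (ha : 0 ≤ a) (hb : 0 ≤ b)
    (ha' : 0 ≤ a') (hb' : 0 ≤ b') (t : ℝ) :
    doubleExp K a b t + doubleExp C a' b' t ≤ doubleExp (K + C) (a + a') (b + b') t := by
  simp only [doubleExp, add_mul K]
  gcongr <;> linarith

theorem doubleExp_nonneg {K : ℝ} (hK : 0 ≤ K) (a b t : ℝ) : 0 ≤ doubleExp K a b t :=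
  mul_nonneg hK (Real.exp_pos _).le

theorem traceNorm_weylOp_mul_le (ħ : ℝ) (q p : R3) (A : Op) :
    traceNorm (weylOp ħ q p * A) ≤ traceNorm A := by
  have h1n : ‖(1 : Op)‖ ≤ 1 := ContinuousLinearMap.norm_id_le
  have h : ‖weylOp ħ q p‖ ≤ 1 := by
    have h1 : weylOp ħ q p = Complex.exp (Complex.I * (ħ * inner ℝ p q / 2 : ℝ)) •
      shiftOp q (ħ • p) := rfl
    rw [h1, norm_smul, Complex.norm_exp_I_mul_ofReal, one_mul]
    exact norm_shiftOp_le _ _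
  simpa using traceNorm_mul_mul_le h h1n A

section Transfer

variable {K a b C a' b' : ℝ} {γ : ℝ → Op} (hK : 0 ≤ K) (hC : 0 ≤ C) (ha : 0 ≤ a) (hb : 0 ≤ b)
  (ha' : 0 ≤ a') (hb' : 0 ≤ b')
  (hδ : ∀ t, traceNorm (ω t - ω' t) ≤ ENNReal.ofReal (doubleExp C a' b' t))

include hK hC ha hb ha' hb' hδ

theorem HSBound.transfer (h : HSBound K a b γ ω) : HSBound (K + C) (a + a') (b + b') γ ω' := by
  intro t
  have h1 : γ t - ω' t = (γ t - ω t) + (ω t - ω' t) := by abel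
  rw [h1]
  refine (hsNorm_add_le _ _).trans
    ((add_le_add (h t) ((hsNorm_le_traceNorm _).trans (hδ t))).trans ?_)
  rw [← ENNReal.ofReal_add (doubleExp_nonneg hK _ _ _) (doubleExp_nonneg hC _ _ _)]
  exact ENNReal.ofReal_le_ofReal (doubleExp_add_le hK hC ha hb ha' hb' t)

theorem TraceBound.transfer (hN : 1 ≤ N) {r : ℝ} (hr : 0 ≤ r) (h : TraceBound N r K a b γ ω) :
    TraceBound N r (K + C) (a + a') (b + b') γ ω' := by
  intro t
  have h1 : γ t - ω' t = (γ t - ω t) + (ω t - ω' t) := by abel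
  have hNr : 1 ≤ (N : ℝ) ^ r := Real.one_le_rpow (by exact_mod_cast hN) hr
  have hK1 := doubleExp_nonneg hK a b t
  have hC1 := doubleExp_nonneg hC a' b' t
  rw [h1]
  refine (traceNorm_add_le _ _).trans ((add_le_add (h t) (hδ t)).trans ?_)
  rw [← ENNReal.ofReal_add (by positivity) hC1]
  refine ENNReal.ofReal_le_ofReal ?_
  calc _ ≤ (N : ℝ) ^ r * doubleExp K a b t + (N : ℝ) ^ r * doubleExp C a' b' t := by
        gcongr
        exact le_mul_of_one_le_left hC1 hNr
    _ = (N : ℝ) ^ r * (doubleExp K a b t + doubleExp C a' b' t) := by ring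
    _ ≤ _ := by
        gcongr
        exact doubleExp_add_le hK hC ha hb ha' hb' t

/-- Trace class assumptions are needed here to make `opTrace` additive. The Weyl operator is a
contraction, and the weight in `q`, `p` is at least one. -/
theorem ObservableBound.transfer (hγ : ∀ t, traceNorm (γ t) < ∞) (hω : ∀ t, traceNorm (ω t) < ∞)
    (h : ObservableBound N K a b γ ω) :
    ObservableBound N (K + C) (a + a') (b + b') γ ω' := by
  intro q p t
  set W := weylOp (planck N) q p
  have h1 : W * (γ t - ω' t) = W * (γ t - ω t) + W * (ω t - ω' t) := by
    rw [← mul_add]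
    congr 1
    abel
  have hx : 1 ≤ (1 + ‖q‖ + ‖p‖) ^ (1 / 2 : ℝ) :=
    Real.one_le_rpow (by linarith [norm_nonneg q, norm_nonneg p]) (by norm_num)
  have hC1 := doubleExp_nonneg hC a' b' t
  have h2 := (traceNorm_weylOp_mul_le (planck N) q p (ω t - ω' t)).trans (hδ t)
  have h3 : traceNorm (W * (γ t - ω t)) < ∞ := (traceNorm_weylOp_mul_le _ _ _ _).trans_lt
    ((traceNorm_sub_le _ _).trans_lt (ENNReal.add_lt_top.2 ⟨hγ t, hω t⟩))
  have h4 : ‖opTrace (W * (ω t - ω' t))‖ ≤ doubleExp C a' b' t := by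
    have := (enorm_opTrace_le _).trans h2
    rwa [← ofReal_norm, ENNReal.ofReal_le_ofReal_iff hC1] at this
  rw [h1, opTrace_add h3 (h2.trans_lt ENNReal.ofReal_lt_top)]
  refine (norm_add_le _ _).trans ((add_le_add (h q p t) h4).trans ?_)
  calc _ ≤ (1 + ‖q‖ + ‖p‖) ^ (1 / 2 : ℝ) * doubleExp K a b t +
        (1 + ‖q‖ + ‖p‖) ^ (1 / 2 : ℝ) * doubleExp C a' b' t := by
        gcongr
        exact le_mul_of_one_le_left hC1 hx
    _ = (1 + ‖q‖ + ‖p‖) ^ (1 / 2 : ℝ) * (doubleExp K a b t + doubleExp C a' b' t) := by ring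
    _ ≤ _ := by
        gcongr
        exact doubleExp_add_le hK hC ha hb ha' hb' t

end Transfer

end Main

end

theorem propositionA1
    (V : R3 → ℝ) (hV : Integrable V) (hVeven : ∀ᵐ x : R3, V (-x) = V x)
    (hVhat : Integrable fun p : R3 => (1 + ‖p‖) ^ 2 * ‖𝓕 (fun x : R3 => (V x : ℂ)) p‖) :
    ∃ C > 0, ∃ c₂ > 0, ∀ C₀ > 0, ∃ c₁ > 0,
      -- the trace norm distance of the two evolutions
      (∀ N : ℕ, 1 ≤ N → ∀ ωN : Op, IsSemiclassicalProjection N C₀ ωN →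
        ∀ ω ω' : ℝ → Op, IsHartreeFockSolution N V ωN ω → IsHartreeSolution N V ωN ω' →
          ∀ t : ℝ, traceNorm (ω t - ω' t) ≤
            ENNReal.ofReal (C * Real.exp (c₁ * Real.exp (c₂ * |t|)))) ∧
      -- every bound on the distance to the first evolution carries over to the second
      (∀ K > 0, ∀ a > 0, ∀ b > 0, ∃ K' > 0, ∃ a' > 0, ∃ b' > 0,
        ∀ N : ℕ, 1 ≤ N → ∀ ωN : Op, IsSemiclassicalProjection N C₀ ωN →
        ∀ ω ω' : ℝ → Op, IsHartreeFockSolution N V ωN ω → IsHartreeSolution N V ωN ω' →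
        ∀ γ : ℝ → Op, (∀ t, traceNorm (γ t) < ∞) →
          (HSBound K a b γ ω → HSBound K' a' b' γ ω') ∧
          (TraceBound N (1 / 2) K a b γ ω → TraceBound N (1 / 2) K' a' b' γ ω') ∧
          (TraceBound N (1 / 6) K a b γ ω → TraceBound N (1 / 6) K' a' b' γ ω') ∧
          (ObservableBound N K a b γ ω → ObservableBound N K' a' b' γ ω')) := by
  have hc₂ : 0 < 2 * forceConst V + 4 := by linarith [forceConst_nonneg V]
  -- Since the solutions agree at `t = 0`, `C = 1` is enough. `c₂` is the rate of the semiclassical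
  -- bound, independent of `C₀`; only `c₁` depends on `C₀`.
  refine ⟨1, one_pos, 2 * forceConst V + 4, hc₂, fun C₀ hC₀ => ?_⟩
  have hrate : 0 < comparisonRate V C₀ := by
    have := potentialConst_nonneg V
    rw [comparisonRate]
    positivity
  have hc₁ : 0 < comparisonRate V C₀ / (2 * forceConst V + 4) := div_pos hrate hc₂
  have hdist : ∀ N : ℕ, 1 ≤ N → ∀ ωN : Op, IsSemiclassicalProjection N C₀ ωN →
      ∀ ω ω' : ℝ → Op, IsHartreeFockSolution N V ωN ω → IsHartreeSolution N V ωN ω' →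
        ∀ t : ℝ, traceNorm (ω t - ω' t) ≤ ENNReal.ofReal (doubleExp 1
          (comparisonRate V C₀ / (2 * forceConst V + 4)) (2 * forceConst V + 4) t) := by
    intro N hN ωN hωN ω ω' h h' t
    rw [doubleExp, one_mul]
    exact traceNorm_sub_le_exp hN hV hVeven hVhat hC₀.le hωN h h' t
  refine ⟨_, hc₁, hdist, fun K hK a ha b hb => ⟨K + 1, by positivity, _, add_pos ha hc₁, _,
    add_pos hb hc₂, fun N hN ωN hωN ω ω' h h' γ hγ => ?_⟩⟩
  have hδ := hdist N hN ωN hωN ω ω' h h'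
  exact ⟨fun hγω => hγω.transfer hK.le zero_le_one ha.le hb.le hc₁.le hc₂.le hδ,
    fun hγω => hγω.transfer hK.le zero_le_one ha.le hb.le hc₁.le hc₂.le hδ hN (by norm_num),
    fun hγω => hγω.transfer hK.le zero_le_one ha.le hb.le hc₁.le hc₂.le hδ hN (by norm_num),
    fun hγω => hγω.transfer hK.le zero_le_one ha.le hb.le hc₁.le hc₂.le hδ hγ h.1.traceClass⟩
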